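/- Let $(M^{2m+1},H(M),J,\theta)$ be a pseudo-Hermitian manifold: $M$ is a $(2m+1)$-dimensional $C^\infty$ manifold, $\theta$ is a nowhere vanishing smooth 1-form with $H(M)=\ker\theta$, $(H(M),J)$ is an integrable CR structure, and the Levi form $L_\theta(X,Y)=d\theta(X,JY)$ is positive definite on $H(M)$. Let $\xi$ be the Reeb vector field ($\theta(\xi)=1$, $d\theta(\xi,\cdot)=0$), extend $J$ by $J\xi=0$, let $\pi_H:TM\to H(M)$ be the projection along $\xi$, and let $\langle X,Y\rangle=\theta(X)\theta(Y)+L_\theta(\pi_HX,\pi_HY)$ be the Webster metric. Here $d\theta(X,Y)=X\theta(Y)-Y\theta(X)-\theta([X,Y])$. Let $\nabla$ be the Tanaka–Webster connection, i.e. the unique linear connection which preserves $H(M)$, for which the Webster metric and $J$ are parallel, and whose torsion $T$ satisfies $T(X,Y)=d\theta(X,Y)\xi$ and $T(\xi,JX)+JT(\xi,X)=0$ for all horizontal $X,Y$ (vectors in $H(M)$). Let $R$ be its curvature, $R(X,Y)Z=\nabla_X\nabla_YZ-\nabla_Y\nabla_XZ-\nabla_{[X,Y]}Z$, and for linearly independent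 horizontal vectors $X,Y$ let $$K^H(X,Y)=\frac{\langle R(X,Y)Y,X\rangle}{\langle X,X\rangle\langle Y,Y\rangle-\langle X,Y\rangle^2}.$$ Let $\exp_p^\nabla$ be the exponential map of $\nabla$ at $p$: $\exp_p^\nabla(v)=\gamma_v(1)$ for the $\nabla$-geodesic $\gamma_v$ with $\gamma_v(0)=p$, $\gamma_v'(0)=v$. For a $\nabla$-geodesic $\gamma$ and parameters $a\neq b$ in its interval of definition, the point $\gamma(b)$ is called conjugate to $\gamma(a)$ along $\gamma$ if the differential of $\exp^\nabla_{\gamma(a)}$ at $(b-a)\gamma'(a)$ is singular. **Theorem 4.4.** Suppose that $M$ is a Sasakian manifold, i.e. $T(\xi,X)=0$ for all $X\in TM$, and that $K^H\le 0$. Then for every $\nabla$-geodesic $\gamma:[0,\beta]\to M$, $\beta>0$, no point $\gamma(t)$ with $t\in(0,\beta]$ is conjugate to $\gamma(0)$ along $\gamma$. Consequently, if moreover $\nabla$ is complete (every $\nabla$-geodesic extends to a $\nabla$-geodesic defined on $\mathbb R$), then $M$ has no conjugate points along any $\nabla$-geodesic: for every $\nabla$-geodesic $\gamma$ and all parameters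 $a\ne b$, the point $\gamma(b)$ is not conjugate to $\gamma(a)$ along $\gamma$. -/

import Mathlib

open Bundle Set VectorField FiberBundle
open scoped Manifold ContDiff Topology

set_option linter.unusedSectionVars false
set_option linter.unusedVariables false

noncomputable section

/-! ## One-forms and linear connections on a manifold -/

namespace Connection

variable {E : Type*} [NormedAddCommGroup E] [NormedSpace ℝ E] [FiniteDimensional ℝ E]
  {H : Type*} [TopologicalSpace H] {I : ModelWithCorners ℝ E H}
  {M : Type*} [TopologicalSpace M] [ChartedSpace H M] [IsManifold I ∞ M]

/-- The vector field `X` is differentiable at `x`. -/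
abbrev DifferentiableVectorFieldAt (X : Π x : M, TangentSpace I x) (x : M) : Prop :=
  MDiffAt (T% X) x

/-- A one-form `θ` is smooth, as a section of the cotangent bundle. -/
def IsSmoothOneForm (θ : Π x : M, TangentSpace I x →L[ℝ] ℝ) : Prop :=
  ContMDiff I (I.prod 𝓘(ℝ, E →L[ℝ] ℝ)) ∞
    (fun x ↦ TotalSpace.mk' (E →L[ℝ] ℝ) (E := fun x : M ↦ TangentSpace I x →L[ℝ] ℝ) x (θ x))

/-- A `(1,1)`-tensor field `J` is smooth, as a section of `End TM`. -/
def IsSmoothEndomorphism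
    (J : Π x : M, TangentSpace I x →L[ℝ] TangentSpace I x) : Prop :=
  ContMDiff I (I.prod 𝓘(ℝ, E →L[ℝ] E)) ∞
    (fun x ↦ TotalSpace.mk' (E →L[ℝ] E)
      (E := fun x : M ↦ TangentSpace I x →L[ℝ] TangentSpace I x) x (J x))

/-- The expression `X(θ(Y)) - Y(θ(X)) - θ([X, Y])` at the point `x`. -/
def exteriorDerivAux (θ : Π x : M, TangentSpace I x →L[ℝ] ℝ)
    (X Y : Π x : M, TangentSpace I x) (x : M) : ℝ :=
  mvfderiv I (fun y ↦ θ y (Y y)) x (X x) - mvfderiv I (fun y ↦ θ y (X y)) x (Y x)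
    - θ x (mlieBracket I X Y x)

section exteriorDeriv

variable {θ : Π x : M, TangentSpace I x →L[ℝ] ℝ}

theorem IsSmoothOneForm.mdifferentiableAt_apply (hθ : IsSmoothOneForm θ)
    {X : Π x : M, TangentSpace I x} {x : M} (hX : MDiffAt (T% X) x) :
    MDiffAt (fun y ↦ θ y (X y)) x := by
  have h1 := (hθ x).mdifferentiableAt (by simp)
  have h2 := MDifferentiableAt.clm_bundle_apply (F₂ := ℝ) (E₂ := Bundle.Trivial M ℝ)
    (b := fun y : M ↦ y) h1 hX
  rw [mdifferentiableAt_section] at h2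
  simpa using! h2

theorem exteriorDerivAux_swap (X Y : Π x : M, TangentSpace I x) (x : M) :
    exteriorDerivAux θ X Y x = - exteriorDerivAux θ Y X x := by
  simp only [exteriorDerivAux]
  rw [mlieBracket_swap_apply, map_neg]
  ring

theorem exteriorDerivAux_tensorial_left (hθ : IsSmoothOneForm θ)
    (Y : Π x : M, TangentSpace I x) (x : M) (hY : MDiffAt (T% Y) x) :
    TensorialAt I E (fun X ↦ exteriorDerivAux θ X Y x) x where
  smul {f X} hf hX := by
    have h : (fun y ↦ θ y ((f • X) y)) = f * fun y ↦ θ y (X y) := by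
      ext y; simp
    simp only [exteriorDerivAux]
    rw [mlieBracket_smul_left hf hX, h, mvfderiv_mul hf (hθ.mdifferentiableAt_apply hX)]
    simp
    ring
  add {X X'} hX hX' := by
    have h : (fun y ↦ θ y ((X + X') y)) = (fun y ↦ θ y (X y)) + fun y ↦ θ y (X' y) := by
      ext y; simp
    simp only [exteriorDerivAux]
    rw [mlieBracket_add_left hX hX', h,
      mvfderiv_add (hθ.mdifferentiableAt_apply hX) (hθ.mdifferentiableAt_apply hX')]
    simp
    ring

theorem exteriorDerivAux_tensorial_right (hθ : IsSmoothOneForm θ)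
    (X : Π x : M, TangentSpace I x) (x : M) (hX : MDiffAt (T% X) x) :
    TensorialAt I E (fun Y ↦ exteriorDerivAux θ X Y x) x where
  smul {f Y} hf hY := by
    rw [exteriorDerivAux_swap, (exteriorDerivAux_tensorial_left hθ X x hX).smul hf hY,
      exteriorDerivAux_swap Y X]
    simp
  add {Y Y'} hY hY' := by
    rw [exteriorDerivAux_swap, (exteriorDerivAux_tensorial_left hθ X x hX).add hY hY',
      exteriorDerivAux_swap Y X, exteriorDerivAux_swap Y' X]
    ring

/-- The exterior derivative of a smooth one-form,
`dθ(X, Y) = X(θ(Y)) - Y(θ(X)) - θ([X, Y])`, as a bilinear form on each tangent space. -/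
def exteriorDeriv (θ : Π x : M, TangentSpace I x →L[ℝ] ℝ) (hθ : IsSmoothOneForm θ) (x : M) :
    TangentSpace I x →L[ℝ] TangentSpace I x →L[ℝ] ℝ :=
  TensorialAt.mkHom₂ (fun X Y ↦ exteriorDerivAux θ X Y x) x
    (fun Y hY ↦ exteriorDerivAux_tensorial_left hθ Y x hY)
    (fun X hX ↦ exteriorDerivAux_tensorial_right hθ X x hX)

theorem exteriorDeriv_apply (hθ : IsSmoothOneForm θ) {X Y : Π x : M, TangentSpace I x} {x : M}
    (hX : MDiffAt (T% X) x) (hY : MDiffAt (T% Y) x) :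
    exteriorDeriv θ hθ x (X x) (Y x) =
      mvfderiv I (fun y ↦ θ y (Y y)) x (X x) - mvfderiv I (fun y ↦ θ y (X y)) x (Y x)
        - θ x (mlieBracket I X Y x) :=
  TensorialAt.mkHom₂_apply _ _ hX hY

theorem exteriorDeriv_self (hθ : IsSmoothOneForm θ) (x : M) (v : TangentSpace I x) :
    exteriorDeriv θ hθ x v v = 0 := by
  have h : exteriorDeriv θ hθ x v v =
      exteriorDerivAux θ (extend E v) (extend E v) x := rfl
  have h' := exteriorDerivAux_swap (θ := θ) (extend E v) (extend E v) x
  rw [h]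
  linarith

end exteriorDeriv

variable (cov : CovariantDerivative I E (TangentSpace I : M → Type _))

/-- The vector field `R(X, Y)Z = ∇_X ∇_Y Z - ∇_Y ∇_X Z - ∇_[X,Y] Z`.
Recall that `cov Z y v` is `∇_v Z` at the point `y`. -/
def curvatureField (X Y Z : Π x : M, TangentSpace I x) (x : M) : TangentSpace I x :=
  cov (fun y ↦ cov Z y (Y y)) x (X x) - cov (fun y ↦ cov Z y (X y)) x (Y x)
    - cov Z x (mlieBracket I X Y x)

/-- The curvature tensor `R(u, v)w` of a smooth connection on tangent vectors at `x`: it is computed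
from vector fields which are smooth near `x` and extend `u`, `v`, `w`; the value does not depend on
the extensions, by tensoriality. -/
def curvature (x : M) (u v w : TangentSpace I x) : TangentSpace I x :=
  curvatureField cov (extend E u) (extend E v) (extend E w) x

variable (I) in
/-- The velocity `γ'(t)` of a curve `γ` defined on the set `s` of parameters. -/
def velocity (γ : ℝ → M) (s : Set ℝ) (t : ℝ) : TangentSpace I (γ t) :=
  mfderivWithin 𝓘(ℝ, ℝ) I γ s t (1 : ℝ)

/-- The vector field `V` along the curve `γ : s → M` has covariant derivative `W` at the parameter
`t₀`. With the vector bundle trivialized near `γ t₀`, and the vector `V t₀` extended to the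
vector field `extend E (V t₀)` that is constant in this trivialization, the covariant derivative is
the sum of the ordinary derivative of `V` in the trivialization
and of `∇_{γ'(t₀)} (extend E (V t₀))`, i.e. of `dV^k/dt + Γ^k_{ij} (γ^i)' V^j` in coordinates. -/
def HasCovDerivAlongAt (γ : ℝ → M) (V : Π t : ℝ, TangentSpace I (γ t)) (s : Set ℝ) (t₀ : ℝ)
    (W : TangentSpace I (γ t₀)) : Prop :=
  HasDerivWithinAt
    (fun t ↦ (trivializationAt E (TangentSpace I : M → Type _) (γ t₀)
      (⟨γ t, V t⟩ : TangentBundle I M)).2)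
    (trivializationAt E (TangentSpace I : M → Type _) (γ t₀)
      (⟨γ t₀, W - cov (extend E (V t₀)) (γ t₀) (velocity I γ s t₀)⟩ : TangentBundle I M)).2
    s t₀

/-- The curve `γ`, defined on the interval `s`, is a geodesic of the connection:
it is `C^1` and `∇_{γ'} γ' = 0` on `s`. -/
def IsGeodesicOn (γ : ℝ → M) (s : Set ℝ) : Prop :=
  ContMDiffOn 𝓘(ℝ, ℝ) I 1 γ s ∧
    ∀ t ∈ s, HasCovDerivAlongAt cov γ (velocity I γ s) s t 0

/-- `γ : [0, 1] → M` is a geodesic with `γ(0) = p` and `γ'(0) = v`. -/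
def IsGeodesicFrom (p : M) (v : TangentSpace I p) (γ : ℝ → M) : Prop :=
  IsGeodesicOn cov γ (Icc 0 1) ∧
    (⟨γ 0, velocity I γ (Icc 0 1) 0⟩ : TangentBundle I M) = ⟨p, v⟩

open Classical in
/-- The exponential map: `exp_p(v) = γ_v(1)`, where `γ_v` is the geodesic with `γ_v(0) = p` and
`γ_v'(0) = v`, for all `v` such that `γ_v` is defined on `[0, 1]`
(and the value `p`, without significance, for other `v`). -/
def expMap (p : M) (v : TangentSpace I p) : M :=
  if h : ∃ γ : ℝ → M, IsGeodesicFrom cov p v γ then h.choose 1 else p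

/-- The differential of `exp_p` at `v`; here `T_p M`, and `T_v (T_p M)`, are identified with the
model vector space `E`, which they are by definition. -/
def dExp (p : M) (v : TangentSpace I p) : E →L[ℝ] TangentSpace I (expMap cov p v) :=
  mfderiv 𝓘(ℝ, E) I (fun w : E ↦ expMap cov p (w : TangentSpace I p)) (v : E)

/-- For a geodesic `γ : s → M` and parameters `a ≠ b` in the interval `s`: the point `γ(b)` is
conjugate to `γ(a)` along `γ`, that is, `d exp_{γ(a)}` is singular at the vector `(b - a) γ'(a)`,
which is the initial velocity of the part of `γ` from `γ(a)` to `γ(b)`, reparametrized by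
`[0, 1]`. -/
def IsConjugateAlong (γ : ℝ → M) (s : Set ℝ) (a b : ℝ) : Prop :=
  ¬ Function.Injective (dExp cov (γ a) ((b - a) • velocity I γ s a))

/-- A connection is complete if every geodesic extends to a geodesic defined on `ℝ`. -/
def IsCompleteConnection : Prop :=
  ∀ (l : ℝ) (γ : ℝ → M), 0 < l → IsGeodesicOn cov γ (Icc 0 l) →
    ∃ γ₁ : ℝ → M, IsGeodesicOn cov γ₁ univ ∧ EqOn γ₁ γ (Icc 0 l)

end Connection

/-! ## Pseudo-Hermitian manifolds -/

open Connection

/-- A pseudo-Hermitian structure `(H(M), J, θ)` on a manifold `M` of dimension `2m+1`: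
a strictly pseudoconvex CR structure `(H(M), J)` with a one-form `θ` such that `H(M) = ker θ`
and such that the Levi form `L_θ(X, Y) = dθ(X, JY)` is positive definite on `H(M)`. The complex
structure `J` of `H(M)` is extended to `TM` by zero on the line bundle `{v | dθ(v, ·) = 0}`,
which is spanned by the Reeb vector field. -/
structure PseudoHermitianStructure (m : ℕ) (M : Type*) [TopologicalSpace M]
    [ChartedSpace (EuclideanSpace ℝ (Fin (2 * m + 1))) M]
    [IsManifold (𝓡 (2 * m + 1)) ∞ M] where
  /-- the contact form -/
  θ : Π x : M, TangentSpace (𝓡 (2 * m + 1)) x →L[ℝ] ℝ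
  smooth_θ : IsSmoothOneForm θ
  θ_ne_zero : ∀ x, θ x ≠ 0
  /-- the complex structure of `H(M) = ker θ`, extended to `TM` -/
  J : Π x : M, TangentSpace (𝓡 (2 * m + 1)) x →L[ℝ] TangentSpace (𝓡 (2 * m + 1)) x
  smooth_J : IsSmoothEndomorphism J
  J_mem : ∀ x v, θ x v = 0 → θ x (J x v) = 0
  J_J : ∀ x v, θ x v = 0 → J x (J x v) = - v
  J_radical : ∀ x v, (∀ w, exteriorDeriv θ smooth_θ x v w = 0) → J x v = 0
  /-- Integrability, i.e. `[Γ(H^{1,0}), Γ(H^{1,0})] ⊆ Γ(H^{1,0})` for the bundle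
  `H^{1,0} = {V - i J V | V ∈ H(M)}`: the bracket of `X - i J X` and `Y - i J Y` is
  `A - i B` with `A = [X, Y] - [JX, JY]` and `B = [JX, Y] + [X, JY]`, and it is required that
  `A` is horizontal and that `B = J A`. -/
  integrable : ∀ (X Y : Π x : M, TangentSpace (𝓡 (2 * m + 1)) x) (x : M),
    (∀ y, θ y (X y) = 0) → (∀ y, θ y (Y y) = 0) → DifferentiableVectorFieldAt X x → DifferentiableVectorFieldAt Y x →
    θ x (mlieBracket (𝓡 (2 * m + 1)) X Y x
        - mlieBracket (𝓡 (2 * m + 1)) (fun y ↦ J y (X y)) (fun y ↦ J y (Y y)) x) = 0 ∧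
      mlieBracket (𝓡 (2 * m + 1)) (fun y ↦ J y (X y)) Y x
          + mlieBracket (𝓡 (2 * m + 1)) X (fun y ↦ J y (Y y)) x =
        J x (mlieBracket (𝓡 (2 * m + 1)) X Y x
          - mlieBracket (𝓡 (2 * m + 1)) (fun y ↦ J y (X y)) (fun y ↦ J y (Y y)) x)
  levi_pos : ∀ x v, θ x v = 0 → v ≠ 0 → 0 < exteriorDeriv θ smooth_θ x v (J x v)

namespace PseudoHermitianStructure

variable {m : ℕ} {M : Type*} [TopologicalSpace M]
  [ChartedSpace (EuclideanSpace ℝ (Fin (2 * m + 1))) M] [IsManifold (𝓡 (2 * m + 1)) ∞ M]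
  (P : PseudoHermitianStructure m M)

/-- The exterior derivative of the contact form. -/
def dθ (x : M) :
    TangentSpace (𝓡 (2 * m + 1)) x →L[ℝ] TangentSpace (𝓡 (2 * m + 1)) x →L[ℝ] ℝ :=
  exteriorDeriv P.θ P.smooth_θ x

/-- A tangent vector is horizontal if it lies in `H(M) = ker θ`. -/
def IsHorizontal (x : M) (v : TangentSpace (𝓡 (2 * m + 1)) x) : Prop := P.θ x v = 0

theorem existsUnique_reeb (x : M) :
    ∃! v : TangentSpace (𝓡 (2 * m + 1)) x, P.θ x v = 1 ∧ ∀ w, P.dθ x v w = 0 := by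
  have hself : ∀ v, P.dθ x v v = 0 := exteriorDeriv_self P.smooth_θ x
  have hJ := P.J_mem x
  have hpos : ∀ v, P.θ x v = 0 → v ≠ 0 → 0 < P.dθ x v (P.J x v) := P.levi_pos x
  -- the kernel of `θ`, and the restriction of `dθ` to it, as a map to the dual
  obtain ⟨v₀, hv₀⟩ : ∃ v, P.θ x v = 1 := by
    obtain ⟨w, hw⟩ : ∃ w, P.θ x w ≠ 0 := by
      by_contra! h
      exact P.θ_ne_zero x (by ext w; simpa using h w)
    exact ⟨(P.θ x w)⁻¹ • w, by simp [hw]⟩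
  let K : Submodule ℝ (TangentSpace (𝓡 (2 * m + 1)) x) := LinearMap.ker (P.θ x).toLinearMap
  have : FiniteDimensional ℝ (TangentSpace (𝓡 (2 * m + 1)) x) :=
    inferInstanceAs (FiniteDimensional ℝ (EuclideanSpace ℝ (Fin (2 * m + 1))))
  let L : TangentSpace (𝓡 (2 * m + 1)) x →ₗ[ℝ] Module.Dual ℝ K :=
    { toFun := fun v ↦ (P.dθ x v).toLinearMap ∘ₗ K.subtype
      map_add' := fun u v ↦ by ext w; simp
      map_smul' := fun c v ↦ by ext w; simp }
  have hL : ∀ v (w : K), L v w = P.dθ x v w := fun v w ↦ rfl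
  have hinj : Function.Injective (L ∘ₗ K.subtype) := by
    rw [← LinearMap.ker_eq_bot, LinearMap.ker_eq_bot']
    rintro ⟨v, hv⟩ h
    by_contra hne
    have h0 : v ≠ 0 := fun h ↦ hne (by simpa using h)
    have h1 := hpos v hv h0
    have h2 : L v ⟨P.J x v, hJ v hv⟩ = 0 := by
      have := congrArg (fun f ↦ f ⟨P.J x v, hJ v hv⟩) h
      simpa using this
    rw [hL] at h2
    exact h1.ne' h2
  have hsurj : Function.Surjective (L ∘ₗ K.subtype) :=
    (LinearMap.injective_iff_surjective_of_finrank_eq_finrank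
      (Subspace.dual_finrank_eq (K := ℝ) (V := K)).symm).1 hinj
  obtain ⟨⟨k, hk⟩, hkL⟩ := hsurj (L v₀)
  have hk' : P.θ x k = 0 := hk
  have hker : ∀ w, P.θ x w = 0 → P.dθ x (v₀ - k) w = 0 := by
    intro w hw
    have := congrArg (fun f ↦ f ⟨w, hw⟩) hkL
    have h3 : P.dθ x k w = P.dθ x v₀ w := this
    simp [h3]
  have hall : ∀ w, P.dθ x (v₀ - k) w = 0 := by
    intro w
    have h1 := hker (w - P.θ x w • (v₀ - k)) (by simp [hv₀, hk'])
    rw [map_sub, map_smul, hself] at h1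
    simpa using h1
  refine ⟨v₀ - k, ⟨by simp [hv₀, hk'], hall⟩, ?_⟩
  rintro v ⟨hv1, hv2⟩
  by_contra hne
  have h1 := hpos (v - (v₀ - k)) (by simp [hv1, hv₀, hk']) (sub_ne_zero.2 hne)
  rw [map_sub] at h1
  simp only [sub_apply] at h1
  rw [hv2, hall] at h1
  simp at h1

/-- The Reeb vector field, characterized by `θ(ξ) = 1` and `dθ(ξ, ·) = 0`. -/
def reeb (x : M) : TangentSpace (𝓡 (2 * m + 1)) x := (P.existsUnique_reeb x).choose

theorem reeb_spec (x : M) : P.θ x (P.reeb x) = 1 ∧ ∀ w, P.dθ x (P.reeb x) w = 0 :=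
  (P.existsUnique_reeb x).choose_spec.1

/-- The projection `π_H : TM → H(M)` along the Reeb vector field. -/
def projH (x : M) (v : TangentSpace (𝓡 (2 * m + 1)) x) : TangentSpace (𝓡 (2 * m + 1)) x :=
  v - P.θ x v • P.reeb x

/-- The Webster metric `g_θ = θ ⊗ θ + G_θ`, where `G_θ(u, v) = L_θ(π_H u, π_H v)` and
`L_θ(u, v) = dθ(u, J v)`. -/
def webster (x : M) (u v : TangentSpace (𝓡 (2 * m + 1)) x) : ℝ :=
  P.θ x u * P.θ x v + P.dθ x (P.projH x u) (P.J x (P.projH x v))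

/-- The connection is the Tanaka-Webster connection of the pseudo-Hermitian manifold. As is usual
for connections in Mathlib, the conditions are stated for vector fields which are differentiable at
the point in question; by the Leibniz rule it would be the same to state them for smooth ones. -/
structure IsTanakaWebster
    (cov : CovariantDerivative (𝓡 (2 * m + 1)) (EuclideanSpace ℝ (Fin (2 * m + 1)))
      (TangentSpace (𝓡 (2 * m + 1)) : M → Type _)) : Prop where
  smooth : CovariantDerivative.ContMDiffCovariantDerivative cov ∞
  /-- `∇_v Γ(H(M)) ⊆ Γ(H(M))` -/
  horizontal : ∀ (X : Π x : M, TangentSpace (𝓡 (2 * m + 1)) x) (x : M) (v),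
    (∀ y, P.IsHorizontal y (X y)) → DifferentiableVectorFieldAt X x → P.IsHorizontal x (cov X x v)
  /-- `∇ g_θ = 0` -/
  metric : ∀ (X Y : Π x : M, TangentSpace (𝓡 (2 * m + 1)) x) (x : M) (v),
    DifferentiableVectorFieldAt X x → DifferentiableVectorFieldAt Y x →
    mvfderiv (𝓡 (2 * m + 1)) (fun y ↦ P.webster y (X y) (Y y)) x v =
      P.webster x (cov X x v) (Y x) + P.webster x (X x) (cov Y x v)
  /-- `∇ J = 0` -/
  parallel_J : ∀ (X : Π x : M, TangentSpace (𝓡 (2 * m + 1)) x) (x : M) (v),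
    DifferentiableVectorFieldAt X x → cov (fun y ↦ P.J y (X y)) x v = P.J x (cov X x v)
  /-- purity of the torsion on horizontal vectors -/
  torsion_horizontal : ∀ (x : M) (u v), P.IsHorizontal x u → P.IsHorizontal x v →
    cov.torsion x u v = P.dθ x u v • P.reeb x
  /-- purity of the torsion on the Reeb vector field -/
  torsion_reeb : ∀ (x : M) (v), P.IsHorizontal x v →
    cov.torsion x (P.reeb x) (P.J x v) + P.J x (cov.torsion x (P.reeb x) v) = 0

variable (cov : CovariantDerivative (𝓡 (2 * m + 1)) (EuclideanSpace ℝ (Fin (2 * m + 1)))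
  (TangentSpace (𝓡 (2 * m + 1)) : M → Type _))

/-- The pseudo-Hermitian torsion `τ(v) = T_∇(ξ, v)` of the Tanaka-Webster connection `∇`. -/
def pseudoHermitianTorsion (x : M) (v : TangentSpace (𝓡 (2 * m + 1)) x) :
    TangentSpace (𝓡 (2 * m + 1)) x :=
  cov.torsion x (P.reeb x) v

/-- A pseudo-Hermitian manifold, with Tanaka-Webster connection `∇`, is a Sasakian manifold if its
pseudo-Hermitian torsion is zero. -/
def IsSasakian : Prop :=
  ∀ (x : M) (v : TangentSpace (𝓡 (2 * m + 1)) x), P.pseudoHermitianTorsion cov x v = 0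

/-- The horizontal sectional curvature
`K^H(P) = ⟨R(u, v)v, u⟩ / (⟨u, u⟩⟨v, v⟩ - ⟨u, v⟩²)` of the plane `P` spanned by the linearly
independent horizontal vectors `u`, `v`; here `R` is the curvature of the Tanaka-Webster connection
and `⟨·, ·⟩` is the Webster metric. -/
def horizontalSectionalCurvature (x : M) (u v : TangentSpace (𝓡 (2 * m + 1)) x) : ℝ :=
  P.webster x (curvature cov x u v v) u /
    (P.webster x u u * P.webster x v v - P.webster x u v ^ 2)

/-- `K^H ≤ 0`: all horizontal planes have nonpositive sectional curvature. -/
def HasNonposHorizontalCurvature : Prop :=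
  ∀ (x : M) (u v : TangentSpace (𝓡 (2 * m + 1)) x), P.IsHorizontal x u → P.IsHorizontal x v →
    LinearIndependent ℝ ![u, v] → P.horizontalSectionalCurvature cov x u v ≤ 0

end PseudoHermitianStructure

end

/-! Let y be the velocity of a geodesic, j the variation field of a family of geodesics around it,
and Y = ∇_j y. In the Sasakian case the torsion is T(u, v) = dθ(u, v)ξ for all vectors u, v. Hence
∇_y j = Y + dθ(y, j)ξ, and interchanging the derivatives gives ∇_y Y = R(y, j)y. The form G(u, v) =
dθ(u, Jv) is parallel, semidefinite, and has kernel spanned by ξ, so G(j, j)' = 2G(j, Y) and G(j,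
j)'' = 2(G(Y, Y) + G(j, R(y, j)y)).

The curvature term is nonnegative (`G_curv_nonneg`). Since ξ is parallel, R(·, ·)ξ = 0. Since T is
parallel and T(T(·, ·), ·) = 0, the first Bianchi identity has its torsion-free form. Together with
the skewness of R this yields G(R(ξ, ·)·, ·) = 0, so only the horizontal parts of y and j matter,
and for these the sign is that of -K^H.

If j vanishes at 0 and 1, the nonnegative convex function G(j, j) vanishes on [0, 1], so j is a
multiple of ξ there and dθ(y, j) = 0. Then θ(j)' = θ(Y), which is constant because R takes values in
ker θ. So θ(j) is affine with two zeros, and j = 0 (`mfderiv_eq_zero`). For the variation field of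
the geodesics leaving a fixed point in the direction v + sw, the derivative of j at 0 is w.
Therefore d exp has trivial kernel (`injective_dExp`).

The rest ties this computation to the definitions. In a chart, geodesics are projections of integral
curves of a first-order vector field on phase space. Its local flow is differentiable in the initial
value (`exists_flow`), and the linearized flow is the Jacobi equation in coordinates. Flow boxes are
glued along [0, 1] by connectedness (`exists_of_isGeodesicOn`), and uniqueness of geodesics
identifies the time-one values of the resulting family with the exponential map (`expMap_eq`). -/

noncomputable section

/-! ## Ordinary differential equations: uniqueness and differentiability of the local flow -/

namespace ODEFlow

open Metric Filter

variable {E : Type*} [NormedAddCommGroup E] [NormedSpace ℝ E]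

/-- Two solutions of an autonomous equation which agree at a point agree near this point. -/
theorem eventuallyEq_of_eq {F : E → E} {f g : ℝ → E} {s : Set ℝ} {t : ℝ}
    (hs : s.OrdConnected) (ht : t ∈ s) (hF : ContDiffAt ℝ 1 F (f t))
    (hf : ∀ᶠ τ in 𝓝[s] t, HasDerivWithinAt f (F (f τ)) s τ)
    (hg : ∀ᶠ τ in 𝓝[s] t, HasDerivWithinAt g (F (g τ)) s τ) (hfg : f t = g t) :
    f =ᶠ[𝓝[s] t] g := by
  obtain ⟨K, V, hV, hK⟩ := hF.exists_lipschitzOnWith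
  have hfV : ∀ᶠ τ in 𝓝[s] t, f τ ∈ V := (hf.self_of_nhdsWithin ht).continuousWithinAt hV
  have hgV : ∀ᶠ τ in 𝓝[s] t, g τ ∈ V :=
    (hg.self_of_nhdsWithin ht).continuousWithinAt (hfg ▸ hV)
  obtain ⟨ε, hε, h⟩ := Metric.mem_nhdsWithin_iff.1 (hf.and (hg.and (hfV.and hgV)))
  refine Metric.mem_nhdsWithin_iff.2 ⟨ε, hε, ?_⟩
  rintro τ ⟨hτ, hτs⟩
  rw [Real.ball_eq_Ioo, mem_Ioo] at hτ
  -- The whole segment from t to τ stays in s and in the ε-neighbourhood, so the one-sided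
  -- uniqueness theorems apply on it, to the right or to the left of t.
  have key : ∀ r ∈ uIcc t τ, HasDerivWithinAt f (F (f r)) s r ∧ HasDerivWithinAt g (F (g r)) s r
      ∧ f r ∈ V ∧ g r ∈ V := by
    intro r hr
    refine h ⟨?_, hs.uIcc_subset ht hτs hr⟩
    rw [Real.ball_eq_Ioo, mem_Ioo]
    rw [mem_uIcc] at hr
    constructor <;> rcases hr with hr | hr <;> linarith [hr.1, hr.2, hτ.1, hτ.2]
  rcases le_total t τ with htτ | htτ
  · rw [uIcc_of_le htτ] at key
    have hsub : Icc t τ ⊆ s := hs.out ht hτs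
    refine ODE_solution_unique_of_mem_Icc_right (v := fun _ ↦ F) (s := fun _ ↦ V) (K := K)
      (fun _ _ ↦ hK) (fun r hr ↦ ((key r hr).1.mono hsub).continuousWithinAt) (fun r hr ↦ ?_)
      (fun r hr ↦ (key r (Ico_subset_Icc_self hr)).2.2.1)
      (fun r hr ↦ ((key r hr).2.1.mono hsub).continuousWithinAt) (fun r hr ↦ ?_)
      (fun r hr ↦ (key r (Ico_subset_Icc_self hr)).2.2.2) hfg (right_mem_Icc.2 htτ)
    · exact ((key r (Ico_subset_Icc_self hr)).1.mono hsub).mono_of_mem_nhdsWithin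
        (Icc_mem_nhdsGE_of_mem hr)
    · exact ((key r (Ico_subset_Icc_self hr)).2.1.mono hsub).mono_of_mem_nhdsWithin
        (Icc_mem_nhdsGE_of_mem hr)
  · rw [uIcc_of_ge htτ] at key
    have hsub : Icc τ t ⊆ s := hs.out hτs ht
    refine ODE_solution_unique_of_mem_Icc_left (v := fun _ ↦ F) (s := fun _ ↦ V) (K := K)
      (fun _ _ ↦ hK) (fun r hr ↦ ((key r hr).1.mono hsub).continuousWithinAt) (fun r hr ↦ ?_)
      (fun r hr ↦ (key r (Ioc_subset_Icc_self hr)).2.2.1)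
      (fun r hr ↦ ((key r hr).2.1.mono hsub).continuousWithinAt) (fun r hr ↦ ?_)
      (fun r hr ↦ (key r (Ioc_subset_Icc_self hr)).2.2.2) hfg (left_mem_Icc.2 htτ)
    · exact ((key r (Ioc_subset_Icc_self hr)).1.mono hsub).mono_of_mem_nhdsWithin
        (Icc_mem_nhdsLE_of_mem hr)
    · exact ((key r (Ioc_subset_Icc_self hr)).2.1.mono hsub).mono_of_mem_nhdsWithin
        (Icc_mem_nhdsLE_of_mem hr)

/-- Grönwall's inequality on a symmetric interval, for a function that vanishes at `0`. -/
theorem norm_le_of_norm_deriv_le {u u' : ℝ → E} {C η δ : ℝ} (hC : 0 < C) (hη : 0 ≤ η)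
    (hu : ∀ t ∈ Ioo (-δ) δ, HasDerivAt u (u' t) t) (h0 : u 0 = 0)
    (hb : ∀ t ∈ Ioo (-δ) δ, ‖u' t‖ ≤ C * ‖u t‖ + η) {t : ℝ} (ht : t ∈ Ioo (-δ) δ) :
    ‖u t‖ ≤ η * (Real.exp (C * δ) / C) := by
  -- The estimate for t ≥ 0 is stated for every u, so that negative times follow by applying it to
  -- the time reversal of u.
  have main : ∀ (u u' : ℝ → E), (∀ t ∈ Ioo (-δ) δ, HasDerivAt u (u' t) t) → u 0 = 0 →
      (∀ t ∈ Ioo (-δ) δ, ‖u' t‖ ≤ C * ‖u t‖ + η) → ∀ t ∈ Ioo (-δ) δ, 0 ≤ t →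
      ‖u t‖ ≤ η * (Real.exp (C * δ) / C) := by
    intro u u' hu h0 hb t ht ht0
    have hsub : Icc 0 t ⊆ Ioo (-δ) δ := fun r hr ↦ ⟨by linarith [hr.1, ht.2], by linarith [hr.2, ht.2]⟩
    have := norm_le_gronwallBound_of_norm_deriv_right_le (f := u) (f' := u') (δ := 0) (K := C)
      (ε := η) (a := 0) (b := t) (fun r hr ↦ (hu r (hsub hr)).continuousAt.continuousWithinAt)
      (fun r hr ↦ (hu r (hsub (Ico_subset_Icc_self hr))).hasDerivWithinAt) (by simp [h0])
      (fun r hr ↦ hb r (hsub (Ico_subset_Icc_self hr))) t (right_mem_Icc.2 ht0)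
    refine this.trans ?_
    rw [gronwallBound_of_K_ne_0 hC.ne']
    have h1 : Real.exp (C * (t - 0)) ≤ Real.exp (C * δ) := by
      apply Real.exp_le_exp.2
      have := ht.2
      nlinarith
    have h2 : Real.exp (C * (t - 0)) - 1 ≤ Real.exp (C * δ) := by linarith
    calc 0 * Real.exp (C * (t - 0)) + η / C * (Real.exp (C * (t - 0)) - 1)
        ≤ η / C * Real.exp (C * δ) := by
          rw [zero_mul, zero_add]
          exact mul_le_mul_of_nonneg_left h2 (by positivity)
      _ = _ := by ring
  rcases le_total 0 t with h | h
  · exact main u u' hu h0 hb t ht h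
  · have := main (fun r ↦ u (-r)) (fun r ↦ -u' (-r)) (fun r hr ↦ ?_) (by simpa using h0)
      (fun r hr ↦ ?_) (-t) ⟨by linarith [ht.2], by linarith [ht.1]⟩ (by linarith)
    · simpa using this
    · have h1 := hu (-r) ⟨by linarith [hr.2], by linarith [hr.1]⟩
      simpa [Function.comp_def] using h1.scomp r (hasDerivAt_neg r)
    · simpa using hb (-r) ⟨by linarith [hr.2], by linarith [hr.1]⟩

/-! ### The linearized equation and differentiability of the flow -/

variable [CompleteSpace E]

/-- The linear equation `L' = A L` for an operator-valued function has a solution near `0`. -/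
theorem exists_linear_solution {A : ℝ → E →L[ℝ] E} {C δ : ℝ} (hδ : 0 < δ) (hC : 0 ≤ C)
    (hCδ : 2 * C * δ ≤ 1) (hA : ContinuousOn A (Icc (-δ) δ))
    (hb : ∀ t ∈ Icc (-δ) δ, ‖A t‖ ≤ C) :
    ∃ L : ℝ → E →L[ℝ] E, L 0 = .id ℝ E ∧
      ∀ t ∈ Ioo (-δ) δ, HasDerivAt L ((A t).comp (L t)) t := by
  -- In the unit ball around the identity ‖X‖ ≤ 2, so the speed is at most 2C, and 2Cδ ≤ 1 keeps the
  -- solution in this ball.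
  have hpl : IsPicardLindelof (fun t (X : E →L[ℝ] E) ↦ (A t).comp X) (tmin := -δ) (tmax := δ)
      ⟨0, by constructor <;> linarith⟩ (.id ℝ E) 1 0 (2 * C.toNNReal) C.toNNReal := by
    refine ⟨fun t ht ↦ ?_, fun X _ ↦ ?_, fun t ht X hX ↦ ?_, ?_⟩
    · refine LipschitzOnWith.of_dist_le_mul fun X _ Y _ ↦ ?_
      rw [dist_eq_norm, dist_eq_norm, ← ContinuousLinearMap.comp_sub, Real.coe_toNNReal _ hC]
      exact (ContinuousLinearMap.opNorm_comp_le _ _).trans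
        (mul_le_mul_of_nonneg_right (hb t ht) (norm_nonneg _))
    · exact hA.clm_comp continuousOn_const
    · have h1 : ‖X‖ ≤ 2 := by
        have := mem_closedBall_iff_norm.1 hX
        have h3 : ‖X‖ ≤ ‖X - .id ℝ E‖ + ‖ContinuousLinearMap.id ℝ E‖ := norm_le_norm_sub_add _ _
        have h4 := ContinuousLinearMap.norm_id_le (𝕜 := ℝ) (E := E)
        simp only [NNReal.coe_one] at this
        linarith
      refine (ContinuousLinearMap.opNorm_comp_le _ _).trans ?_
      simp only [NNReal.coe_mul, Real.coe_toNNReal _ hC, NNReal.coe_ofNat]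
      rw [mul_comm 2]
      exact mul_le_mul (hb t ht) h1 (norm_nonneg _) hC
    · simp only [NNReal.coe_mul, Real.coe_toNNReal _ hC, NNReal.coe_ofNat, NNReal.coe_one,
        NNReal.coe_zero, sub_zero, sub_neg_eq_add, zero_add, max_self]
      exact hCδ
  obtain ⟨L, h0, hL⟩ := hpl.exists_eq_forall_mem_Icc_hasDerivWithinAt₀
  exact ⟨L, h0, fun t ht ↦ (hL t (Ioo_subset_Icc_self ht)).hasDerivAt (Icc_mem_nhds ht.1 ht.2)⟩

/-- The local flow of a `C^1` vector field is differentiable in the initial value; the derivative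
is the solution of the linearized equation. -/
theorem exists_flow {F : E → E} {Ω : Set E} (hΩ : IsOpen Ω) (hF : ContDiffOn ℝ 1 F Ω) {z₀ : E}
    (hz₀ : z₀ ∈ Ω) :
    ∃ δ > 0, ∃ r > 0, ∃ α : E → ℝ → E, ∀ z ∈ ball z₀ r, α z 0 = z ∧
      (∀ t ∈ Ioo (-δ) δ, α z t ∈ Ω ∧ HasDerivAt (α z) (F (α z t)) t) ∧
      ∃ L : ℝ → E →L[ℝ] E, L 0 = .id ℝ E ∧ ∀ t ∈ Ioo (-δ) δ,
        HasDerivAt L ((fderiv ℝ F (α z t)).comp (L t)) t ∧ HasFDerivAt (α · t) (L t) z := by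
  have hF0 : ContDiffAt ℝ 1 F z₀ := hF.contDiffAt (hΩ.mem_nhds hz₀)
  have hDF : ContinuousOn (fderiv ℝ F) Ω := hF.continuousOn_fderiv_of_isOpen hΩ le_rfl
  obtain ⟨ε, hε, a, r₀, L₀, K₀, hr₀, hpl⟩ := IsPicardLindelof.of_contDiffAt_one hF0
  have hpl := hpl 0
  obtain ⟨α, hα, K, hαK⟩ := hpl.exists_forall_mem_closedBall_eq_hasDerivWithinAt_lipschitzOnWith
  simp only [zero_sub, zero_add] at hα hαK
  have hcont : ContinuousOn (Function.uncurry α) (closedBall z₀ r₀ ×ˢ Icc (-ε) ε) :=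
    continuousOn_prod_of_continuousOn_lipschitzOnWith _ K
      (fun x hx ↦ HasDerivWithinAt.continuousOn (hα x hx).2) hαK
  -- the region in which the derivative of `F` is bounded
  obtain ⟨C, hC1, hC⟩ : ∃ C : ℝ, 1 ≤ C ∧ ∀ᶠ z in 𝓝 z₀, z ∈ Ω ∧ ‖fderiv ℝ F z‖ ≤ C := by
    refine ⟨‖fderiv ℝ F z₀‖ + 1, by linarith [norm_nonneg (fderiv ℝ F z₀)], ?_⟩
    refine Filter.Eventually.and (hΩ.mem_nhds hz₀) ?_
    have := (hDF.continuousAt (hΩ.mem_nhds hz₀)).norm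
    filter_upwards [this.eventually (gt_mem_nhds (lt_add_one _))] with z hz using hz.le
  have hnh : closedBall z₀ r₀ ×ˢ Icc (-ε) ε ∈ 𝓝 ((z₀, 0) : E × ℝ) :=
    prod_mem_nhds (closedBall_mem_nhds _ (by exact_mod_cast hr₀)) (Icc_mem_nhds (by linarith) hε)
  have hct : ContinuousAt (Function.uncurry α) (z₀, 0) := hcont.continuousAt hnh
  have h00 : α z₀ 0 = z₀ := (hα z₀ (mem_closedBall_self r₀.2)).1
  have hev : ∀ᶠ q in 𝓝 ((z₀, 0) : E × ℝ), q ∈ closedBall z₀ r₀ ×ˢ Icc (-ε) ε ∧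
      (α q.1 q.2 ∈ Ω ∧ ‖fderiv ℝ F (α q.1 q.2)‖ ≤ C) := by
    refine (show ∀ᶠ q in 𝓝 ((z₀, 0) : E × ℝ), q ∈ closedBall z₀ r₀ ×ˢ Icc (-ε) ε from hnh).and ?_
    refine hct.eventually (p := fun z ↦ z ∈ Ω ∧ ‖fderiv ℝ F z‖ ≤ C) ?_
    simpa [Function.uncurry, h00] using hC
  obtain ⟨ρ, hρ, hball⟩ := Metric.mem_nhds_iff.1 hev
  -- The bound ρ / 2 keeps the closed time interval where F' is bounded by C; the bound 1 / (2C) is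
  -- the smallness needed to solve the linearized equation.
  set δ₁ := min (ρ / 2) (1 / (2 * C)) with hδ₁
  have hδ₁0 : 0 < δ₁ := lt_min (by linarith) (by positivity)
  have hC0 : 0 < C := by linarith
  have hCδ : 2 * C * δ₁ ≤ 1 := by
    have : δ₁ ≤ 1 / (2 * C) := min_le_right _ _
    rw [le_div_iff₀ (by positivity)] at this
    linarith
  have hreg : ∀ z ∈ ball z₀ ρ, ∀ t ∈ Icc (-δ₁) δ₁, z ∈ closedBall z₀ r₀ ∧ t ∈ Icc (-ε) ε ∧
      α z t ∈ Ω ∧ ‖fderiv ℝ F (α z t)‖ ≤ C := by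
    intro z hz t ht
    have h1 : ((z, t) : E × ℝ) ∈ ball ((z₀, 0) : E × ℝ) ρ := by
      rw [← ball_prod_same]
      refine ⟨hz, ?_⟩
      rw [Real.ball_eq_Ioo]
      have : δ₁ ≤ ρ / 2 := min_le_left _ _
      constructor <;> linarith [ht.1, ht.2]
    have := hball h1
    exact ⟨this.1.1, this.1.2, this.2⟩
  have hεδ : δ₁ ≤ ε :=
    (hreg z₀ (mem_ball_self hρ) δ₁ ⟨by linarith, le_rfl⟩).2.1.2
  have hderiv : ∀ z ∈ ball z₀ ρ, ∀ t ∈ Ioo (-δ₁) δ₁, HasDerivAt (α z) (F (α z t)) t := by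
    intro z hz t ht
    obtain ⟨h1, h2, -⟩ := hreg z hz t (Ioo_subset_Icc_self ht)
    exact ((hα z h1).2 t h2).hasDerivAt
      (Icc_mem_nhds (by linarith [ht.1]) (by linarith [ht.2]))
  -- Halving leaves a compact time interval inside the open one, for the uniform Taylor estimate
  -- below.
  refine ⟨δ₁ / 2, by linarith, ρ, hρ, α, fun z hz ↦ ?_⟩
  have hzmem : z ∈ closedBall z₀ r₀ := (hreg z hz 0 ⟨by linarith, by linarith⟩).1
  have hhalf : Ioo (-(δ₁ / 2)) (δ₁ / 2) ⊆ Ioo (-δ₁) δ₁ :=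
    Ioo_subset_Ioo (by linarith) (by linarith)
  refine ⟨(hα z hzmem).1, fun t ht ↦ ⟨(hreg z hz t (Ioo_subset_Icc_self (hhalf ht))).2.2.1,
    hderiv z hz t (hhalf ht)⟩, ?_⟩
  have hAcont : ContinuousOn (fun t ↦ fderiv ℝ F (α z t)) (Icc (-δ₁) δ₁) := by
    refine hDF.comp (fun t ht ↦ ?_) (fun t ht ↦ (hreg z hz t ht).2.2.1)
    exact (((hα z hzmem).2 t (hreg z hz t ht).2.1).continuousWithinAt).mono
      (Icc_subset_Icc (by linarith) hεδ)
  obtain ⟨L, hL0, hL⟩ := exists_linear_solution hδ₁0 hC0.le hCδ hAcont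
    (fun t ht ↦ (hreg z hz t ht).2.2.2)
  refine ⟨L, hL0, fun t ht ↦ ⟨hL t (hhalf ht), ?_⟩⟩
  -- the estimate for the derivative
  rw [hasFDerivAt_iff_isLittleO_nhds_zero, Asymptotics.isLittleO_iff]
  intro c hc
  set B := Real.exp (C * (δ₁ / 2)) / C with hB
  have hB0 : 0 < B := by positivity
  -- Chosen so that the Grönwall bound c' K ‖h‖ B is at most c ‖h‖; the summand 1 covers K = 0.
  set c' := c / (B * (K + 1)) with hc'
  have hc'0 : 0 < c' := by positivity
  -- First-order Taylor expansion of F along the orbit, uniform in time. By compactness it suffices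
  -- to work near each (0, τ): strict differentiability at the point `α z τ` gives half of the
  -- error, and continuity of F' absorbs moving the base point to nearby times.
  have hunif : ∀ᶠ h in 𝓝 (0 : E), ∀ τ ∈ Icc (-(δ₁ / 2)) (δ₁ / 2),
      ‖F (α (z + h) τ) - F (α z τ) - fderiv ℝ F (α z τ) (α (z + h) τ - α z τ)‖ ≤
        c' * ‖α (z + h) τ - α z τ‖ := by
    refine isCompact_Icc.eventually_forall_of_forall_eventually fun τ hτ ↦ ?_
    have hτ' : τ ∈ Ioo (-δ₁) δ₁ := ⟨by linarith [hτ.1], by linarith [hτ.2]⟩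
    obtain ⟨-, -, hΩτ, -⟩ := hreg z hz τ (Ioo_subset_Icc_self hτ')
    have hst : HasStrictFDerivAt F (fderiv ℝ F (α z τ)) (α z τ) :=
      (hF.contDiffAt (hΩ.mem_nhds hΩτ)).hasStrictFDerivAt one_ne_zero
    have hst' := hst.isLittleO.def (half_pos hc'0)
    have hAτ : ∀ᶠ y in 𝓝 (α z τ), ‖fderiv ℝ F y - fderiv ℝ F (α z τ)‖ < c' / 2 := by
      have := (hDF.continuousAt (hΩ.mem_nhds hΩτ))
      have := Metric.tendsto_nhds.1 this (c' / 2) (half_pos hc'0)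
      simpa [dist_eq_norm] using this
    have hαc : ContinuousAt (Function.uncurry α) (z, τ) := by
      refine hcont.continuousAt (prod_mem_nhds ?_
        (Icc_mem_nhds (by linarith [hτ'.1]) (by linarith [hτ'.2])))
      filter_upwards [isOpen_ball.mem_nhds hz] with y hy
      exact (hreg y hy 0 ⟨by linarith, by linarith⟩).1
    have t1 : Tendsto (fun q : E × ℝ ↦ α (z + q.1) q.2) (𝓝 (0, τ)) (𝓝 (α z τ)) := by
      have h1 : Tendsto (fun q : E × ℝ ↦ ((z + q.1, q.2) : E × ℝ)) (𝓝 (0, τ)) (𝓝 (z, τ)) := by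
        have : Continuous (fun q : E × ℝ ↦ ((z + q.1, q.2) : E × ℝ)) := by fun_prop
        simpa using this.tendsto ((0, τ) : E × ℝ)
      exact hαc.tendsto.comp h1
    have t2 : Tendsto (fun q : E × ℝ ↦ α z q.2) (𝓝 (0, τ)) (𝓝 (α z τ)) := by
      have h1 : Tendsto (fun q : E × ℝ ↦ ((z, q.2) : E × ℝ)) (𝓝 (0, τ)) (𝓝 (z, τ)) := by
        have : Continuous (fun q : E × ℝ ↦ ((z, q.2) : E × ℝ)) := by fun_prop
        simpa using this.tendsto ((0, τ) : E × ℝ)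
      exact hαc.tendsto.comp h1
    have t12 : Tendsto (fun q : E × ℝ ↦ (α (z + q.1) q.2, α z q.2)) (𝓝 (0, τ))
        (𝓝 (α z τ, α z τ)) := t1.prodMk_nhds t2
    filter_upwards [t12.eventually hst', t2.eventually hAτ] with q hq1 hq2
    set u := α (z + q.1) q.2
    set w := α z q.2
    have e : F u - F w - fderiv ℝ F w (u - w) = (F u - F w - fderiv ℝ F (α z τ) (u - w))
        - (fderiv ℝ F w - fderiv ℝ F (α z τ)) (u - w) := by
      simp only [sub_apply]
      abel
    rw [e]
    calc _ ≤ ‖F u - F w - fderiv ℝ F (α z τ) (u - w)‖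
          + ‖(fderiv ℝ F w - fderiv ℝ F (α z τ)) (u - w)‖ := norm_sub_le _ _
      _ ≤ c' / 2 * ‖u - w‖ + c' / 2 * ‖u - w‖ := by
          refine add_le_add hq1 ((ContinuousLinearMap.le_opNorm _ _).trans ?_)
          exact mul_le_mul_of_nonneg_right hq2.le (norm_nonneg _)
      _ = c' * ‖u - w‖ := by ring
  have hzh : ∀ᶠ h in 𝓝 (0 : E), z + h ∈ ball z₀ ρ := by
    have h1 : Tendsto (fun h : E ↦ z + h) (𝓝 0) (𝓝 z) := by
      simpa using (show Continuous fun h : E ↦ z + h by fun_prop).tendsto 0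
    exact h1 (isOpen_ball.mem_nhds hz)
  filter_upwards [hunif, hzh] with h h1 h2
  have hzhmem : z + h ∈ closedBall z₀ r₀ := (hreg _ h2 0 ⟨by linarith, by linarith⟩).1
  have hlip : ∀ τ ∈ Ioo (-(δ₁ / 2)) (δ₁ / 2), ‖α (z + h) τ - α z τ‖ ≤ K * ‖h‖ := by
    intro τ hτ
    have := (hαK τ (hreg z hz τ (Ioo_subset_Icc_self (hhalf hτ))).2.1).norm_sub_le hzhmem hzmem
    simpa using this
  -- The remainder of the expected linear approximation solves u' = F'(α z) u plus a Taylor error of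
  -- size at most c' K ‖h‖, and it vanishes at time 0.
  have := norm_le_of_norm_deriv_le (u := fun τ ↦ α (z + h) τ - α z τ - L τ h)
    (u' := fun τ ↦ F (α (z + h) τ) - F (α z τ) - fderiv ℝ F (α z τ) (L τ h))
    (C := C) (η := c' * (K * ‖h‖)) (δ := δ₁ / 2) hC0 (by positivity)
    (fun τ hτ ↦ ?_) ?_ (fun τ hτ ↦ ?_) ht
  · refine this.trans ?_
    rw [← hB]
    have e : c' * (K * ‖h‖) * B = c * ‖h‖ * (K / (K + 1)) := by
      rw [hc']; field_simp
    rw [e]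
    have : (K : ℝ) / (K + 1) ≤ 1 := by
      rw [div_le_one (by positivity)]; linarith
    exact mul_le_of_le_one_right (by positivity) this
  · have d1 := hderiv _ h2 τ (hhalf hτ)
    have d2 := hderiv z hz τ (hhalf hτ)
    have d3 := (hL τ (hhalf hτ)).clm_apply (hasDerivAt_const τ h)
    have d4 := (d1.sub d2).sub d3
    simp only [map_zero, add_zero, ContinuousLinearMap.comp_apply] at d4
    exact d4
  · simp [(hα _ hzhmem).1, (hα _ hzmem).1, hL0]
  · have e : F (α (z + h) τ) - F (α z τ) - fderiv ℝ F (α z τ) (L τ h) =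
        (F (α (z + h) τ) - F (α z τ) - fderiv ℝ F (α z τ) (α (z + h) τ - α z τ))
        + fderiv ℝ F (α z τ) (α (z + h) τ - α z τ - L τ h) := by
      simp only [map_sub]; abel
    rw [e]
    refine (norm_add_le _ _).trans ?_
    rw [add_comm]
    refine add_le_add ?_ ((h1 τ (Ioo_subset_Icc_self hτ)).trans ?_)
    · refine (ContinuousLinearMap.le_opNorm _ _).trans ?_
      exact mul_le_mul_of_nonneg_right (hreg z hz τ (Ioo_subset_Icc_self (hhalf hτ))).2.2.2
        (norm_nonneg _)
    · exact mul_le_mul_of_nonneg_left (hlip τ hτ) hc'0.le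

end ODEFlow

end

noncomputable section

set_option synthInstance.maxHeartbeats 200000
set_option maxHeartbeats 1000000

/-! ## Sasakian structures in coordinates -/

namespace LocalConnection

variable {E : Type*} [NormedAddCommGroup E] [NormedSpace ℝ E]

/-- The curvature `R(u, v)w` at `x` of the connection with Christoffel symbols `Γ`. -/
def curv (Γ : E → E →L[ℝ] E →L[ℝ] E) (x u v w : E) : E :=
  fderiv ℝ Γ x u v w - fderiv ℝ Γ x v u w + Γ x u (Γ x v w) - Γ x v (Γ x u w)

/-- Symmetry of second derivatives, in the form used for the Ricci identities: if f is a component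
of a parallel tensor, g expresses its first derivative through Christoffel symbols, and g'
differentiates that expression again. -/
theorem fderiv_symm_of_eventually {F : Type*} [NormedAddCommGroup F] [NormedSpace ℝ F] {f : E → F}
    {x : E} (hf : ContDiffAt ℝ 2 f x) {g : E → E → F}
    (hfg : ∀ᶠ y in 𝓝 x, ∀ u, fderiv ℝ f y u = g y u) {g' : E → E → F}
    (hg : ∀ u v, HasFDerivAt (g · u) (fderiv ℝ (g · u) x) x ∧ fderiv ℝ (g · u) x v = g' u v)
    (u v : E) : g' u v = g' v u := by
  have hs := hf.isSymmSndFDerivAt (by simp)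
  have hd : DifferentiableAt ℝ (fderiv ℝ f) x :=
    (hf.fderiv_right (m := 1) (by norm_num)).differentiableAt one_ne_zero
  have key : ∀ u v, fderiv ℝ (fderiv ℝ f) x v u = g' u v := by
    intro u v
    have h1 : HasFDerivAt (fun y ↦ fderiv ℝ f y u)
        ((fderiv ℝ (fderiv ℝ f) x).flip u) x := by
      simpa using hd.hasFDerivAt.clm_apply (hasFDerivAt_const u x)
    have h2 : (fun y ↦ fderiv ℝ f y u) =ᶠ[𝓝 x] (g · u) := hfg.mono fun y hy ↦ hy u
    rw [← (hg u v).2, ← h2.fderiv_eq, h1.fderiv]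
    rfl
  rw [← key, ← key]
  exact hs v u

/-- The coordinate form of a Sasakian structure: the Christoffel symbols `Γ` of the Tanaka-Webster
connection, the contact form `θ`, its exterior derivative `Ω`, the Levi form `G` (extended to all
vectors) and the Reeb field `ξ`. -/
structure IsSasakian (U : Set E) (Γ : E → E →L[ℝ] E →L[ℝ] E) (θ : E → E →L[ℝ] ℝ)
    (Ω G : E → E →L[ℝ] E →L[ℝ] ℝ) (ξ : E → E) : Prop where
  isOpen : IsOpen U
  contDiffOn_christoffel : ContDiffOn ℝ ∞ Γ U
  contDiffOn_θ : ContDiffOn ℝ ∞ θ U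
  contDiffOn_Ω : ContDiffOn ℝ ∞ Ω U
  contDiffOn_G : ContDiffOn ℝ ∞ G U
  contDiffOn_ξ : ContDiffOn ℝ ∞ ξ U
  θ_ξ : ∀ x ∈ U, θ x (ξ x) = 1
  Ω_swap : ∀ x ∈ U, ∀ u v, Ω x u v = - Ω x v u
  Ω_ξ : ∀ x ∈ U, ∀ v, Ω x (ξ x) v = 0
  G_swap : ∀ x ∈ U, ∀ u v, G x u v = G x v u
  G_ξ : ∀ x ∈ U, ∀ v, G x (ξ x) v = 0
  G_nonneg : ∀ x ∈ U, ∀ v, 0 ≤ G x v v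
  eq_of_G_eq_zero : ∀ x ∈ U, ∀ v, G x v v = 0 → v = θ x v • ξ x
  parallel_θ : ∀ x ∈ U, ∀ u v, fderiv ℝ θ x u v = θ x (Γ x u v)
  parallel_ξ : ∀ x ∈ U, ∀ u, fderiv ℝ ξ x u = - Γ x u (ξ x)
  parallel_Ω : ∀ x ∈ U, ∀ u v w, fderiv ℝ Ω x u v w = Ω x (Γ x u v) w + Ω x v (Γ x u w)
  parallel_G : ∀ x ∈ U, ∀ u v w, fderiv ℝ G x u v w = G x (Γ x u v) w + G x v (Γ x u w)
  torsion : ∀ x ∈ U, ∀ u v, Γ x u v - Γ x v u = Ω x u v • ξ x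

namespace IsSasakian

variable {U : Set E} {Γ : E → E →L[ℝ] E →L[ℝ] E} {θ : E → E →L[ℝ] ℝ}
  {Ω G : E → E →L[ℝ] E →L[ℝ] ℝ} {ξ : E → E} (h : IsSasakian U Γ θ Ω G ξ) {x : E}

section
include h

theorem contDiffAt {F : Type*} [NormedAddCommGroup F] [NormedSpace ℝ F] {f : E → F}
    (hf : ContDiffOn ℝ ∞ f U) (hx : x ∈ U) (n : ℕ) : ContDiffAt ℝ n f x :=
  (hf.contDiffAt (h.isOpen.mem_nhds hx)).of_le (by exact_mod_cast le_top)

theorem hasFDerivAt {F : Type*} [NormedAddCommGroup F] [NormedSpace ℝ F] {f : E → F}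
    (hf : ContDiffOn ℝ ∞ f U) (hx : x ∈ U) : HasFDerivAt f (fderiv ℝ f x) x :=
  ((h.contDiffAt hf hx 1).differentiableAt (by simp)).hasFDerivAt

theorem G_ξ' (hx : x ∈ U) (v : E) : G x v (ξ x) = 0 := by
  rw [h.G_swap x hx, h.G_ξ x hx]

theorem hasFDerivAt_christoffel_apply (hx : x ∈ U) (u w : E) :
    HasFDerivAt (fun y ↦ Γ y u w) (((fderiv ℝ Γ x).flip u).flip w) x := by
  have := ((h.hasFDerivAt h.contDiffOn_christoffel hx).clm_apply
    (hasFDerivAt_const u x)).clm_apply (hasFDerivAt_const w x)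
  refine this.congr_fderiv ?_
  ext v
  simp

/-- Ricci identity for the parallel form θ. -/
theorem θ_curv (hx : x ∈ U) (u v w : E) : θ x (curv Γ x u v w) = 0 := by
  have key := fderiv_symm_of_eventually (f := fun y ↦ θ y w) (x := x)
    ((h.contDiffAt h.contDiffOn_θ hx 2).clm_apply contDiffAt_const)
    (g := fun y u ↦ θ y (Γ y u w)) ?_
    (g' := fun u v ↦ θ x (Γ x v (Γ x u w)) + θ x (fderiv ℝ Γ x v u w)) (fun u v ↦ ?_) u v
  · simp only [curv, map_sub, map_add]
    linarith
  · filter_upwards [h.isOpen.mem_nhds hx] with y hy u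
    rw [← h.parallel_θ y hy]
    have := (h.hasFDerivAt h.contDiffOn_θ hy).clm_apply (hasFDerivAt_const w y)
    rw [this.fderiv]
    simp
  · have := (h.hasFDerivAt h.contDiffOn_θ hx).clm_apply (h.hasFDerivAt_christoffel_apply hx u w)
    rw [this.fderiv]
    refine ⟨this, ?_⟩
    simp [h.parallel_θ x hx, add_comm]

/-- Curvature annihilates a parallel vector field. -/
theorem curv_ξ (hx : x ∈ U) (u v : E) : curv Γ x u v (ξ x) = 0 := by
  have key := fderiv_symm_of_eventually (f := ξ) (x := x) (h.contDiffAt h.contDiffOn_ξ hx 2)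
    (g := fun y u ↦ - Γ y u (ξ y)) ?_
    (g' := fun u v ↦ Γ x u (Γ x v (ξ x)) - fderiv ℝ Γ x v u (ξ x)) (fun u v ↦ ?_) u v
  · simp only [curv]
    have e : fderiv ℝ Γ x u v (ξ x) - fderiv ℝ Γ x v u (ξ x) + Γ x u (Γ x v (ξ x))
        - Γ x v (Γ x u (ξ x)) = (Γ x u (Γ x v (ξ x)) - fderiv ℝ Γ x v u (ξ x)) -
          (Γ x v (Γ x u (ξ x)) - fderiv ℝ Γ x u v (ξ x)) := by abel
    rw [e, sub_eq_zero]
    exact key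
  · filter_upwards [h.isOpen.mem_nhds hx] with y hy u
    exact h.parallel_ξ y hy u
  · have := (((h.hasFDerivAt h.contDiffOn_christoffel hx).clm_apply
      (hasFDerivAt_const u x)).clm_apply (h.hasFDerivAt h.contDiffOn_ξ hx)).fun_neg
    rw [this.fderiv]
    refine ⟨this, ?_⟩
    simp [h.parallel_ξ x hx]
    abel

/-- Ricci identity for the parallel symmetric form G; the mixed terms are symmetric in u, v and
cancel. -/
theorem G_curv_swap (hx : x ∈ U) (u v w z : E) :
    G x (curv Γ x u v w) z = - G x (curv Γ x u v z) w := by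
  have key := fderiv_symm_of_eventually (f := fun y ↦ G y w z) (x := x)
    (((h.contDiffAt h.contDiffOn_G hx 2).clm_apply contDiffAt_const).clm_apply contDiffAt_const)
    (g := fun y u ↦ G y (Γ y u w) z + G y w (Γ y u z)) ?_
    (g' := fun u v ↦ (G x (Γ x v (Γ x u w)) z + G x (Γ x u w) (Γ x v z)
        + G x (fderiv ℝ Γ x v u w) z)
      + (G x (Γ x v w) (Γ x u z) + G x w (Γ x v (Γ x u z)) + G x w (fderiv ℝ Γ x v u z)))
    (fun u v ↦ ?_) u v
  · rw [h.G_swap x hx (curv Γ x u v z)]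
    simp only [curv, map_sub, map_add, sub_apply, add_apply]
    linarith
  · filter_upwards [h.isOpen.mem_nhds hx] with y hy u
    rw [← h.parallel_G y hy]
    have := ((h.hasFDerivAt h.contDiffOn_G hy).clm_apply
      (hasFDerivAt_const w y)).clm_apply (hasFDerivAt_const z y)
    rw [this.fderiv]
    simp
  · have hG := h.hasFDerivAt h.contDiffOn_G hx
    have := ((hG.clm_apply (h.hasFDerivAt_christoffel_apply hx u w)).clm_apply
        (hasFDerivAt_const z x)).fun_add ((hG.clm_apply
        (hasFDerivAt_const w x)).clm_apply (h.hasFDerivAt_christoffel_apply hx u z))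
    rw [this.fderiv]
    refine ⟨this, ?_⟩
    simp [h.parallel_G x hx]
    ring

theorem fderiv_torsion (hx : x ∈ U) (u v w : E) :
    fderiv ℝ Γ x u v w - fderiv ℝ Γ x u w v =
      (Ω x (Γ x u v) w + Ω x v (Γ x u w)) • ξ x - Ω x v w • Γ x u (ξ x) := by
  have h1 : HasFDerivAt (fun y ↦ Γ y v w - Γ y w v) _ x :=
    (h.hasFDerivAt_christoffel_apply hx v w).fun_sub (h.hasFDerivAt_christoffel_apply hx w v)
  have h2 := (((h.hasFDerivAt h.contDiffOn_Ω hx).clm_apply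
    (hasFDerivAt_const v x)).clm_apply (hasFDerivAt_const w x)).fun_smul
    (h.hasFDerivAt h.contDiffOn_ξ hx)
  have h3 : (fun y ↦ Γ y v w - Γ y w v) =ᶠ[𝓝 x] fun y ↦ Ω y v w • ξ y := by
    filter_upwards [h.isOpen.mem_nhds hx] with y hy using h.torsion y hy v w
  have h4 := congrArg (fun L ↦ L u) (h1.unique (h2.congr_of_eventuallyEq h3))
  simp [h.parallel_Ω x hx, h.parallel_ξ x hx] at h4
  rw [h4]
  abel

/-- In general the cyclic sum of R equals that of ∇T and T(T(·, ·), ·). Here T = Ω ⊗ ξ is parallel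
and Ω(ξ, ·) = 0, so both contributions vanish. -/
theorem bianchi (hx : x ∈ U) (u v w : E) :
    curv Γ x u v w + curv Γ x v w u + curv Γ x w u v = 0 := by
  have t : ∀ a b c, Γ x a (Γ x b c) - Γ x a (Γ x c b) = Ω x b c • Γ x a (ξ x) := by
    intro a b c
    rw [← map_sub, h.torsion x hx, map_smul]
  have s : ∀ a b c, Ω x (Γ x a b) c = Ω x (Γ x b a) c := by
    intro a b c
    have e : Γ x a b = Γ x b a + Ω x a b • ξ x := by
      rw [← h.torsion x hx]; abel
    rw [e, map_add, add_apply, map_smul, smul_apply, h.Ω_ξ x hx]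
    simp
  have f1 := h.fderiv_torsion hx u v w
  have f2 := h.fderiv_torsion hx v w u
  have f3 := h.fderiv_torsion hx w u v
  have e : (Ω x (Γ x u v) w + Ω x v (Γ x u w)) + (Ω x (Γ x v w) u + Ω x w (Γ x v u))
      + (Ω x (Γ x w u) v + Ω x u (Γ x w v)) = 0 := by
    rw [h.Ω_swap x hx v, h.Ω_swap x hx w, h.Ω_swap x hx u, s v u w, s u w v, s v w u]
    ring
  have e' : (Ω x (Γ x u v) w + Ω x v (Γ x u w)) • ξ x + (Ω x (Γ x v w) u + Ω x w (Γ x v u)) • ξ x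
      + (Ω x (Γ x w u) v + Ω x u (Γ x w v)) • ξ x = 0 := by
    rw [← add_smul, ← add_smul, e, zero_smul]
  have g : curv Γ x u v w + curv Γ x v w u + curv Γ x w u v =
      (fderiv ℝ Γ x u v w - fderiv ℝ Γ x u w v) + (fderiv ℝ Γ x v w u - fderiv ℝ Γ x v u w)
      + (fderiv ℝ Γ x w u v - fderiv ℝ Γ x w v u)
      + (Γ x u (Γ x v w) - Γ x u (Γ x w v)) + (Γ x v (Γ x w u) - Γ x v (Γ x u w))
      + (Γ x w (Γ x u v) - Γ x w (Γ x v u)) := by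
    simp only [curv]; abel
  rw [g, f1, f2, f3, t, t, t, ← e']
  abel

theorem curv_swap (u v w : E) : curv Γ x u v w = - curv Γ x v u w := by
  simp only [curv]; abel

/-- Bianchi and R(·, ·)ξ = 0 make this trilinear form symmetric in v, w; metricity makes it skew in
w, z. Alternating the two symmetries shows that it equals its negative. -/
theorem G_curv_reeb (hx : x ∈ U) (v w z : E) : G x (curv Γ x (ξ x) v w) z = 0 := by
  have sym : ∀ v w z, G x (curv Γ x (ξ x) v w) z = G x (curv Γ x (ξ x) w v) z := by
    intro v w z
    have b := h.bianchi hx (ξ x) v w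
    rw [h.curv_ξ hx, add_zero, h.curv_swap w] at b
    rw [← sub_eq_zero, ← sub_apply, ← map_sub, sub_eq_add_neg, b]
    simp
  have skew : ∀ v w z, G x (curv Γ x (ξ x) v w) z = - G x (curv Γ x (ξ x) v z) w :=
    fun v w z ↦ h.G_curv_swap hx _ _ _ _
  have h1 := sym v w z
  have h2 := skew w v z
  have h3 := sym w z v
  have h4 := skew z w v
  have h5 := sym z v w
  have h6 := skew v z w
  linarith

theorem curv_add_left (u u' v w : E) :
    curv Γ x (u + u') v w = curv Γ x u v w + curv Γ x u' v w := by
  simp only [curv, map_add, add_apply]; abel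

theorem curv_smul_left (c : ℝ) (u v w : E) : curv Γ x (c • u) v w = c • curv Γ x u v w := by
  simp only [curv, map_smul, smul_apply, smul_sub, smul_add]

theorem curv_add_right (u v w w' : E) :
    curv Γ x u v (w + w') = curv Γ x u v w + curv Γ x u v w' := by
  simp only [curv, map_add]; abel

theorem curv_smul_right (c : ℝ) (u v w : E) : curv Γ x u v (c • w) = c • curv Γ x u v w := by
  simp only [curv, map_smul, smul_sub, smul_add]

/-- With a, b the horizontal parts of y, j, all Reeb contributions drop out and -G(R(b, a)a, b)
remains. This is the curvature term in the second derivative of the energy. -/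
theorem G_curv_nonneg (hx : x ∈ U)
    (hK : ∀ u v, θ x u = 0 → θ x v = 0 → G x (curv Γ x u v v) u ≤ 0) (y j : E) :
    0 ≤ G x j (curv Γ x y j y) := by
  set a := y - θ x y • ξ x with ha
  set b := j - θ x j • ξ x with hb
  have hy : y = a + θ x y • ξ x := by simp [ha]
  have hj : j = b + θ x j • ξ x := by simp [hb]
  have ha0 : θ x a = 0 := by simp [ha, h.θ_ξ x hx]
  have hb0 : θ x b = 0 := by simp [hb, h.θ_ξ x hx]
  have e1 : ∀ z, curv Γ x y j z = curv Γ x a b z + θ x y • curv Γ x (ξ x) j z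
      - θ x j • curv Γ x (ξ x) a z := by
    intro z
    conv_lhs => rw [hy, h.curv_add_left, h.curv_smul_left, h.curv_swap a j, hj, h.curv_add_left,
      h.curv_smul_left, h.curv_swap b a, ← hj]
    simp only [neg_add, neg_neg]
    abel
  have e2 : curv Γ x y j y = curv Γ x y j a := by
    conv_lhs => rw [hy, h.curv_add_right, h.curv_smul_right, h.curv_ξ hx, ← hy]
    simp
  rw [h.G_swap x hx, e2, e1]
  simp only [map_add, map_sub, map_smul, add_apply, sub_apply, smul_apply, h.G_curv_reeb hx]
  have e3 : G x (curv Γ x a b a) j = - G x (curv Γ x b a a) b := by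
    rw [h.curv_swap, hj, map_add, map_smul, h.G_ξ' hx]
    simp
  rw [e3]
  have := hK b a hb0 ha0
  simp only [smul_zero]
  linarith

end

end IsSasakian

/-- `x` is a geodesic with velocity `y` and `j` is a Jacobi field along `x` with derivative `k`,
at the parameter `t`, in coordinates. -/
structure IsJacobiAt (Γ : E → E →L[ℝ] E →L[ℝ] E) (x y j k : ℝ → E) (t : ℝ) : Prop where
  deriv_x : HasDerivAt x (y t) t
  deriv_y : HasDerivAt y (- Γ (x t) (y t) (y t)) t
  deriv_j : HasDerivAt j (k t) t
  deriv_k : HasDerivAt k (- fderiv ℝ Γ (x t) (j t) (y t) (y t) - Γ (x t) (k t) (y t)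
    - Γ (x t) (y t) (k t)) t

/-! ### Energy and Reeb component along a Jacobi field -/

namespace IsJacobiAt

variable {U : Set E} {Γ : E → E →L[ℝ] E →L[ℝ] E} {θ : E → E →L[ℝ] ℝ}
  {Ω G : E → E →L[ℝ] E →L[ℝ] ℝ} {ξ : E → E} (h : IsSasakian U Γ θ Ω G ξ)
  {x y j k : ℝ → E} {t : ℝ} (hJ : IsJacobiAt Γ x y j k t) (hx : x t ∈ U)
include h hJ hx

/-- The derivative of `Y = k + Γ(j)y`. -/
theorem hasDerivAt_covDeriv : HasDerivAt (fun s ↦ k s + Γ (x s) (j s) (y s))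
    (curv Γ (x t) (y t) (j t) (y t) - Γ (x t) (y t) (k t + Γ (x t) (j t) (y t))) t := by
  have hΓ := (h.hasFDerivAt h.contDiffOn_christoffel hx).comp_hasDerivAt t hJ.deriv_x
  have := hJ.deriv_k.fun_add ((hΓ.clm_apply hJ.deriv_j).clm_apply hJ.deriv_y)
  convert! this using 1
  simp only [curv, map_add, map_neg, add_apply, Function.comp]
  abel

/-- Product rule for the parallel form G: the hypotheses say that a' and b' are the covariant
derivatives of a and b along x at t. -/
theorem hasDerivAt_G {a b a' b' : ℝ → E}
    (ha : HasDerivAt a (a' t - Γ (x t) (y t) (a t)) t)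
    (hb : HasDerivAt b (b' t - Γ (x t) (y t) (b t)) t) :
    HasDerivAt (fun s ↦ G (x s) (a s) (b s)) (G (x t) (a' t) (b t) + G (x t) (a t) (b' t)) t := by
  have hG := (h.hasFDerivAt h.contDiffOn_G hx).comp_hasDerivAt t hJ.deriv_x
  convert! (hG.clm_apply ha).clm_apply hb using 1
  simp only [Function.comp, map_sub, sub_apply, add_apply, h.parallel_G _ hx]
  ring

/-- Mixed coordinate derivatives commute, so ∇_y j and Y = ∇_j y differ by the torsion Ω(y, j)ξ. The
derivative is left as a covariant derivative minus Γ(y)j, the shape `hasDerivAt_G` and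
`hasDerivAt_θ` expect. -/
theorem hasDerivAt_j : HasDerivAt j ((k t + Γ (x t) (j t) (y t)
    + Ω (x t) (y t) (j t) • ξ (x t)) - Γ (x t) (y t) (j t)) t := by
  convert hJ.deriv_j using 1
  rw [← h.torsion _ hx]
  abel

/-- The torsion term in ∇_y j is a multiple of ξ, hence invisible to G. -/
theorem hasDerivAt_energy : HasDerivAt (fun s ↦ G (x s) (j s) (j s))
    (2 * G (x t) (j t) (k t + Γ (x t) (j t) (y t))) t := by
  have hj := hJ.hasDerivAt_j h hx
  convert! hJ.hasDerivAt_G h hx (a' := fun t ↦ k t + Γ (x t) (j t) (y t)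
    + Ω (x t) (y t) (j t) • ξ (x t)) (b' := fun t ↦ k t + Γ (x t) (j t) (y t)
    + Ω (x t) (y t) (j t) • ξ (x t)) hj hj using 1
  rw [h.G_swap _ hx _ (j t), map_add (G (x t) (j t)) _ (_ • _), map_smul, h.G_ξ' hx]
  simp
  ring

theorem hasDerivAt_deriv_energy :
    HasDerivAt (fun s ↦ 2 * G (x s) (j s) (k s + Γ (x s) (j s) (y s)))
    (2 * (G (x t) (k t + Γ (x t) (j t) (y t)) (k t + Γ (x t) (j t) (y t))
      + G (x t) (j t) (curv Γ (x t) (y t) (j t) (y t)))) t := by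
  have hj := hJ.hasDerivAt_j h hx
  have hY := hJ.hasDerivAt_covDeriv h hx
  convert! (hJ.hasDerivAt_G h hx (a' := fun t ↦ k t + Γ (x t) (j t) (y t)
    + Ω (x t) (y t) (j t) • ξ (x t)) (b' := fun t ↦ curv Γ (x t) (y t) (j t) (y t)) hj
    hY).const_mul 2 using 1
  rw [map_add (G (x t)) _ (_ • _), map_smul, add_apply, smul_apply, h.G_ξ _ hx]
  simp

theorem hasDerivAt_θ {a a' : ℝ → E} (ha : HasDerivAt a (a' t - Γ (x t) (y t) (a t)) t) :
    HasDerivAt (fun s ↦ θ (x s) (a s)) (θ (x t) (a' t)) t := by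
  have hθ := (h.hasFDerivAt h.contDiffOn_θ hx).comp_hasDerivAt t hJ.deriv_x
  convert! hθ.clm_apply ha using 1
  simp [h.parallel_θ _ hx]

theorem hasDerivAt_θ_j : HasDerivAt (fun s ↦ θ (x s) (j s))
    (θ (x t) (k t + Γ (x t) (j t) (y t)) + Ω (x t) (y t) (j t)) t := by
  convert! hJ.hasDerivAt_θ h hx (a' := fun t ↦ k t + Γ (x t) (j t) (y t)
    + Ω (x t) (y t) (j t) • ξ (x t)) (hJ.hasDerivAt_j h hx) using 1
  rw [map_add (θ (x t)) _ (_ • _), map_smul, h.θ_ξ _ hx]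
  simp

/-- ∇_y Y = R(y, j)y is horizontal, so θ(Y) is constant. -/
theorem hasDerivAt_θ_covDeriv :
    HasDerivAt (fun s ↦ θ (x s) (k s + Γ (x s) (j s) (y s))) 0 t := by
  convert! hJ.hasDerivAt_θ h hx (a' := fun t ↦ curv Γ (x t) (y t) (j t) (y t))
    (hJ.hasDerivAt_covDeriv h hx) using 1
  exact (h.θ_curv hx _ _ _).symm

end IsJacobiAt

end LocalConnection

end

noncomputable section

/-! ## Coordinate frames on a manifold -/

namespace CoordinateFrame

variable {E : Type*} [NormedAddCommGroup E] [NormedSpace ℝ E] [FiniteDimensional ℝ E]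
  {M : Type*} [TopologicalSpace M] [ChartedSpace E M] [IsManifold 𝓘(ℝ, E) ∞ M]

/-- The components of tangent vectors at `x` in the chart at `p`. -/
def coord (p x : M) : TangentSpace 𝓘(ℝ, E) x →L[ℝ] E :=
  (trivializationAt E (TangentSpace 𝓘(ℝ, E) : M → Type _) p).continuousLinearMapAt ℝ x

/-- The tangent vector at `x` with given components in the chart at `p`. -/
def frameL (p x : M) : E →L[ℝ] TangentSpace 𝓘(ℝ, E) x :=
  (trivializationAt E (TangentSpace 𝓘(ℝ, E) : M → Type _) p).symmL ℝ x

/-- The vector field with constant components `e` in the chart at `p`. -/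
def frame (p : M) (e : E) (x : M) : TangentSpace 𝓘(ℝ, E) x := frameL p x e

variable {p x : M}

theorem coord_frameL (hx : x ∈ (chartAt E p).source) (e : E) : coord p x (frameL p x e) = e :=
  Trivialization.continuousLinearMapAt_symmL _ (by simpa using hx) e

theorem coord_frame (hx : x ∈ (chartAt E p).source) (e : E) : coord p x (frame p e x) = e :=
  coord_frameL hx e

theorem frameL_coord (hx : x ∈ (chartAt E p).source) (v : TangentSpace 𝓘(ℝ, E) x) :
    frameL p x (coord p x v) = v :=
  Trivialization.symmL_continuousLinearMapAt _ (by simpa using hx) v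

theorem coord_eq_mfderiv (hx : x ∈ (chartAt E p).source) :
    coord p x = mfderiv 𝓘(ℝ, E) 𝓘(ℝ, E) (extChartAt 𝓘(ℝ, E) p) x :=
  TangentBundle.continuousLinearMapAt_trivializationAt hx

theorem coord_eq_snd (hx : x ∈ (chartAt E p).source) (v : TangentSpace 𝓘(ℝ, E) x) :
    coord p x v = (trivializationAt E (TangentSpace 𝓘(ℝ, E) : M → Type _) p ⟨x, v⟩).2 :=
  Trivialization.continuousLinearMapAt_apply_of_mem ℝ _ (by simpa using hx) v

/-- At its own base point, the preferred chart induces the definitional identification of the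
tangent space with E. -/
theorem coord_self (v : TangentSpace 𝓘(ℝ, E) p) : coord p p v = v := by
  rw [coord_eq_mfderiv (mem_chart_source E p), mfderiv_extChartAt_self]
  rfl

/-- Makes the definitions through `extend` computable: on the domain of the chart at p, the
extension is a coordinate field with constant components. -/
theorem extend_eq_frame (v : TangentSpace 𝓘(ℝ, E) p) (hx : x ∈ (chartAt E p).source) :
    (extend E v : Π x : M, TangentSpace 𝓘(ℝ, E) x) x = frame (E := E) p v x := by
  have h : (trivializationAt E (TangentSpace 𝓘(ℝ, E) : M → Type _) p ⟨p, v⟩).2 = v := by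
    rw [← coord_eq_snd (mem_chart_source E p), coord_self]
  have key : ∀ e : E, (trivializationAt E (TangentSpace 𝓘(ℝ, E) : M → Type _) p).symm x e =
      frame p e x :=
    fun e ↦ (Trivialization.symmL_apply _ (by simpa using hx) e).symm
  exact (key _).trans (congrArg (fun e : E ↦ frame p e x) h)

theorem contMDiffAt_section_iff {X : Π x : M, TangentSpace 𝓘(ℝ, E) x}
    (hx : x ∈ (chartAt E p).source) : ContMDiffAt 𝓘(ℝ, E) (𝓘(ℝ, E).prod 𝓘(ℝ, E)) ∞
      (T% X) x ↔ ContMDiffAt 𝓘(ℝ, E) 𝓘(ℝ, E) ∞ (fun y ↦ coord p y (X y)) x := by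
  rw [Trivialization.contMDiffAt_section_iff
    (trivializationAt E (TangentSpace 𝓘(ℝ, E) : M → Type _) p) (by simpa using hx)]
  refine Filter.EventuallyEq.contMDiffAt_iff ?_
  filter_upwards [(chartAt E p).open_source.mem_nhds hx] with y hy
  exact (coord_eq_snd hy _).symm

theorem mdifferentiableAt_section_iff {X : Π x : M, TangentSpace 𝓘(ℝ, E) x}
    (hx : x ∈ (chartAt E p).source) : MDiffAt (T% X) x ↔
      MDifferentiableAt 𝓘(ℝ, E) 𝓘(ℝ, E) (fun y ↦ coord p y (X y)) x := by
  rw [Trivialization.mdifferentiableAt_section_iff 𝓘(ℝ, E)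
    (trivializationAt E (TangentSpace 𝓘(ℝ, E) : M → Type _) p) _ (by simpa using hx)]
  refine Filter.EventuallyEq.mdifferentiableAt_iff ?_
  filter_upwards [(chartAt E p).open_source.mem_nhds hx] with y hy
  exact (coord_eq_snd hy _).symm

theorem contMDiffAt_frame (hx : x ∈ (chartAt E p).source) (e : E) :
    ContMDiffAt 𝓘(ℝ, E) (𝓘(ℝ, E).prod 𝓘(ℝ, E)) ∞ (T% (frame p e : Π x : M, _)) x := by
  rw [contMDiffAt_section_iff hx]
  refine (contMDiffAt_const (c := e)).congr_of_eventuallyEq ?_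
  filter_upwards [(chartAt E p).open_source.mem_nhds hx] with y hy using coord_frame hy e

theorem mdifferentiableAt_frame (hx : x ∈ (chartAt E p).source) (e : E) :
    MDiffAt (T% (frame p e : Π x : M, _)) x :=
  (contMDiffAt_frame hx e).mdifferentiableAt (by simp)

theorem extChartAt_mem_target (hx : x ∈ (chartAt E p).source) :
    extChartAt 𝓘(ℝ, E) p x ∈ (chartAt E p).target := by
  simpa using (chartAt E p).map_source hx

theorem extChartAt_symm_mem {z : E} (hz : z ∈ (chartAt E p).target) :
    (extChartAt 𝓘(ℝ, E) p).symm z ∈ (chartAt E p).source := by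
  simpa using (chartAt E p).map_target hz

theorem extChartAt_left_inv (hx : x ∈ (chartAt E p).source) :
    (extChartAt 𝓘(ℝ, E) p).symm (extChartAt 𝓘(ℝ, E) p x) = x :=
  (extChartAt 𝓘(ℝ, E) p).left_inv (by simpa using hx)

theorem extChartAt_right_inv {z : E} (hz : z ∈ (chartAt E p).target) :
    extChartAt 𝓘(ℝ, E) p ((extChartAt 𝓘(ℝ, E) p).symm z) = z :=
  (extChartAt 𝓘(ℝ, E) p).right_inv (by simpa using hz)

theorem contMDiffAt_chart_symm {z : E} (hz : z ∈ (chartAt E p).target) :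
    ContMDiffAt 𝓘(ℝ, E) 𝓘(ℝ, E) ∞ (extChartAt 𝓘(ℝ, E) p).symm z := by
  have h := contMDiffOn_extChartAt_symm (I := 𝓘(ℝ, E)) (n := ∞) p
  refine h.contMDiffAt ?_
  simpa using (chartAt E p).open_target.mem_nhds hz

theorem contMDiffAt_chart (hx : x ∈ (chartAt E p).source) :
    ContMDiffAt 𝓘(ℝ, E) 𝓘(ℝ, E) ∞ (extChartAt 𝓘(ℝ, E) p) x :=
  contMDiffAt_extChartAt' hx

section functions

variable {F : Type*} [NormedAddCommGroup F] [NormedSpace ℝ F] {f : M → F}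

theorem comp_symm_comp_chart (f : M → F) (hx : x ∈ (chartAt E p).source) :
    (f ∘ (extChartAt 𝓘(ℝ, E) p).symm) ∘ extChartAt 𝓘(ℝ, E) p =ᶠ[𝓝 x] f := by
  filter_upwards [(chartAt E p).open_source.mem_nhds hx] with y hy
  simp only [Function.comp, extChartAt_left_inv hy]

theorem contDiffOn_comp_symm
    (hf : ∀ x ∈ (chartAt E p).source, ContMDiffAt 𝓘(ℝ, E) 𝓘(ℝ, F) ∞ f x) :
    ContDiffOn ℝ ∞ (fun z ↦ f ((extChartAt 𝓘(ℝ, E) p).symm z)) (chartAt E p).target := by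
  intro z hz
  exact ((hf _ (extChartAt_symm_mem hz)).comp z
    (contMDiffAt_chart_symm hz)).contDiffAt.contDiffWithinAt

theorem differentiableAt_comp_symm (hx : x ∈ (chartAt E p).source)
    (hf : MDifferentiableAt 𝓘(ℝ, E) 𝓘(ℝ, F) f x) :
    DifferentiableAt ℝ (fun z ↦ f ((extChartAt 𝓘(ℝ, E) p).symm z)) (extChartAt 𝓘(ℝ, E) p x) := by
  have h := (contMDiffAt_chart_symm (extChartAt_mem_target hx)).mdifferentiableAt (by simp)
  rw [← extChartAt_left_inv hx] at hf
  exact (hf.comp _ h).differentiableAt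

theorem mvfderiv_eq (hx : x ∈ (chartAt E p).source)
    (hf : MDifferentiableAt 𝓘(ℝ, E) 𝓘(ℝ, F) f x) (v : TangentSpace 𝓘(ℝ, E) x) :
    mvfderiv 𝓘(ℝ, E) f x v = fderiv ℝ (fun z ↦ f ((extChartAt 𝓘(ℝ, E) p).symm z))
      (extChartAt 𝓘(ℝ, E) p x) (coord p x v) := by
  have h1 := (differentiableAt_comp_symm hx hf).hasFDerivAt.hasMFDerivAt
  have h2 : HasMFDerivAt 𝓘(ℝ, E) 𝓘(ℝ, E) (extChartAt 𝓘(ℝ, E) p) x (coord p x) := by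
    rw [coord_eq_mfderiv hx]
    exact ((contMDiffAt_chart hx).mdifferentiableAt (by simp)).hasMFDerivAt
  have h3 := (h1.comp x h2).congr_of_eventuallyEq (comp_symm_comp_chart f hx).symm
  simp only [mvfderiv, h3.mfderiv]
  rfl

end functions

/-- The components of a vector field in the chart at `p`. -/
def localRep (p : M) (X : Π x : M, TangentSpace 𝓘(ℝ, E) x) (z : E) : E :=
  coord p ((extChartAt 𝓘(ℝ, E) p).symm z) (X ((extChartAt 𝓘(ℝ, E) p).symm z))

theorem localRep_chart (X : Π x : M, TangentSpace 𝓘(ℝ, E) x) (hx : x ∈ (chartAt E p).source) :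
    localRep p X (extChartAt 𝓘(ℝ, E) p x) = coord p x (X x) := by
  rw [localRep, extChartAt_left_inv hx]

theorem differentiableAt_localRep {X : Π x : M, TangentSpace 𝓘(ℝ, E) x}
    (hx : x ∈ (chartAt E p).source) (hX : MDiffAt (T% X) x) :
    DifferentiableAt ℝ (localRep p X) (extChartAt 𝓘(ℝ, E) p x) :=
  differentiableAt_comp_symm (f := fun y ↦ coord p y (X y)) hx
    ((mdifferentiableAt_section_iff hx).1 hX)

theorem localRep_frame {z : E} (hz : z ∈ (chartAt E p).target) (e : E) :
    localRep p (frame p e) z = e :=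
  coord_frame (extChartAt_symm_mem hz) e

theorem fderiv_localRep_frame (hx : x ∈ (chartAt E p).source) (e : E) :
    fderiv ℝ (localRep p (frame p e)) (extChartAt 𝓘(ℝ, E) p x) = 0 := by
  have : localRep p (frame p e) =ᶠ[𝓝 (extChartAt 𝓘(ℝ, E) p x)] fun _ ↦ e := by
    filter_upwards [(chartAt E p).open_target.mem_nhds (extChartAt_mem_target hx)] with z hz
      using localRep_frame hz e
  rw [this.fderiv_eq]
  simp

/-- Coordinate fields are pullbacks of constant fields under the chart, and constant fields commute.
-/
theorem mlieBracket_frame (hx : x ∈ (chartAt E p).source) (e e' : E) :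
    mlieBracket 𝓘(ℝ, E) (frame p e : Π x : M, _) (frame p e') x = 0 := by
  have hpull : ∀ e : E, (frame p e : Π x : M, TangentSpace 𝓘(ℝ, E) x) =ᶠ[𝓝 x]
      mpullback 𝓘(ℝ, E) 𝓘(ℝ, E) (extChartAt 𝓘(ℝ, E) p) (fun _ ↦ e) := by
    intro e
    filter_upwards [(chartAt E p).open_source.mem_nhds hx] with y hy
    have h1 : mfderiv 𝓘(ℝ, E) 𝓘(ℝ, E) (extChartAt 𝓘(ℝ, E) p) y (frame p e y) = e := by
      rw [← coord_eq_mfderiv hy]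
      exact coord_frame hy e
    have h2 := isInvertible_mfderiv_extChartAt (I := 𝓘(ℝ, E)) (x := p) (y := y) (by simpa using hy)
    exact (h2.inverse_apply_eq.2 h1.symm).symm
  have hc : ∀ e : E, MDifferentiableAt 𝓘(ℝ, E) 𝓘(ℝ, E).tangent
      (fun z : E ↦ (⟨z, e⟩ : TangentBundle 𝓘(ℝ, E) E)) (extChartAt 𝓘(ℝ, E) p x) := fun e ↦ ContMDiffAt.mdifferentiableAt
    ((contMDiffAt_vectorSpace_iff_contDiffAt (𝕜 := ℝ) (n := 1) (V := fun _ : E ↦ e)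
      (x := extChartAt 𝓘(ℝ, E) p x)).2 contDiffAt_const) one_ne_zero
  have : IsManifold 𝓘(ℝ, E) (minSmoothness ℝ 2) M := by
    rw [minSmoothness_of_isRCLikeNormedField]; infer_instance
  have hz : mlieBracket 𝓘(ℝ, E) ((fun _ ↦ e) : Π z : E, TangentSpace 𝓘(ℝ, E) z) (fun _ ↦ e')
      (extChartAt 𝓘(ℝ, E) p x) = 0 := by
    refine (congrFun (mlieBracketWithin_univ (I := 𝓘(ℝ, E)) (V := fun _ : E ↦ e)
      (W := fun _ : E ↦ e')) _).symm.trans ?_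
    refine (congrFun (mlieBracketWithin_eq_lieBracketWithin (𝕜 := ℝ) (E := E)
      (V := fun _ : E ↦ e) (W := fun _ : E ↦ e') (s := univ)) _).trans ?_
    rw [lieBracketWithin_univ]
    simp only [lieBracket, fderiv_fun_const]
    exact sub_self _
  rw [(hpull e).mlieBracket_vectorField_eq (hpull e'), ← mpullback_mlieBracket (n := ∞) (hc e)
    (hc e') (contMDiffAt_chart hx) (by
      rw [minSmoothness_of_isRCLikeNormedField]; exact WithTop.coe_le_coe.2 le_top), mpullback_apply]
  exact (congrArg _ hz).trans (map_zero _)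

/-! ### Connections in coordinates -/

variable (cov : CovariantDerivative 𝓘(ℝ, E) E (TangentSpace 𝓘(ℝ, E) : M → Type _))

/-- The Christoffel symbols of a connection in the chart at `p`. -/
def christoffel (p : M) (z : E) : E →L[ℝ] E →L[ℝ] E :=
  ∑ i, ∑ j, (LinearMap.toContinuousLinearMap ((Module.finBasis ℝ E).coord i)).smulRight
    ((LinearMap.toContinuousLinearMap ((Module.finBasis ℝ E).coord j)).smulRight
      (localRep p (fun x ↦ cov (frame p (Module.finBasis ℝ E j)) x
        (frame p (Module.finBasis ℝ E i) x)) z))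

theorem frame_add (e e' : E) : (frame p (e + e') : Π x : M, TangentSpace 𝓘(ℝ, E) x) =
    frame p e + frame p e' := by
  ext1 y
  simp [frame]

theorem frame_smul (c : ℝ) (e : E) : (frame p (c • e) : Π x : M, TangentSpace 𝓘(ℝ, E) x) =
    c • frame p e := by
  ext1 y
  simp [frame]

theorem cov_frame_sum (hx : x ∈ (chartAt E p).source) {ι : Type*} (s : Finset ι) (c : ι → ℝ)
    (e : ι → E) : cov (frame p (∑ j ∈ s, c j • e j)) x = ∑ j ∈ s, c j • cov (frame p (e j)) x := by
  classical
  induction s using Finset.induction_on with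
  | empty =>
    have : (frame p (0 : E) : Π x : M, TangentSpace 𝓘(ℝ, E) x) = 0 := by
      ext1 y; simp [frame]
    simp only [Finset.sum_empty, this]
    exact cov.isCovariantDerivativeOn.zero
  | insert a s ha ih =>
    rw [Finset.sum_insert ha, Finset.sum_insert ha, frame_add, frame_smul, ← ih]
    have h1 := mdifferentiableAt_frame (x := x) (p := p) hx (c a • e a)
    rw [frame_smul] at h1
    rw [cov.isCovariantDerivativeOn.add h1 (mdifferentiableAt_frame hx _),
      cov.isCovariantDerivativeOn.smul_const _ (mdifferentiableAt_frame hx _)]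

theorem christoffel_apply (hx : x ∈ (chartAt E p).source) (u e : E) :
    christoffel cov p (extChartAt 𝓘(ℝ, E) p x) u e =
      coord p x (cov (frame p e) x (frame p u x)) := by
  set b := Module.finBasis ℝ E
  have hu : frame p u x = ∑ i, b.coord i u • frame p (b i) x := by
    simp only [frame, ← map_smul, ← map_sum]
    congr 1
    exact (b.sum_repr u).symm
  have he : cov (frame p e) x = ∑ j, b.coord j e • cov (frame p (b j)) x := by
    rw [← cov_frame_sum cov hx]
    congr 2
    exact (b.sum_repr e).symm
  rw [hu, he]
  simp only [christoffel, sum_apply, ContinuousLinearMap.smulRight_apply, map_sum, map_smul,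
    smul_apply, LinearMap.coe_toContinuousLinearMap', localRep_chart _ hx]
  refine Finset.sum_congr rfl fun i _ ↦ ?_
  rw [Finset.smul_sum]

/-- The covariant derivative of a vector field in the chart at `p`. -/
theorem coord_cov (hx : x ∈ (chartAt E p).source) {X : Π x : M, TangentSpace 𝓘(ℝ, E) x}
    (hX : MDiffAt (T% X) x) (v : TangentSpace 𝓘(ℝ, E) x) :
    coord p x (cov X x v) =
      fderiv ℝ (localRep p X) (extChartAt 𝓘(ℝ, E) p x) (coord p x v) +
        christoffel cov p (extChartAt 𝓘(ℝ, E) p x) (coord p x v) (coord p x (X x)) := by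
  -- The connection and the coordinate derivative obey the same Leibniz rule, so their difference
  -- depends only on the value of X at x. It may be evaluated on the frame field with that value,
  -- whose coordinate derivative is zero.
  have hten : TensorialAt 𝓘(ℝ, E) E (fun X : Π x : M, TangentSpace 𝓘(ℝ, E) x ↦
      coord p x (cov X x v) - fderiv ℝ (localRep p X) (extChartAt 𝓘(ℝ, E) p x) (coord p x v)) x := by
    refine ⟨fun {f X} hf hX ↦ ?_, fun {X Y} hX hY ↦ ?_⟩
    · have e : localRep p (f • X) =
          fun z ↦ f ((extChartAt 𝓘(ℝ, E) p).symm z) • localRep p X z := by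
        ext1 z; exact map_smul (coord p _) _ _
      rw [cov.isCovariantDerivativeOn.leibniz hX hf, e,
        fderiv_fun_smul (differentiableAt_comp_symm hx hf) (differentiableAt_localRep hx hX)]
      simp only [add_apply, smul_apply, ContinuousLinearMap.smulRight_apply, map_add, map_smul,
        extChartAt_left_inv hx, mvfderiv_eq hx hf, localRep_chart _ hx]
      rw [smul_sub]
      abel
    · have e : localRep p (X + Y) = localRep p X + localRep p Y := by
        ext1 z; exact map_add (coord p _) _ _
      rw [cov.isCovariantDerivativeOn.add hX hY, e,
        fderiv_add (differentiableAt_localRep hx hX) (differentiableAt_localRep hx hY)]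
      simp only [add_apply, map_add]
      abel
  have h := hten.pointwise hX (mdifferentiableAt_frame hx (coord p x (X x)))
    (frameL_coord hx _).symm
  simp only [fderiv_localRep_frame hx, zero_apply, sub_zero] at h
  have hv : frame p (coord p x v) x = v := frameL_coord hx v
  rw [christoffel_apply cov hx, hv, ← h]
  abel

end CoordinateFrame

end

/-! ### Smoothness of the Christoffel symbols and curvature in coordinates -/

noncomputable section

namespace CoordinateFrame

variable {E : Type*} [NormedAddCommGroup E] [NormedSpace ℝ E] [FiniteDimensional ℝ E]
  {M : Type*} [TopologicalSpace M] [ChartedSpace E M] [IsManifold 𝓘(ℝ, E) ∞ M]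
  (cov : CovariantDerivative 𝓘(ℝ, E) E (TangentSpace 𝓘(ℝ, E) : M → Type _))
  {p x : M}

theorem cov_congr {X Y : Π x : M, TangentSpace 𝓘(ℝ, E) x} (hX : MDiffAt (T% X) x)
    (h : X =ᶠ[𝓝 x] Y) : cov X x = cov Y x := by
  have hY : MDiffAt (T% Y) x := by
    refine MDifferentiableAt.congr_of_eventuallyEq hX ?_
    filter_upwards [h] with y hy
    rw [hy]
  exact (cov.isCovariantDerivativeOn.mono (subset_univ {y | X y = Y y})).congr_of_eqOn hX hY h
    fun y hy ↦ hy

theorem extend_frame (u : E) (hx : x ∈ (chartAt E p).source) :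
    (extend E (frame p u p) : Π x : M, TangentSpace 𝓘(ℝ, E) x) x = frame p u x := by
  have h : coord p p (frame p u p) = u := coord_frame (mem_chart_source E p) u
  rw [coord_self] at h
  exact (extend_eq_frame (frame p u p) hx).trans (congrArg (fun e : E ↦ frame p e x) h)

set_option synthInstance.maxHeartbeats 200000 in
theorem hasFDerivAt_clm_apply_apply {F : Type*} [NormedAddCommGroup F] [NormedSpace ℝ F]
    {f : E → E →L[ℝ] E →L[ℝ] F} {f' : E →L[ℝ] E →L[ℝ] E →L[ℝ] F} {z : E}
    (hf : HasFDerivAt f f' z) (v w : E) :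
    HasFDerivAt (fun z ↦ f z v w) ((f'.flip v).flip w) z := by
  refine ((hf.clm_apply (hasFDerivAt_const v z)).clm_apply
    (hasFDerivAt_const w z)).congr_fderiv ?_
  ext u
  simp

section smooth

variable [T2Space M] (hcov : CovariantDerivative.ContMDiffCovariantDerivative cov ∞)
include hcov

/-- Smoothness of the connection is applied to globally smooth fields, whereas the frame is smooth
only on the chart domain. It is cut off by a bump function equal to 1 near x, which locality of the
connection does not see. -/
theorem contMDiffAt_cov_frame (hx : x ∈ (chartAt E p).source) (u e : E) :
    ContMDiffAt 𝓘(ℝ, E) (𝓘(ℝ, E).prod 𝓘(ℝ, E)) ∞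
      (fun y ↦ TotalSpace.mk' E (E := fun y : M ↦ TangentSpace 𝓘(ℝ, E) y) y
        (cov (frame p e) y (frame p u y))) x := by
  obtain ⟨ψ, -, hψ⟩ := (SmoothBumpFunction.nhds_basis_tsupport (I := 𝓘(ℝ, E)) x).mem_iff.1
    ((chartAt E p).open_source.mem_nhds hx)
  have h1 : ContMDiff 𝓘(ℝ, E) (𝓘(ℝ, E).prod 𝓘(ℝ, E)) ∞
      (T% ((ψ : M → ℝ) • (frame p e : Π x : M, TangentSpace 𝓘(ℝ, E) x))) :=
    ContMDiffOn.smul_section_of_tsupport ψ.contMDiff.contMDiffOn (chartAt E p).open_source hψ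
      fun y hy ↦ (contMDiffAt_frame hy e).contMDiffWithinAt
  have h2 := (hcov.contMDiff.contMDiff (by simpa using! h1.contMDiffOn (s := univ))).contMDiffAt
    (x := x) Filter.univ_mem
  have h3 : ∀ᶠ y in 𝓝 x, cov (frame p e) y =
      cov ((ψ : M → ℝ) • (frame p e : Π x : M, TangentSpace 𝓘(ℝ, E) x)) y := by
    filter_upwards [ψ.eventuallyEq_one.eventually_nhds,
      (chartAt E p).open_source.mem_nhds hx] with y hy hy'
    refine cov_congr cov (mdifferentiableAt_frame hy' e) ?_
    filter_upwards [hy] with z hz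
    have : ψ z = 1 := hz
    exact ((congrArg (· • frame p e z) this).trans (one_smul ℝ _)).symm
  have h4 := ContMDiffAt.clm_bundle_apply (F₂ := E)
    (E₂ := fun y : M ↦ TangentSpace 𝓘(ℝ, E) y) (b := fun y : M ↦ y) h2 (contMDiffAt_frame hx u)
  refine h4.congr_of_eventuallyEq ?_
  filter_upwards [h3] with y hy
  rw [hy]
  rfl

theorem contDiffOn_christoffel (p : M) :
    ContDiffOn ℝ ∞ (christoffel cov p) (chartAt E p).target := by
  unfold christoffel
  refine ContDiffOn.sum fun i _ ↦ ContDiffOn.sum fun j _ ↦ ?_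
  have h : ContDiffOn ℝ ∞ (localRep p (fun x ↦ cov (frame p (Module.finBasis ℝ E j)) x
      (frame p (Module.finBasis ℝ E i) x))) (chartAt E p).target :=
    contDiffOn_comp_symm (f := fun y ↦ coord p y (cov (frame p (Module.finBasis ℝ E j)) y
      (frame p (Module.finBasis ℝ E i) y))) fun y hy ↦
        (contMDiffAt_section_iff hy).1 (contMDiffAt_cov_frame cov hcov hy _ _)
  exact contDiffOn_const.smulRight (contDiffOn_const.smulRight h)

theorem differentiableAt_christoffel (hx : x ∈ (chartAt E p).source) :
    DifferentiableAt ℝ (christoffel cov p) (extChartAt 𝓘(ℝ, E) p x) :=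
  ((contDiffOn_christoffel cov hcov p).contDiffAt
    ((chartAt E p).open_target.mem_nhds (extChartAt_mem_target hx))).differentiableAt (by simp)

/-- The extensions in the definition of curvature are commuting coordinate fields of the chart at p,
so only the two iterated covariant derivatives contribute. The computation is tied to the centre of
the chart, since `extend` uses the chart of its own base point. -/
theorem curvature_frame (u v w : E) :
    coord p p (Connection.curvature cov p (frame p u p) (frame p v p) (frame p w p)) =
      LocalConnection.curv (christoffel cov p) (extChartAt 𝓘(ℝ, E) p p) u v w := by
  have hp : p ∈ (chartAt E p).source := mem_chart_source E p
  have hnear := (chartAt E p).open_source.mem_nhds hp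
  have hext : ∀ u : E, ∀ y ∈ (chartAt E p).source,
      (extend E (frame p u p) : Π x : M, TangentSpace 𝓘(ℝ, E) x) =ᶠ[𝓝 y] frame p u :=
    fun u y hy ↦ by
      filter_upwards [(chartAt E p).open_source.mem_nhds hy] with z hz
      exact extend_frame u hz
  have hfield : ∀ v w : E, ∀ y ∈ (chartAt E p).source,
      coord p y (cov (extend E (frame p w p)) y (extend E (frame p v p) y)) =
        christoffel cov p (extChartAt 𝓘(ℝ, E) p y) v w := by
    intro v w y hy
    rw [christoffel_apply cov hy, extend_frame v hy,
      cov_congr cov (mdifferentiableAt_frame hy w) (hext w y hy).symm]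
  have hΓ := differentiableAt_christoffel cov hcov hp
  have hsecond : ∀ u v w : E,
      coord p p (cov (fun y ↦ cov (extend E (frame p w p)) y (extend E (frame p v p) y)) p
        (extend E (frame p u p) p)) =
        fderiv ℝ (christoffel cov p) (extChartAt 𝓘(ℝ, E) p p) u v w +
          christoffel cov p (extChartAt 𝓘(ℝ, E) p p) u
            (christoffel cov p (extChartAt 𝓘(ℝ, E) p p) v w) := by
    intro u v w
    have hd : HasFDerivAt (fun z ↦ christoffel cov p z v w)
        (((fderiv ℝ (christoffel cov p) (extChartAt 𝓘(ℝ, E) p p)).flip v).flip w)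
        (extChartAt 𝓘(ℝ, E) p p) := hasFDerivAt_clm_apply_apply hΓ.hasFDerivAt v w
    have hX : MDiffAt (T% (fun y ↦ cov (extend E (frame p w p)) y (extend E (frame p v p) y) :
        Π x : M, TangentSpace 𝓘(ℝ, E) x)) p := by
      rw [mdifferentiableAt_section_iff hp]
      refine MDifferentiableAt.congr_of_eventuallyEq
        (f := fun y ↦ christoffel cov p (extChartAt 𝓘(ℝ, E) p y) v w)
        (hd.differentiableAt.mdifferentiableAt.comp p
          ((contMDiffAt_chart hp).mdifferentiableAt (by simp))) ?_
      filter_upwards [hnear] with y hy using hfield v w y hy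
    have hl : localRep p (fun y ↦ cov (extend E (frame p w p)) y (extend E (frame p v p) y))
        =ᶠ[𝓝 (extChartAt 𝓘(ℝ, E) p p)] fun z ↦ christoffel cov p z v w := by
      filter_upwards [(chartAt E p).open_target.mem_nhds (extChartAt_mem_target hp)] with z hz
      have := hfield v w _ (extChartAt_symm_mem hz)
      rwa [extChartAt_right_inv hz] at this
    rw [coord_cov cov hp hX, hl.fderiv_eq, hd.fderiv, hfield v w p hp, extend_frame u hp,
      coord_frame hp]
    rfl
  have hb : mlieBracket 𝓘(ℝ, E) (extend E (frame p u p) : Π x : M, TangentSpace 𝓘(ℝ, E) x)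
      (extend E (frame p v p)) p = 0 := by
    rw [(hext u p hp).mlieBracket_vectorField_eq (hext v p hp), mlieBracket_frame hp]
  simp only [Connection.curvature, Connection.curvatureField, hb, map_zero, sub_zero, map_sub,
    hsecond, LocalConnection.curv]
  abel

end smooth

end CoordinateFrame

end

noncomputable section

set_option synthInstance.maxHeartbeats 200000
set_option maxHeartbeats 1000000
open Connection

/-! ## The pseudo-Hermitian structure in coordinates -/

/-- The solution of an invertible linear system with smooth coefficients is smooth, because
inversion of operators is. Serves to show that the Reeb field is smooth. -/
theorem ContDiffOn.of_clm_apply {E F G : Type*} [NormedAddCommGroup E] [NormedSpace ℝ E]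
    [NormedAddCommGroup F] [NormedSpace ℝ F] [FiniteDimensional ℝ F]
    [NormedAddCommGroup G] [NormedSpace ℝ G] [FiniteDimensional ℝ G]
    {U : Set E} (hU : IsOpen U) {A : E → F →L[ℝ] G} (hA : ContDiffOn ℝ ∞ A U)
    (hinj : ∀ z ∈ U, Function.Injective (A z))
    (hdim : Module.finrank ℝ F = Module.finrank ℝ G) {f : E → F}
    (hf : ContDiffOn ℝ ∞ (fun z ↦ A z (f z)) U) : ContDiffOn ℝ ∞ f U := by
  have : CompleteSpace F := FiniteDimensional.complete ℝ F
  have hinv : ∀ z ∈ U, (A z).IsInvertible := fun z hz ↦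
    ⟨(LinearEquiv.ofInjectiveOfFinrankEq (A z : F →ₗ[ℝ] G) (hinj z hz)
      hdim).toContinuousLinearEquiv, by ext; rfl⟩
  intro z hz
  have h1 := hA.contDiffAt (hU.mem_nhds hz)
  have h2 := ((hinv z hz).contDiffAt_map_inverse (n := ∞)).comp z h1
  refine ((h2.clm_apply (hf.contDiffAt (hU.mem_nhds hz))).congr_of_eventuallyEq
    ?_).contDiffWithinAt
  filter_upwards [hU.mem_nhds hz] with y hy
  exact ((hinv y hy).inverse_apply_eq.2 rfl).symm

section helpers

variable {E : Type*} [NormedAddCommGroup E] [NormedSpace ℝ E] [FiniteDimensional ℝ E]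

theorem ContDiffOn.fderiv_sub_flip {U : Set E} (hU : IsOpen U) {f : E → E →L[ℝ] ℝ}
    (hf : ContDiffOn ℝ ∞ f U) :
    ContDiffOn ℝ ∞ (fun z ↦ fderiv ℝ f z - (fderiv ℝ f z).flip) U := by
  have h := hf.fderiv_of_isOpen (m := ∞) hU (by simp)
  exact h.sub (contDiffOn_clm_apply.2 fun u ↦ contDiffOn_clm_apply.2 fun v ↦
    (h.clm_apply contDiffOn_const).clm_apply contDiffOn_const)

theorem ContDiffOn.clm_comp_right {U : Set E} {B : E → E →L[ℝ] E →L[ℝ] ℝ} {J : E → E →L[ℝ] E}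
    (hB : ContDiffOn ℝ ∞ B U) (hJ : ContDiffOn ℝ ∞ J U) :
    ContDiffOn ℝ ∞ (fun z ↦ ((ContinuousLinearMap.compL ℝ E E ℝ).flip (J z)).comp (B z)) U :=
  contDiffOn_clm_apply.2 fun u ↦ contDiffOn_clm_apply.2 fun v ↦
    (hB.clm_apply contDiffOn_const).clm_apply (hJ.clm_apply contDiffOn_const)

theorem ContinuousLinearMap.finrank_dual :
    Module.finrank ℝ E = Module.finrank ℝ (E →L[ℝ] ℝ) := by
  rw [← (LinearMap.toContinuousLinearMap (𝕜 := ℝ) (E := E) (F' := ℝ)).finrank_eq]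
  exact (Subspace.dual_finrank_eq (K := ℝ) (V := E)).symm

end helpers

namespace PseudoHermitianStructure

open CoordinateFrame

variable {m : ℕ} {M : Type*} [TopologicalSpace M]
  [ChartedSpace (EuclideanSpace ℝ (Fin (2 * m + 1))) M] [IsManifold (𝓡 (2 * m + 1)) ∞ M]
  (P : PseudoHermitianStructure m M) {p x : M}

theorem dθ_swap (u v : TangentSpace (𝓡 (2 * m + 1)) x) : P.dθ x u v = - P.dθ x v u := by
  have h : P.dθ x (u + v) (u + v) = 0 := exteriorDeriv_self P.smooth_θ x _
  have hu : P.dθ x u u = 0 := exteriorDeriv_self P.smooth_θ x _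
  have hv : P.dθ x v v = 0 := exteriorDeriv_self P.smooth_θ x _
  simp only [map_add, add_apply, hu, hv] at h
  linarith

theorem θ_reeb (x : M) : P.θ x (P.reeb x) = 1 := (P.reeb_spec x).1

theorem dθ_reeb (v : TangentSpace (𝓡 (2 * m + 1)) x) : P.dθ x (P.reeb x) v = 0 :=
  (P.reeb_spec x).2 v

theorem dθ_reeb_right (v : TangentSpace (𝓡 (2 * m + 1)) x) : P.dθ x v (P.reeb x) = 0 := by
  rw [dθ_swap, dθ_reeb, neg_zero]

theorem J_reeb (x : M) : P.J x (P.reeb x) = 0 := P.J_radical x _ fun w ↦ P.dθ_reeb w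

theorem θ_projH (v : TangentSpace (𝓡 (2 * m + 1)) x) : P.θ x (P.projH x v) = 0 := by
  rw [projH, map_sub, map_smul, θ_reeb]
  simp

theorem dθ_projH (u v : TangentSpace (𝓡 (2 * m + 1)) x) :
    P.dθ x (P.projH x u) v = P.dθ x u v := by
  rw [projH, map_sub, map_smul, sub_apply, smul_apply, dθ_reeb]
  simp

theorem J_projH (v : TangentSpace (𝓡 (2 * m + 1)) x) : P.J x (P.projH x v) = P.J x v := by
  rw [projH, map_sub, map_smul, J_reeb]
  simp

theorem θ_J (v : TangentSpace (𝓡 (2 * m + 1)) x) : P.θ x (P.J x v) = 0 := by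
  rw [← J_projH]
  exact P.J_mem x _ (P.θ_projH v)

theorem J_J_eq (v : TangentSpace (𝓡 (2 * m + 1)) x) : P.J x (P.J x v) = - P.projH x v := by
  rw [← P.J_J x _ (P.θ_projH v), J_projH]

theorem webster_eq (u v : TangentSpace (𝓡 (2 * m + 1)) x) :
    P.webster x u v = P.θ x u * P.θ x v + P.dθ x u (P.J x v) := by
  rw [webster, dθ_projH, J_projH]

theorem levi_nonneg (v : TangentSpace (𝓡 (2 * m + 1)) x) : 0 ≤ P.dθ x v (P.J x v) := by
  rw [← dθ_projH, ← J_projH]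
  rcases eq_or_ne (P.projH x v) 0 with h | h
  · rw [h]; simp
  · exact (P.levi_pos x _ (P.θ_projH v) h).le

theorem eq_of_levi_eq_zero {v : TangentSpace (𝓡 (2 * m + 1)) x} (hv : P.dθ x v (P.J x v) = 0) :
    v = P.θ x v • P.reeb x := by
  rw [← dθ_projH, ← J_projH] at hv
  have h : P.projH x v = 0 := by
    by_contra h
    exact (P.levi_pos x _ (P.θ_projH v) h).ne' hv
  exact sub_eq_zero.1 h

/-- The components of `θ` in the chart at `p`. -/
def coordθ (p : M) (z : EuclideanSpace ℝ (Fin (2 * m + 1))) :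
    EuclideanSpace ℝ (Fin (2 * m + 1)) →L[ℝ] ℝ :=
  (P.θ ((extChartAt (𝓡 (2 * m + 1)) p).symm z)).comp
    (frameL p ((extChartAt (𝓡 (2 * m + 1)) p).symm z))

/-- The components of `J` in the chart at `p`. -/
def coordJ (p : M) (z : EuclideanSpace ℝ (Fin (2 * m + 1))) :
    EuclideanSpace ℝ (Fin (2 * m + 1)) →L[ℝ] EuclideanSpace ℝ (Fin (2 * m + 1)) :=
  (coord p ((extChartAt (𝓡 (2 * m + 1)) p).symm z)).comp
    ((P.J ((extChartAt (𝓡 (2 * m + 1)) p).symm z)).comp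
      (frameL p ((extChartAt (𝓡 (2 * m + 1)) p).symm z)))

/-- The components of `dθ` in the chart at `p`. -/
def coordΩ (p : M) (z : EuclideanSpace ℝ (Fin (2 * m + 1))) :
    EuclideanSpace ℝ (Fin (2 * m + 1)) →L[ℝ] EuclideanSpace ℝ (Fin (2 * m + 1)) →L[ℝ] ℝ :=
  fderiv ℝ (P.coordθ p) z - (fderiv ℝ (P.coordθ p) z).flip

/-- The components of `dθ(·, J ·)` in the chart at `p`. -/
def coordG (p : M) (z : EuclideanSpace ℝ (Fin (2 * m + 1))) :
    EuclideanSpace ℝ (Fin (2 * m + 1)) →L[ℝ] EuclideanSpace ℝ (Fin (2 * m + 1)) →L[ℝ] ℝ :=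
  ((ContinuousLinearMap.compL ℝ (EuclideanSpace ℝ (Fin (2 * m + 1)))
    (EuclideanSpace ℝ (Fin (2 * m + 1))) ℝ).flip (P.coordJ p z)).comp (P.coordΩ p z)

/-- The components of the Reeb vector field in the chart at `p`. -/
def coordξ (p : M) : EuclideanSpace ℝ (Fin (2 * m + 1)) → EuclideanSpace ℝ (Fin (2 * m + 1)) :=
  localRep p P.reeb

variable (hx : x ∈ (chartAt (EuclideanSpace ℝ (Fin (2 * m + 1))) p).source)
include hx

theorem coordθ_chart (u : EuclideanSpace ℝ (Fin (2 * m + 1))) :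
    P.coordθ p (extChartAt (𝓡 (2 * m + 1)) p x) u = P.θ x (frame p u x) := by
  rw [coordθ, extChartAt_left_inv hx]
  rfl

theorem coordJ_chart (u : EuclideanSpace ℝ (Fin (2 * m + 1))) :
    P.coordJ p (extChartAt (𝓡 (2 * m + 1)) p x) u = coord p x (P.J x (frame p u x)) := by
  rw [coordJ, extChartAt_left_inv hx]
  rfl

theorem contMDiffAt_θ_frame (u : EuclideanSpace ℝ (Fin (2 * m + 1))) :
    ContMDiffAt (𝓡 (2 * m + 1)) 𝓘(ℝ, ℝ) ∞ (fun y ↦ P.θ y (frame p u y)) x := by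
  have h2 := ContMDiffAt.clm_bundle_apply (F₂ := ℝ) (E₂ := Bundle.Trivial M ℝ)
    (b := fun y : M ↦ y) (P.smooth_θ x) (contMDiffAt_frame hx u)
  rw [Bundle.contMDiffAt_section] at h2
  simpa using! h2

theorem contMDiffAt_J_frame (u : EuclideanSpace ℝ (Fin (2 * m + 1))) :
    ContMDiffAt (𝓡 (2 * m + 1)) ((𝓡 (2 * m + 1)).prod (𝓡 (2 * m + 1))) ∞
      (T% (fun y ↦ P.J y (frame p u y))) x :=
  ContMDiffAt.clm_bundle_apply (F₂ := EuclideanSpace ℝ (Fin (2 * m + 1)))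
    (E₂ := fun y : M ↦ TangentSpace (𝓡 (2 * m + 1)) y)
    (b := fun y : M ↦ y) (P.smooth_J x) (contMDiffAt_frame hx u)

omit hx in
theorem contDiffOn_coordθ (p : M) : ContDiffOn ℝ ∞ (P.coordθ p)
    (chartAt (EuclideanSpace ℝ (Fin (2 * m + 1))) p).target :=
  contDiffOn_clm_apply.2 fun u ↦ contDiffOn_comp_symm fun y hy ↦ P.contMDiffAt_θ_frame hy u

omit hx in
theorem contDiffOn_coordJ (p : M) : ContDiffOn ℝ ∞ (P.coordJ p)
    (chartAt (EuclideanSpace ℝ (Fin (2 * m + 1))) p).target :=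
  contDiffOn_clm_apply.2 fun u ↦ contDiffOn_comp_symm (f := fun y ↦ coord p y (P.J y (frame p u y)))
    fun y hy ↦ (contMDiffAt_section_iff hy).1 (P.contMDiffAt_J_frame hy u)

omit hx in
theorem contDiffOn_coordΩ (p : M) : ContDiffOn ℝ ∞ (P.coordΩ p)
    (chartAt (EuclideanSpace ℝ (Fin (2 * m + 1))) p).target :=
  (P.contDiffOn_coordθ p).fderiv_sub_flip (chartAt _ p).open_target

omit hx in
theorem contDiffOn_coordG (p : M) : ContDiffOn ℝ ∞ (P.coordG p)
    (chartAt (EuclideanSpace ℝ (Fin (2 * m + 1))) p).target :=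
  (P.contDiffOn_coordΩ p).clm_comp_right (P.contDiffOn_coordJ p)

theorem coordΩ_chart (u v : EuclideanSpace ℝ (Fin (2 * m + 1))) :
    P.coordΩ p (extChartAt (𝓡 (2 * m + 1)) p x) u v = P.dθ x (frame p u x) (frame p v x) := by
  have hd := ((P.contDiffOn_coordθ p).contDiffAt ((chartAt _ p).open_target.mem_nhds
    (extChartAt_mem_target hx))).differentiableAt (by simp)
  have key : ∀ u v : EuclideanSpace ℝ (Fin (2 * m + 1)),
      mvfderiv (𝓡 (2 * m + 1)) (fun y ↦ P.θ y (frame p v y)) x (frame p u x) =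
        fderiv ℝ (P.coordθ p) (extChartAt (𝓡 (2 * m + 1)) p x) u v := by
    intro u v
    rw [mvfderiv_eq hx ((P.contMDiffAt_θ_frame hx v).mdifferentiableAt (by simp)), coord_frame hx]
    have := hd.hasFDerivAt.clm_apply (hasFDerivAt_const v _)
    refine (congrArg (fun L ↦ L u) this.fderiv).trans ?_
    simp
  rw [dθ, exteriorDeriv_apply P.smooth_θ (mdifferentiableAt_frame hx u)
    (mdifferentiableAt_frame hx v), key, key, mlieBracket_frame hx, map_zero, sub_zero]
  rfl

theorem coordG_chart (u v : EuclideanSpace ℝ (Fin (2 * m + 1))) :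
    P.coordG p (extChartAt (𝓡 (2 * m + 1)) p x) u v =
      P.dθ x (frame p u x) (P.J x (frame p v x)) := by
  have : frame p (coord p x (P.J x (frame p v x))) x = P.J x (frame p v x) := frameL_coord hx _
  rw [← this, ← P.coordΩ_chart hx, ← P.coordJ_chart hx]
  rfl

theorem coordξ_chart : P.coordξ p (extChartAt (𝓡 (2 * m + 1)) p x) = coord p x (P.reeb x) :=
  localRep_chart _ hx

theorem frame_coordξ : frame p (P.coordξ p (extChartAt (𝓡 (2 * m + 1)) p x)) x = P.reeb x := by
  rw [coordξ_chart P hx]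
  exact frameL_coord hx _

omit hx in
-- The Reeb field is chosen pointwise, but it solves the smooth linear system Ω(v, ·) + θ(v)θ = θ.
-- The left side is injective in v: testing its kernel on ξ gives θ(v) = 0, and then testing on Jv
-- gives zero Levi norm.
theorem contDiffOn_coordξ (p : M) : ContDiffOn ℝ ∞ (P.coordξ p)
    (chartAt (EuclideanSpace ℝ (Fin (2 * m + 1))) p).target := by
  have hU := (chartAt (EuclideanSpace ℝ (Fin (2 * m + 1))) p).open_target
  refine ContDiffOn.of_clm_apply hU (A := fun z ↦ P.coordΩ p z +
    (P.coordθ p z).smulRight (P.coordθ p z))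
    ((P.contDiffOn_coordΩ p).add ((P.contDiffOn_coordθ p).smulRight (P.contDiffOn_coordθ p)))
    (fun z hz ↦ ?_) ?_ ?_
  · rw [injective_iff_map_eq_zero]
    intro v hv
    obtain ⟨x, hx, rfl⟩ : ∃ x, x ∈ (chartAt (EuclideanSpace ℝ (Fin (2 * m + 1))) p).source ∧
        extChartAt (𝓡 (2 * m + 1)) p x = z :=
      ⟨_, extChartAt_symm_mem hz, extChartAt_right_inv hz⟩
    have hv' : ∀ w, P.dθ x (frame p v x) (frame p w x) +
        P.θ x (frame p v x) * P.θ x (frame p w x) = 0 := by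
      intro w
      rw [← P.coordΩ_chart hx, ← P.coordθ_chart hx, ← P.coordθ_chart hx]
      exact congrArg (fun L ↦ L w) hv
    have h1 : P.θ x (frame p v x) = 0 := by
      have := hv' (P.coordξ p (extChartAt (𝓡 (2 * m + 1)) p x))
      rwa [frame_coordξ P hx, dθ_reeb_right, θ_reeb, zero_add, mul_one] at this
    have h2 := hv' (coord p x (P.J x (frame p v x)))
    rw [show frame p (coord p x (P.J x (frame p v x))) x = _ from frameL_coord hx _, h1, zero_mul,
      add_zero] at h2
    have h3 := P.eq_of_levi_eq_zero h2
    rw [h1, zero_smul] at h3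
    rw [← coord_frame hx v, h3, map_zero]
  · exact ContinuousLinearMap.finrank_dual
  · refine (P.contDiffOn_coordθ p).congr fun z hz ↦ ?_
    obtain ⟨x, hx, rfl⟩ : ∃ x, x ∈ (chartAt (EuclideanSpace ℝ (Fin (2 * m + 1))) p).source ∧
        extChartAt (𝓡 (2 * m + 1)) p x = z :=
      ⟨_, extChartAt_symm_mem hz, extChartAt_right_inv hz⟩
    ext w
    have h1 := P.coordΩ_chart hx (P.coordξ p (extChartAt (𝓡 (2 * m + 1)) p x)) w
    have h2 := P.coordθ_chart hx (P.coordξ p (extChartAt (𝓡 (2 * m + 1)) p x))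
    rw [frame_coordξ P hx, dθ_reeb] at h1
    rw [frame_coordξ P hx, θ_reeb] at h2
    simp only [add_apply, ContinuousLinearMap.smulRight_apply, h1, h2, one_smul, zero_add]

theorem contMDiffAt_reeb : ContMDiffAt (𝓡 (2 * m + 1)) ((𝓡 (2 * m + 1)).prod (𝓡 (2 * m + 1))) ∞
    (T% P.reeb) x := by
  rw [contMDiffAt_section_iff hx]
  have h := ((P.contDiffOn_coordξ p).contDiffAt ((chartAt _ p).open_target.mem_nhds
    (extChartAt_mem_target hx))).contMDiffAt.comp x (contMDiffAt_chart hx)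
  refine h.congr_of_eventuallyEq ?_
  filter_upwards [(chartAt _ p).open_source.mem_nhds hx] with y hy
  exact (coordξ_chart P hy).symm

end PseudoHermitianStructure

end

noncomputable section

set_option synthInstance.maxHeartbeats 200000
set_option maxHeartbeats 1000000
open Connection

theorem LocalConnection.curv_smul_self {E : Type*} [NormedAddCommGroup E] [NormedSpace ℝ E]
    (Γ : E → E →L[ℝ] E →L[ℝ] E) (x u w : E) (a : ℝ) : curv Γ x u (a • u) w = 0 := by
  have h1 : fderiv ℝ Γ x u (a • u) = a • fderiv ℝ Γ x u u := map_smul (fderiv ℝ Γ x u) a u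
  have h2 : fderiv ℝ Γ x (a • u) = a • fderiv ℝ Γ x u := map_smul (fderiv ℝ Γ x) a u
  have h3 : Γ x (a • u) = a • Γ x u := map_smul (Γ x) a u
  have h4 : Γ x u (a • Γ x u w) = a • Γ x u (Γ x u w) := map_smul (Γ x u) a _
  have h5 : (a • Γ x u) (Γ x u w) = a • Γ x u (Γ x u w) := rfl
  rw [curv, h1, h2, h3, smul_apply, smul_apply, smul_apply, smul_apply, h4, h5]
  abel

namespace PseudoHermitianStructure

open CoordinateFrame

variable {m : ℕ} {M : Type*} [TopologicalSpace M]
  [ChartedSpace (EuclideanSpace ℝ (Fin (2 * m + 1))) M] [IsManifold (𝓡 (2 * m + 1)) ∞ M]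
  (P : PseudoHermitianStructure m M) {p x : M}

/-! ### Consequences of integrability and of the axioms of the connection -/

theorem mdifferentiableAt_reeb (x : M) : DifferentiableVectorFieldAt P.reeb x :=
  (P.contMDiffAt_reeb (mem_chart_source _ x)).mdifferentiableAt (by simp)

theorem mdifferentiableAt_projH {X : Π x : M, TangentSpace (𝓡 (2 * m + 1)) x}
    (hX : DifferentiableVectorFieldAt X x) : DifferentiableVectorFieldAt (fun y ↦ P.projH y (X y)) x :=
  mdifferentiableAt_sub_section hX (MDifferentiableAt.smul_section
    (P.smooth_θ.mdifferentiableAt_apply hX) (P.mdifferentiableAt_reeb x))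

theorem mdifferentiableAt_J {X : Π x : M, TangentSpace (𝓡 (2 * m + 1)) x}
    (hX : DifferentiableVectorFieldAt X x) : DifferentiableVectorFieldAt (fun y ↦ P.J y (X y)) x :=
  MDifferentiableAt.clm_bundle_apply (F₂ := EuclideanSpace ℝ (Fin (2 * m + 1)))
    (E₂ := fun y : M ↦ TangentSpace (𝓡 (2 * m + 1)) y) (b := fun y : M ↦ y)
    ((P.smooth_J x).mdifferentiableAt (by simp)) hX

theorem exists_field (v : TangentSpace (𝓡 (2 * m + 1)) x) :
    ∃ X : Π x : M, TangentSpace (𝓡 (2 * m + 1)) x, DifferentiableVectorFieldAt X x ∧ X x = v :=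
  ⟨frame x (coord x x v), mdifferentiableAt_frame (mem_chart_source _ x) _,
    frameL_coord (mem_chart_source _ x) v⟩

/-- The axioms on integrability and on `horizontal` ask for horizontality at every point but
differentiability only at x; applying `projH` to any extension achieves both. -/
theorem exists_horizontal_field (v : TangentSpace (𝓡 (2 * m + 1)) x) :
    ∃ X : Π x : M, TangentSpace (𝓡 (2 * m + 1)) x, DifferentiableVectorFieldAt X x ∧ X x = P.projH x v ∧
      ∀ y, P.θ y (X y) = 0 := by
  obtain ⟨X, hX, hv⟩ := exists_field v
  exact ⟨_, P.mdifferentiableAt_projH hX, by rw [hv], fun y ↦ P.θ_projH _⟩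

theorem dθ_apply_of_horizontal {X Y : Π x : M, TangentSpace (𝓡 (2 * m + 1)) x}
    (hX : DifferentiableVectorFieldAt X x) (hY : DifferentiableVectorFieldAt Y x) (hX' : ∀ y, P.θ y (X y) = 0)
    (hY' : ∀ y, P.θ y (Y y) = 0) :
    P.dθ x (X x) (Y x) = - P.θ x (mlieBracket (𝓡 (2 * m + 1)) X Y x) := by
  rw [dθ, exteriorDeriv_apply P.smooth_θ hX hY]
  simp only [hX', hY', mvfderiv_const]
  simp

/-- For horizontal fields dθ(X, Y) = -θ([X, Y]), and the first half of integrability says that [X,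
Y] - [JX, JY] is horizontal. -/
theorem dθ_J_J (u v : TangentSpace (𝓡 (2 * m + 1)) x) :
    P.dθ x (P.J x u) (P.J x v) = P.dθ x u v := by
  obtain ⟨X, hX, hu, hX'⟩ := P.exists_horizontal_field u
  obtain ⟨Y, hY, hv, hY'⟩ := P.exists_horizontal_field v
  have h1 := P.dθ_apply_of_horizontal hX hY hX' hY'
  have h2 := P.dθ_apply_of_horizontal (P.mdifferentiableAt_J hX) (P.mdifferentiableAt_J hY)
    (fun y ↦ P.θ_J _) (fun y ↦ P.θ_J _)
  have h3 := (P.integrable X Y x hX' hY' hX hY).1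
  rw [map_sub] at h3
  rw [hu, hv, dθ_projH, dθ_swap, dθ_projH, ← dθ_swap] at h1
  rw [hu, hv, J_projH, J_projH] at h2
  linarith

theorem levi_swap (u v : TangentSpace (𝓡 (2 * m + 1)) x) :
    P.dθ x u (P.J x v) = P.dθ x v (P.J x u) := by
  rw [← dθ_J_J, J_J_eq, map_neg, dθ_swap, dθ_projH, neg_neg]

variable {cov : CovariantDerivative (𝓡 (2 * m + 1)) (EuclideanSpace ℝ (Fin (2 * m + 1)))
  (TangentSpace (𝓡 (2 * m + 1)) : M → Type _)}

namespace IsTanakaWebster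

variable {P} (h : P.IsTanakaWebster cov)
include h

/-- ∇ξ is orthogonal to ξ because ξ has unit length, and to H(M) because the metric connection
preserves H(M), the orthogonal complement of ξ. -/
theorem cov_reeb (v : TangentSpace (𝓡 (2 * m + 1)) x) : cov P.reeb x v = 0 := by
  have hξ := P.mdifferentiableAt_reeb x
  have h1 : P.θ x (cov P.reeb x v) = 0 := by
    have := h.metric P.reeb P.reeb x v hξ hξ
    simp only [webster_eq, θ_reeb, J_reeb, map_zero, dθ_reeb, mul_one, add_zero, one_mul,
      mvfderiv_const] at this
    have h0 : (0 : TangentSpace (𝓡 (2 * m + 1)) x →L[ℝ] ℝ) v = 0 := rfl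
    linarith
  -- The test field takes the horizontal part of ∇ξ itself as value, so orthogonality makes the Levi
  -- norm of ∇ξ zero.
  obtain ⟨X, hX, hXv, hX'⟩ := P.exists_horizontal_field (cov P.reeb x v)
  have h2 := h.metric X P.reeb x v hX hξ
  have h3 : P.θ x (cov X x v) = 0 := h.horizontal X x v hX' hX
  simp only [webster_eq, hX', J_reeb, map_zero, zero_mul, h3, add_zero, zero_add,
    mvfderiv_const, hXv, dθ_projH, h1, mul_zero] at h2
  have h4 := P.eq_of_levi_eq_zero (v := cov P.reeb x v) (by
    have h0 : (0 : TangentSpace (𝓡 (2 * m + 1)) x →L[ℝ] ℝ) v = 0 := rfl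
    linarith)
  rw [h4, h1, zero_smul]

/-- ∇θ = 0: split X into its horizontal part, whose derivatives stay horizontal, and a multiple of
the parallel field ξ. -/
theorem mvfderiv_θ {X : Π x : M, TangentSpace (𝓡 (2 * m + 1)) x} (hX : DifferentiableVectorFieldAt X x)
    (v : TangentSpace (𝓡 (2 * m + 1)) x) :
    mvfderiv (𝓡 (2 * m + 1)) (fun y ↦ P.θ y (X y)) x v = P.θ x (cov X x v) := by
  have hf := P.smooth_θ.mdifferentiableAt_apply hX
  have hξ := P.mdifferentiableAt_reeb x
  have hp := P.mdifferentiableAt_projH hX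
  have h1 : X = (fun y ↦ P.projH y (X y)) + (fun y ↦ P.θ y (X y)) • P.reeb := by
    ext1 y
    simp [projH]
  have h2 : cov X x = _ := congrArg (fun Z ↦ cov Z x) h1
  rw [cov.isCovariantDerivativeOn.add hp (MDifferentiableAt.smul_section hf hξ),
    cov.isCovariantDerivativeOn.leibniz hξ hf] at h2
  have h3 : P.θ x (cov (fun y ↦ P.projH y (X y)) x v) = 0 :=
    h.horizontal _ x v (fun y ↦ P.θ_projH _) hp
  rw [h2]
  simp [h3, h.cov_reeb, θ_reeb]

/-- The Levi form is the Webster metric minus θ ⊗ θ, and both of these are parallel. -/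
theorem mvfderiv_levi {X Y : Π x : M, TangentSpace (𝓡 (2 * m + 1)) x} (hX : DifferentiableVectorFieldAt X x)
    (hY : DifferentiableVectorFieldAt Y x) (hl : MDifferentiableAt (𝓡 (2 * m + 1)) 𝓘(ℝ, ℝ)
      (fun y ↦ P.dθ y (X y) (P.J y (Y y))) x) (v : TangentSpace (𝓡 (2 * m + 1)) x) :
    mvfderiv (𝓡 (2 * m + 1)) (fun y ↦ P.dθ y (X y) (P.J y (Y y))) x v =
      P.dθ x (cov X x v) (P.J x (Y x)) + P.dθ x (X x) (P.J x (cov Y x v)) := by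
  have h1 := h.metric X Y x v hX hY
  have hfX := P.smooth_θ.mdifferentiableAt_apply hX
  have hfY := P.smooth_θ.mdifferentiableAt_apply hY
  simp only [webster_eq] at h1
  have h2 := congrArg (fun L ↦ L v) (mvfderiv_add (hfX.mul hfY) hl)
  have h3 := congrArg (fun L ↦ L v) (mvfderiv_mul hfX hfY)
  have h4 := h.mvfderiv_θ hX v
  have h5 := h.mvfderiv_θ hY v
  simp only [add_apply, smul_apply, smul_eq_mul] at h2 h3
  have h6 := h1.symm.trans h2
  rw [h3, h4, h5] at h6
  linarith

/-! ### Parallel tensors, torsion and curvature sign in coordinates -/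

section coordinates

omit h in
theorem frame_christoffel (hx : x ∈ (chartAt (EuclideanSpace ℝ (Fin (2 * m + 1))) p).source)
    (u v : EuclideanSpace ℝ (Fin (2 * m + 1))) :
    frame p (christoffel cov p (extChartAt (𝓡 (2 * m + 1)) p x) u v) x =
      cov (frame p v) x (frame p u x) := by
  rw [christoffel_apply cov hx]
  exact frameL_coord hx _

theorem fderiv_coordθ (hx : x ∈ (chartAt (EuclideanSpace ℝ (Fin (2 * m + 1))) p).source)
    (u v : EuclideanSpace ℝ (Fin (2 * m + 1))) :
    fderiv ℝ (P.coordθ p) (extChartAt (𝓡 (2 * m + 1)) p x) u v =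
      P.coordθ p (extChartAt (𝓡 (2 * m + 1)) p x)
        (christoffel cov p (extChartAt (𝓡 (2 * m + 1)) p x) u v) := by
  have hd := ((P.contDiffOn_coordθ p).contDiffAt ((chartAt _ p).open_target.mem_nhds
    (extChartAt_mem_target hx))).differentiableAt (by simp)
  rw [P.coordθ_chart hx, frame_christoffel hx, ← h.mvfderiv_θ (mdifferentiableAt_frame hx v),
    mvfderiv_eq hx ((P.contMDiffAt_θ_frame hx v).mdifferentiableAt (by simp)), coord_frame hx]
  have := hd.hasFDerivAt.clm_apply (hasFDerivAt_const v _)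
  refine (Eq.trans ?_ (congrArg (fun L ↦ L u) this.fderiv).symm)
  simp

theorem fderiv_coordξ (hx : x ∈ (chartAt (EuclideanSpace ℝ (Fin (2 * m + 1))) p).source)
    (u : EuclideanSpace ℝ (Fin (2 * m + 1))) :
    fderiv ℝ (P.coordξ p) (extChartAt (𝓡 (2 * m + 1)) p x) u =
      - christoffel cov p (extChartAt (𝓡 (2 * m + 1)) p x) u
        (P.coordξ p (extChartAt (𝓡 (2 * m + 1)) p x)) := by
  have h1 := coord_cov cov hx (P.mdifferentiableAt_reeb x) (frame p u x)
  rw [h.cov_reeb, map_zero, coord_frame hx] at h1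
  rw [coordξ_chart P hx]
  exact eq_neg_of_add_eq_zero_left h1.symm

theorem fderiv_coordG (hx : x ∈ (chartAt (EuclideanSpace ℝ (Fin (2 * m + 1))) p).source)
    (u v w : EuclideanSpace ℝ (Fin (2 * m + 1))) :
    fderiv ℝ (P.coordG p) (extChartAt (𝓡 (2 * m + 1)) p x) u v w =
      P.coordG p (extChartAt (𝓡 (2 * m + 1)) p x)
        (christoffel cov p (extChartAt (𝓡 (2 * m + 1)) p x) u v) w +
      P.coordG p (extChartAt (𝓡 (2 * m + 1)) p x) v
        (christoffel cov p (extChartAt (𝓡 (2 * m + 1)) p x) u w) := by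
  have hd := ((P.contDiffOn_coordG p).contDiffAt ((chartAt _ p).open_target.mem_nhds
    (extChartAt_mem_target hx))).differentiableAt (by simp)
  have h1 := hasFDerivAt_clm_apply_apply hd.hasFDerivAt v w
  have h2 : MDifferentiableAt (𝓡 (2 * m + 1)) 𝓘(ℝ, ℝ)
      (fun y ↦ P.dθ y (frame p v y) (P.J y (frame p w y))) x := by
    refine (h1.differentiableAt.mdifferentiableAt.comp x
      ((contMDiffAt_chart hx).mdifferentiableAt (by simp))).congr_of_eventuallyEq ?_
    filter_upwards [(chartAt _ p).open_source.mem_nhds hx] with y hy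
    exact (P.coordG_chart hy v w).symm
  have h3 : (fun z ↦ P.dθ ((extChartAt (𝓡 (2 * m + 1)) p).symm z)
      (frame p v ((extChartAt (𝓡 (2 * m + 1)) p).symm z))
      (P.J _ (frame p w ((extChartAt (𝓡 (2 * m + 1)) p).symm z)))) =ᶠ[𝓝
        (extChartAt (𝓡 (2 * m + 1)) p x)] fun z ↦ P.coordG p z v w := by
    filter_upwards [(chartAt _ p).open_target.mem_nhds (extChartAt_mem_target hx)] with z hz
    rw [← P.coordG_chart (extChartAt_symm_mem hz), extChartAt_right_inv hz]
  rw [P.coordG_chart hx, P.coordG_chart hx, frame_christoffel hx, frame_christoffel hx,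
    ← h.mvfderiv_levi (mdifferentiableAt_frame hx v) (mdifferentiableAt_frame hx w) h2,
    mvfderiv_eq hx h2, coord_frame hx, h3.fderiv_eq, h1.fderiv]
  rfl

theorem fderiv_coordJ (hx : x ∈ (chartAt (EuclideanSpace ℝ (Fin (2 * m + 1))) p).source)
    (u v : EuclideanSpace ℝ (Fin (2 * m + 1))) :
    fderiv ℝ (fun z ↦ P.coordJ p z v) (extChartAt (𝓡 (2 * m + 1)) p x) u =
      P.coordJ p (extChartAt (𝓡 (2 * m + 1)) p x)
        (christoffel cov p (extChartAt (𝓡 (2 * m + 1)) p x) u v) -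
      christoffel cov p (extChartAt (𝓡 (2 * m + 1)) p x) u
        (P.coordJ p (extChartAt (𝓡 (2 * m + 1)) p x) v) := by
  have h1 := coord_cov cov hx (P.mdifferentiableAt_J (mdifferentiableAt_frame hx v)) (frame p u x)
  rw [h.parallel_J _ x _ (mdifferentiableAt_frame hx v), ← frame_christoffel hx,
    ← P.coordJ_chart hx, ← P.coordJ_chart hx, coord_frame hx] at h1
  exact eq_sub_of_add_eq h1.symm

theorem fderiv_coordΩ (hx : x ∈ (chartAt (EuclideanSpace ℝ (Fin (2 * m + 1))) p).source)
    (u v w : EuclideanSpace ℝ (Fin (2 * m + 1))) :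
    fderiv ℝ (P.coordΩ p) (extChartAt (𝓡 (2 * m + 1)) p x) u v w =
      P.coordΩ p (extChartAt (𝓡 (2 * m + 1)) p x)
        (christoffel cov p (extChartAt (𝓡 (2 * m + 1)) p x) u v) w +
      P.coordΩ p (extChartAt (𝓡 (2 * m + 1)) p x) v
        (christoffel cov p (extChartAt (𝓡 (2 * m + 1)) p x) u w) := by
  -- Since J² = -π_H and dθ annihilates ξ, dθ is recovered from G and J; it is therefore parallel
  -- because they are.
  have key : ∀ y ∈ (chartAt (EuclideanSpace ℝ (Fin (2 * m + 1))) p).source, ∀ a b,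
      P.coordΩ p (extChartAt (𝓡 (2 * m + 1)) p y) a b =
        - P.coordG p (extChartAt (𝓡 (2 * m + 1)) p y) a
          (P.coordJ p (extChartAt (𝓡 (2 * m + 1)) p y) b) := by
    intro y hy a b
    have : frame p (coord p y (P.J y (frame p b y))) y = P.J y (frame p b y) := frameL_coord hy _
    rw [P.coordΩ_chart hy, P.coordG_chart hy, P.coordJ_chart hy, this, J_J_eq, map_neg, neg_neg,
      dθ_swap _ (frame p a y) (P.projH y _), dθ_projH, ← dθ_swap]
  have hU := (chartAt (EuclideanSpace ℝ (Fin (2 * m + 1))) p).open_target.mem_nhds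
    (extChartAt_mem_target hx)
  have hΩ := ((P.contDiffOn_coordΩ p).contDiffAt hU).differentiableAt (by simp)
  have hG := ((P.contDiffOn_coordG p).contDiffAt hU).differentiableAt (by simp)
  have hJ := ((((P.contDiffOn_coordJ p).clm_apply
    (contDiffOn_const (c := w))).contDiffAt hU).differentiableAt (by simp)).hasFDerivAt
  have hG' := (hG.hasFDerivAt.clm_apply (hasFDerivAt_const v _)).clm_apply hJ
  have h1 : (fun z ↦ P.coordΩ p z v w) =ᶠ[𝓝 (extChartAt (𝓡 (2 * m + 1)) p x)]
      fun z ↦ - P.coordG p z v (P.coordJ p z w) := by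
    filter_upwards [hU] with z hz
    have := key _ (extChartAt_symm_mem hz) v w
    rwa [extChartAt_right_inv hz] at this
  have h2 := congrArg (fun L ↦ L u) (((hasFDerivAt_clm_apply_apply hΩ.hasFDerivAt v w).fderiv.symm.trans
    h1.fderiv_eq).trans hG'.fun_neg.fderiv)
  have h3 := h.fderiv_coordG hx u v (P.coordJ p (extChartAt (𝓡 (2 * m + 1)) p x) w)
  have h4 := h.fderiv_coordJ hx u w
  refine h2.trans ?_
  simp only [neg_apply, add_apply, ContinuousLinearMap.comp_apply, zero_apply, map_zero,
    ContinuousLinearMap.flip_apply, h3, h4, map_sub, key x hx]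
  ring

/-- The Sasakian condition kills the torsion as soon as one argument is ξ, so the formula T = dθ ⊗ ξ
passes from horizontal to arbitrary vectors. -/
theorem christoffel_sub (hS : P.IsSasakian cov)
    (hx : x ∈ (chartAt (EuclideanSpace ℝ (Fin (2 * m + 1))) p).source)
    (u v : EuclideanSpace ℝ (Fin (2 * m + 1))) :
    christoffel cov p (extChartAt (𝓡 (2 * m + 1)) p x) u v -
      christoffel cov p (extChartAt (𝓡 (2 * m + 1)) p x) v u =
      P.coordΩ p (extChartAt (𝓡 (2 * m + 1)) p x) u v •
        P.coordξ p (extChartAt (𝓡 (2 * m + 1)) p x) := by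
  have hT : ∀ a b : TangentSpace (𝓡 (2 * m + 1)) x,
      cov.torsion x a b = P.dθ x a b • P.reeb x := by
    intro a b
    have h1 : ∀ a, cov.torsion x (P.reeb x) a = 0 := hS x
    have h2 : ∀ a, cov.torsion x a (P.reeb x) = 0 := fun a ↦ by
      rw [cov.torsion_antisymm, h1, neg_zero]
    have h3 := h.torsion_horizontal x (P.projH x a) (P.projH x b) (P.θ_projH a) (P.θ_projH b)
    rw [dθ_projH, dθ_swap, dθ_projH, ← dθ_swap] at h3
    rw [← h3]
    simp only [projH, map_sub, map_smul, sub_apply, smul_apply, h1, h2, smul_zero, sub_zero]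
  have h1 := cov.torsion_apply (mdifferentiableAt_frame hx u) (mdifferentiableAt_frame hx v)
  rw [mlieBracket_frame hx, sub_zero, hT] at h1
  rw [christoffel_apply cov hx, christoffel_apply cov hx, ← map_sub, ← h1, map_smul,
    P.coordΩ_chart hx, P.coordξ_chart hx]

theorem isSasakian_coord [T2Space M] (hS : P.IsSasakian cov) (p : M) :
    LocalConnection.IsSasakian (chartAt (EuclideanSpace ℝ (Fin (2 * m + 1))) p).target
      (christoffel cov p) (P.coordθ p) (P.coordΩ p) (P.coordG p) (P.coordξ p) := by
  have hex : ∀ z ∈ (chartAt (EuclideanSpace ℝ (Fin (2 * m + 1))) p).target,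
      ∃ x, x ∈ (chartAt (EuclideanSpace ℝ (Fin (2 * m + 1))) p).source ∧
        extChartAt (𝓡 (2 * m + 1)) p x = z :=
    fun z hz ↦ ⟨_, extChartAt_symm_mem hz, extChartAt_right_inv hz⟩
  refine ⟨(chartAt _ p).open_target, contDiffOn_christoffel cov h.smooth p, P.contDiffOn_coordθ p,
    P.contDiffOn_coordΩ p, P.contDiffOn_coordG p, P.contDiffOn_coordξ p, ?_, ?_, ?_, ?_, ?_, ?_, ?_,
    ?_, ?_, ?_, ?_, ?_⟩
  all_goals
    intro z hz
    obtain ⟨x, hx, rfl⟩ := hex z hz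
  · rw [P.coordθ_chart hx, P.frame_coordξ hx, θ_reeb]
  · intro u v
    rw [P.coordΩ_chart hx, P.coordΩ_chart hx, dθ_swap]
  · intro v
    rw [P.coordΩ_chart hx, P.frame_coordξ hx, dθ_reeb]
  · intro u v
    rw [P.coordG_chart hx, P.coordG_chart hx, levi_swap]
  · intro v
    rw [P.coordG_chart hx, P.frame_coordξ hx, dθ_reeb]
  · intro v
    rw [P.coordG_chart hx]
    exact P.levi_nonneg _
  · intro v hv
    rw [P.coordG_chart hx] at hv
    have := congrArg (coord p x) (P.eq_of_levi_eq_zero hv)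
    rwa [coord_frame hx, map_smul, ← P.coordξ_chart hx, ← P.coordθ_chart hx] at this
  · exact h.fderiv_coordθ hx
  · exact h.fderiv_coordξ hx
  · exact h.fderiv_coordΩ hx
  · exact h.fderiv_coordG hx
  · exact h.christoffel_sub hS hx

/-- For independent vectors the denominator of K^H is a positive Gram determinant and can be
cleared; for dependent ones the curvature vanishes by antisymmetry. -/
theorem coordG_curv_nonpos [T2Space M] (hK : P.HasNonposHorizontalCurvature cov) (p : M)
    (u v : EuclideanSpace ℝ (Fin (2 * m + 1)))
    (hu : P.coordθ p (extChartAt (𝓡 (2 * m + 1)) p p) u = 0)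
    (hv : P.coordθ p (extChartAt (𝓡 (2 * m + 1)) p p) v = 0) :
    P.coordG p (extChartAt (𝓡 (2 * m + 1)) p p) (LocalConnection.curv (christoffel cov p)
      (extChartAt (𝓡 (2 * m + 1)) p p) u v v) u ≤ 0 := by
  have hp : p ∈ (chartAt (EuclideanSpace ℝ (Fin (2 * m + 1))) p).source := mem_chart_source _ p
  by_cases hli : LinearIndependent ℝ ![frame p u p, frame p v p]
  · rw [P.coordθ_chart hp] at hu hv
    have h1 := hK p (frame p u p) (frame p v p) hu hv hli
    have h2 : frame p (coord p p (curvature cov p (frame p u p) (frame p v p) (frame p v p))) p =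
      curvature cov p (frame p u p) (frame p v p) (frame p v p) := frameL_coord hp _
    rw [← curvature_frame cov h.smooth, P.coordG_chart hp, h2]
    rw [horizontalSectionalCurvature] at h1
    simp only [webster_eq, hu, hv, mul_zero, zero_add] at h1
    generalize frame p u p = u' at *
    generalize frame p v p = v' at *
    have hvv : 0 < P.dθ p v' (P.J p v') := P.levi_pos p v' hv (by simpa using hli.ne_zero 1)
    -- The Levi norm of this Gram-Schmidt vector is ⟨v', v'⟩ times the Gram determinant, so its
    -- positivity is the strict Cauchy-Schwarz inequality.
    have hne : P.dθ p v' (P.J p v') • u' - P.dθ p u' (P.J p v') • v' ≠ 0 := by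
      intro h0
      have := (LinearIndependent.pair_iff.1 hli) (P.dθ p v' (P.J p v')) (- P.dθ p u' (P.J p v'))
        (by rw [neg_smul, ← sub_eq_add_neg, h0])
      exact hvv.ne' this.1
    have hpos : 0 < P.dθ p (P.dθ p v' (P.J p v') • u' - P.dθ p u' (P.J p v') • v')
        (P.J p (P.dθ p v' (P.J p v') • u' - P.dθ p u' (P.J p v') • v')) :=
      P.levi_pos p _ (by simp [hu, hv]) hne
    simp only [map_sub, map_smul, sub_apply, smul_apply, smul_eq_mul] at hpos
    rw [P.levi_swap v' u'] at hpos
    have hden : 0 < P.dθ p u' (P.J p u') * P.dθ p v' (P.J p v') - P.dθ p u' (P.J p v') ^ 2 := by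
      by_contra! hle
      nlinarith
    by_contra! hgt
    exact absurd h1 (not_le.2 (div_pos hgt hden))
  · have hdep : u = 0 ∨ ∃ a : ℝ, v = a • u := by
      by_cases hu0 : u = 0
      · exact Or.inl hu0
      · right
        have hne : frame p u p ≠ 0 := fun h0 ↦ hu0 (by rw [← coord_frame hp u, h0, map_zero])
        rw [LinearIndependent.pair_iff' hne] at hli
        push Not at hli
        obtain ⟨a, ha⟩ := hli
        refine ⟨a, ?_⟩
        rw [← coord_frame hp v, ← ha, map_smul, coord_frame hp]
    rcases hdep with rfl | ⟨a, rfl⟩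
    · simp
    · rw [LocalConnection.curv_smul_self, map_zero, zero_apply]

end coordinates

end IsTanakaWebster

end PseudoHermitianStructure

end

noncomputable section

open Connection

/-! ## Geodesics in coordinates -/

namespace CoordinateFrame

variable {E : Type*} [NormedAddCommGroup E] [NormedSpace ℝ E] [FiniteDimensional ℝ E]
  {M : Type*} [TopologicalSpace M] [ChartedSpace E M] [IsManifold 𝓘(ℝ, E) ∞ M]
  (cov : CovariantDerivative 𝓘(ℝ, E) E (TangentSpace 𝓘(ℝ, E) : M → Type _))
  {p q x : M} {γ : ℝ → M} {s : Set ℝ} {t : ℝ}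

theorem _root_.DifferentiableAt.clm_of_apply {F : Type*} [NormedAddCommGroup F] [NormedSpace ℝ F]
    {A : E → E →L[ℝ] F} {z : E} (h : ∀ e, DifferentiableAt ℝ (fun z ↦ A z e) z) :
    DifferentiableAt ℝ A z := by
  set b := Module.finBasis ℝ E
  have hA : A = fun z ↦ ∑ i, (LinearMap.toContinuousLinearMap (b.coord i)).smulRight
      (A z (b i)) := by
    ext z e
    refine (congrArg (A z) (b.sum_repr e)).symm.trans ?_
    rw [map_sum]
    simp
  rw [hA]
  exact DifferentiableAt.fun_sum fun i _ ↦
    ((ContinuousLinearMap.smulRightL ℝ E F _).differentiableAt).comp z (h (b i))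

theorem hasDerivWithinAt_chart (hγ : MDifferentiableWithinAt 𝓘(ℝ, ℝ) 𝓘(ℝ, E) γ s t)
    (hp : γ t ∈ (chartAt E p).source) :
    HasDerivWithinAt (fun t ↦ extChartAt 𝓘(ℝ, E) p (γ t))
      (coord p (γ t) (velocity 𝓘(ℝ, E) γ s t)) s t := by
  have h1 : HasMFDerivAt 𝓘(ℝ, E) 𝓘(ℝ, E) (extChartAt 𝓘(ℝ, E) p) (γ t) (coord p (γ t)) := by
    rw [coord_eq_mfderiv hp]
    exact ((contMDiffAt_chart hp).mdifferentiableAt (by simp)).hasMFDerivAt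
  have h2 : HasFDerivWithinAt (fun t ↦ extChartAt 𝓘(ℝ, E) p (γ t))
      ((coord p (γ t)).comp (mfderivWithin 𝓘(ℝ, ℝ) 𝓘(ℝ, E) γ s t) : ℝ →L[ℝ] E) s t :=
    (h1.comp_hasMFDerivWithinAt t hγ.hasMFDerivWithinAt).hasFDerivWithinAt
  exact h2.hasDerivWithinAt

theorem coord_velocity (hs : UniqueDiffWithinAt ℝ s t)
    (hγ : MDifferentiableWithinAt 𝓘(ℝ, ℝ) 𝓘(ℝ, E) γ s t) (hp : γ t ∈ (chartAt E p).source) :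
    coord p (γ t) (velocity 𝓘(ℝ, E) γ s t) =
      derivWithin (fun t ↦ extChartAt 𝓘(ℝ, E) p (γ t)) s t :=
  ((hasDerivWithinAt_chart hγ hp).derivWithin hs).symm

/-- The change of components from the chart at `q` to the chart at `p`. -/
def transition (p q : M) (z : E) : E →L[ℝ] E :=
  (coord p ((extChartAt 𝓘(ℝ, E) p).symm z)).comp (frameL q ((extChartAt 𝓘(ℝ, E) p).symm z))

theorem transition_chart (hp : x ∈ (chartAt E p).source) (e : E) :
    transition p q (extChartAt 𝓘(ℝ, E) p x) e = coord p x (frame q e x) := by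
  rw [transition, extChartAt_left_inv hp]
  rfl

theorem differentiableAt_transition (hp : x ∈ (chartAt E p).source)
    (hq : x ∈ (chartAt E q).source) :
    DifferentiableAt ℝ (transition p q) (extChartAt 𝓘(ℝ, E) p x) := by
  have h : ∀ e, DifferentiableAt ℝ (fun z ↦ transition p q z e) (extChartAt 𝓘(ℝ, E) p x) :=
    fun e ↦ differentiableAt_localRep hp (mdifferentiableAt_frame hq e)
  exact .clm_of_apply h

/-- The transformation law of Christoffel symbols, obtained by writing the covariant derivative of a
frame field of the chart at q in the chart at p. -/
theorem fderiv_transition (hp : x ∈ (chartAt E p).source) (hq : x ∈ (chartAt E q).source)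
    (u e : E) :
    fderiv ℝ (transition p q) (extChartAt 𝓘(ℝ, E) p x) u e =
      coord p x (cov (frame q e) x (frame p u x)) -
        christoffel cov p (extChartAt 𝓘(ℝ, E) p x) u (coord p x (frame q e x)) := by
  have h1 := coord_cov cov hp (mdifferentiableAt_frame hq e) (frame p u x)
  rw [coord_frame hp] at h1
  rw [h1, add_sub_cancel_right]
  have h2 := (differentiableAt_transition hp hq).hasFDerivAt.clm_apply (hasFDerivAt_const e _)
  refine Eq.trans ?_ (congrArg (fun L ↦ L u) h2.fderiv).symm
  simp

theorem eventually_mem_source (hγ : ContinuousWithinAt γ s t) (hp : γ t ∈ (chartAt E p).source) :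
    ∀ᶠ t' in 𝓝[s] t, γ t' ∈ (chartAt E p).source :=
  hγ ((chartAt E p).open_source.mem_nhds hp)

set_option maxHeartbeats 1000000 in
/-- The geodesic equation does not depend on the chart. -/
theorem hasDerivWithinAt_derivWithin_chart (hs : UniqueDiffOn ℝ s) (ht : t ∈ s)
    (hγ : ∀ᶠ t' in 𝓝[s] t, MDifferentiableWithinAt 𝓘(ℝ, ℝ) 𝓘(ℝ, E) γ s t')
    (hp : γ t ∈ (chartAt E p).source) (hq : γ t ∈ (chartAt E q).source) {y : E}
    (hy : derivWithin (fun t ↦ extChartAt 𝓘(ℝ, E) q (γ t)) s t = y)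
    (hq' : HasDerivWithinAt (derivWithin (fun t ↦ extChartAt 𝓘(ℝ, E) q (γ t)) s)
      (- christoffel cov q (extChartAt 𝓘(ℝ, E) q (γ t)) y y) s t) {w : E}
    (hw : derivWithin (fun t ↦ extChartAt 𝓘(ℝ, E) p (γ t)) s t = w) :
    HasDerivWithinAt (derivWithin (fun t ↦ extChartAt 𝓘(ℝ, E) p (γ t)) s)
      (- christoffel cov p (extChartAt 𝓘(ℝ, E) p (γ t)) w w) s t := by
  have hγt := hγ.self_of_nhdsWithin ht
  have hv := coord_velocity (hs t ht) hγt hp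
  have hv' := coord_velocity (hs t ht) hγt hq
  rw [hw] at hv
  rw [hy] at hv'
  have h1 := hasDerivWithinAt_chart hγt hp
  -- The velocity in chart p is the transition matrix applied to the velocity in chart q. On
  -- differentiating this product, the Christoffel term of q cancels against the derivative of the
  -- matrix.
  have h2 := ((differentiableAt_transition hp hq).hasFDerivAt.comp_hasDerivWithinAt t h1).clm_apply
    hq'
  have hv1 : frame p w (γ t) = velocity 𝓘(ℝ, E) γ s t := by rw [← hv]; exact frameL_coord hp _
  have hv2 : frame q y (γ t) = velocity 𝓘(ℝ, E) γ s t := by rw [← hv']; exact frameL_coord hq _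
  have hchr : frame q (christoffel cov q (extChartAt 𝓘(ℝ, E) q (γ t)) y y) (γ t) =
      cov (frame q y) (γ t) (velocity 𝓘(ℝ, E) γ s t) := by
    rw [christoffel_apply cov hq, hv2]; exact frameL_coord hq _
  rw [hv, hy, fderiv_transition cov hp hq, hv1, hv2, hv, map_neg, Function.comp_apply,
    transition_chart hp, hchr, ← sub_eq_add_neg, sub_sub_cancel_left] at h2
  refine h2.congr_of_eventuallyEq ?_ ?_
  · filter_upwards [hγ, eventually_mem_source hγt.continuousWithinAt hp,
      eventually_mem_source hγt.continuousWithinAt hq, self_mem_nhdsWithin] with t' h1 h2 h3 h4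
    rw [← coord_velocity (hs t' h4) h1 h2, ← coord_velocity (hs t' h4) h1 h3, Function.comp_apply,
      transition_chart h2]
    exact congrArg _ (frameL_coord h3 _).symm
  · rw [hw, hy, Function.comp_apply, transition_chart hp, hv2, hv]

/-- The definition of a geodesic uses a different chart at each parameter, centred at the current
point; there it is the classical second-order equation, which chart independence then transports to
a fixed chart. -/
theorem hasCovDerivAlongAt_velocity_iff (hs : UniqueDiffOn ℝ s) (ht : t ∈ s)
    (hγ : ∀ᶠ t' in 𝓝[s] t, MDifferentiableWithinAt 𝓘(ℝ, ℝ) 𝓘(ℝ, E) γ s t') {y : E}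
    (hy : derivWithin (fun t' ↦ extChartAt 𝓘(ℝ, E) (γ t) (γ t')) s t = y) :
    HasCovDerivAlongAt cov γ (velocity 𝓘(ℝ, E) γ s) s t 0 ↔
      HasDerivWithinAt (derivWithin (fun t' ↦ extChartAt 𝓘(ℝ, E) (γ t) (γ t')) s)
        (- christoffel cov (γ t) (extChartAt 𝓘(ℝ, E) (γ t) (γ t)) y y) s t := by
  have hγt := hγ.self_of_nhdsWithin ht
  have hp := mem_chart_source E (γ t)
  have hv := coord_velocity (hs t ht) hγt hp
  rw [hy] at hv
  have hv1 : frame (γ t) y (γ t) = velocity 𝓘(ℝ, E) γ s t := by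
    rw [← hv]; exact frameL_coord hp _
  have h1 : coord (γ t) (γ t) (cov (extend E (velocity 𝓘(ℝ, E) γ s t)) (γ t)
      (velocity 𝓘(ℝ, E) γ s t)) =
      christoffel cov (γ t) (extChartAt 𝓘(ℝ, E) (γ t) (γ t)) y y := by
    rw [christoffel_apply cov hp, hv1, cov_congr cov (mdifferentiableAt_frame hp y)]
    filter_upwards [(chartAt E (γ t)).open_source.mem_nhds hp] with z hz
    rw [← hv1]
    exact (extend_frame y hz).symm
  have h2 : (fun t' ↦ (trivializationAt E (TangentSpace 𝓘(ℝ, E) : M → Type _) (γ t)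
      (⟨γ t', velocity 𝓘(ℝ, E) γ s t'⟩ : TangentBundle 𝓘(ℝ, E) M)).2) =ᶠ[𝓝[s] t]
      derivWithin (fun t' ↦ extChartAt 𝓘(ℝ, E) (γ t) (γ t')) s := by
    filter_upwards [hγ, eventually_mem_source hγt.continuousWithinAt hp,
      self_mem_nhdsWithin] with t' h1 h2 h3
    rw [← coord_eq_snd h2, coord_velocity (hs t' h3) h1 h2]
  rw [HasCovDerivAlongAt, h2.hasDerivWithinAt_iff (h2.self_of_nhdsWithin ht), ← coord_eq_snd hp,
    map_sub, h1, map_zero, zero_sub]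

/-- The geodesic vector field on the phase space of the chart at `p`. -/
def geodesicField (p : M) (z : E × E) : E × E := (z.2, - christoffel cov p z.1 z.2 z.2)

/-- The position and velocity of a curve in the chart at `p`. -/
def phase (p : M) (γ : ℝ → M) (s : Set ℝ) (t : ℝ) : E × E :=
  (extChartAt 𝓘(ℝ, E) p (γ t), derivWithin (fun t ↦ extChartAt 𝓘(ℝ, E) p (γ t)) s t)

/-- Near `t`, the curve `γ` is the projection of the integral curve `z` of the geodesic vector field
of the chart at `p`. -/
structure IsProjectionAt (p : M) (z : ℝ → E × E) (γ : ℝ → M) (s : Set ℝ) (t : ℝ) : Prop where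
  mem_source : γ t ∈ (chartAt E p).source
  continuousWithinAt : ContinuousWithinAt γ s t
  eventually : ∀ᶠ t' in 𝓝[s] t, extChartAt 𝓘(ℝ, E) p (γ t') = (z t').1 ∧
    HasDerivWithinAt z (geodesicField cov p (z t')) s t'

variable {cov}

theorem IsProjectionAt.mono {z : ℝ → E × E} (h : IsProjectionAt cov p z γ s t) {s' : Set ℝ}
    (hs : s' ⊆ s) : IsProjectionAt cov p z γ s' t :=
  ⟨h.mem_source, h.continuousWithinAt.mono hs,
    (h.eventually.filter_mono (nhdsWithin_mono _ hs)).mono fun t' h ↦ ⟨h.1, h.2.mono hs⟩⟩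

theorem IsProjectionAt.hasDerivWithinAt_fst {z : ℝ → E × E} (h : IsProjectionAt cov p z γ s t) :
    ∀ᶠ t' in 𝓝[s] t, HasDerivWithinAt (fun t ↦ extChartAt 𝓘(ℝ, E) p (γ t)) (z t').2 s t' := by
  filter_upwards [eventually_eventually_nhdsWithin.2 h.eventually,
    self_mem_nhdsWithin] with t' h1 h2
  have h3 := (h1.self_of_nhdsWithin h2).2.hasFDerivWithinAt.fst.hasDerivWithinAt
  refine HasDerivWithinAt.congr_of_eventuallyEq (f := fun t ↦ (z t).1) ?_
    (h1.mono fun _ h ↦ h.1) (h1.self_of_nhdsWithin h2).1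
  simpa [geodesicField] using h3

theorem IsProjectionAt.phase_eq {z : ℝ → E × E} (h : IsProjectionAt cov p z γ s t)
    (hs : UniqueDiffOn ℝ s) : ∀ᶠ t' in 𝓝[s] t, phase p γ s t' = z t' := by
  filter_upwards [h.eventually, h.hasDerivWithinAt_fst, self_mem_nhdsWithin] with t' h1 h2 h3
  exact Prod.ext h1.1 (h2.derivWithin (hs t' h3))

theorem IsProjectionAt.contMDiffWithinAt {z : ℝ → E × E} (h : IsProjectionAt cov p z γ s t)
    (ht : t ∈ s) : ContMDiffWithinAt 𝓘(ℝ, ℝ) 𝓘(ℝ, E) 1 γ s t := by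
  have h1 : ContDiffWithinAt ℝ 1 (fun t ↦ extChartAt 𝓘(ℝ, E) p (γ t)) s t := by
    obtain ⟨u, hu, hu'⟩ := mem_nhdsWithin_iff_exists_mem_nhds_inter.1
      (h.eventually.and h.hasDerivWithinAt_fst)
    rw [show (1 : WithTop ℕ∞) = 0 + 1 from rfl, contDiffWithinAt_succ_iff_hasFDerivWithinAt (by simp)]
    refine ⟨u ∩ s, ?_, fun h ↦ absurd h (by simp), fun t' ↦
      ContinuousLinearMap.toSpanSingleton ℝ (z t').2, fun t' ht' ↦ ?_, ?_⟩
    · rw [insert_eq_of_mem ht, inter_comm]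
      exact Filter.inter_mem self_mem_nhdsWithin (mem_nhdsWithin_of_mem_nhds hu)
    · exact (hu' ht').2.hasFDerivWithinAt.mono inter_subset_right
    · refine (contDiffWithinAt_zero (show t ∈ u ∩ s from ⟨mem_of_mem_nhds hu, ht⟩)).2
        ⟨univ, Filter.univ_mem, fun t' ht' ↦ ?_⟩
      rw [inter_univ] at ht' ⊢
      have := ((hu' ht').1.2.continuousWithinAt.mono inter_subset_right :
        ContinuousWithinAt z (u ∩ s) t').snd
      exact (ContinuousLinearMap.toSpanSingletonCLE (𝕜 := ℝ)
        (E := E)).continuous.continuousAt.comp_continuousWithinAt this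
  have h2 := (contMDiffAt_chart_symm (extChartAt_mem_target h.mem_source)).of_le
    (show (1 : WithTop ℕ∞) ≤ ∞ by simp)
  refine (h2.comp_contMDiffWithinAt t h1.contMDiffWithinAt).congr_of_eventuallyEq ?_ ?_
  · filter_upwards [eventually_mem_source h.continuousWithinAt h.mem_source] with t' ht'
    exact (extChartAt_left_inv ht').symm
  · exact (extChartAt_left_inv h.mem_source).symm

/-- Together with `IsGeodesicOn.isProjectionAt` this trades the intrinsic definition for a
first-order equation in phase space, in whichever chart is convenient near each parameter. -/
theorem isGeodesicOn_of_isProjectionAt (hs : UniqueDiffOn ℝ s)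
    (h : ∀ t ∈ s, ∃ p z, IsProjectionAt cov p z γ s t) : IsGeodesicOn cov γ s := by
  have h1 : ContMDiffOn 𝓘(ℝ, ℝ) 𝓘(ℝ, E) 1 γ s := fun t ht ↦ by
    obtain ⟨p, z, h⟩ := h t ht
    exact h.contMDiffWithinAt ht
  refine ⟨h1, fun t ht ↦ ?_⟩
  have h2 : ∀ᶠ t' in 𝓝[s] t, MDifferentiableWithinAt 𝓘(ℝ, ℝ) 𝓘(ℝ, E) γ s t' := by
    filter_upwards [self_mem_nhdsWithin] with t' ht'
    exact (h1 t' ht').mdifferentiableWithinAt one_ne_zero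
  rw [hasCovDerivAlongAt_velocity_iff cov hs ht h2 rfl]
  obtain ⟨p, z, h⟩ := h t ht
  have h3 := h.phase_eq hs
  refine hasDerivWithinAt_derivWithin_chart cov hs ht h2 (mem_chart_source E _) h.mem_source rfl ?_
    rfl
  have h4 := (h.eventually.self_of_nhdsWithin ht).2.hasFDerivWithinAt.snd.hasDerivWithinAt
  have h5 : derivWithin (fun t ↦ extChartAt 𝓘(ℝ, E) p (γ t)) s =ᶠ[𝓝[s] t] fun t ↦ (z t).2 :=
    h3.mono fun t' h ↦ congrArg Prod.snd h
  rw [h5.hasDerivWithinAt_iff (h5.self_of_nhdsWithin ht), h5.self_of_nhdsWithin ht,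
    (h.eventually.self_of_nhdsWithin ht).1]
  simpa [geodesicField] using h4

theorem _root_.Connection.IsGeodesicOn.isProjectionAt (h : IsGeodesicOn cov γ s)
    (hs : UniqueDiffOn ℝ s) (ht : t ∈ s) (hp : γ t ∈ (chartAt E p).source) :
    IsProjectionAt cov p (phase p γ s) γ s t := by
  have h1 := (h.1 t ht).continuousWithinAt
  refine ⟨hp, h1, ?_⟩
  filter_upwards [eventually_mem_source h1 hp, self_mem_nhdsWithin] with t' ht' ht's
  have h2 : ∀ᶠ t in 𝓝[s] t', MDifferentiableWithinAt 𝓘(ℝ, ℝ) 𝓘(ℝ, E) γ s t := by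
    filter_upwards [self_mem_nhdsWithin] with t ht
    exact (h.1 t ht).mdifferentiableWithinAt one_ne_zero
  have h3 := h2.self_of_nhdsWithin ht's
  have h4 := hasDerivWithinAt_chart h3 ht'
  rw [coord_velocity (hs t' ht's) h3 ht'] at h4
  have h5 := hasDerivWithinAt_derivWithin_chart cov hs ht's h2 ht' (mem_chart_source E _) rfl
    ((hasCovDerivAlongAt_velocity_iff cov hs ht's h2 rfl).1 (h.2 t' ht's)) rfl
  exact ⟨rfl, h4.prodMk h5⟩

theorem _root_.Connection.IsGeodesicOn.mono (h : IsGeodesicOn cov γ s) (hs : UniqueDiffOn ℝ s)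
    {s' : Set ℝ} (hs' : UniqueDiffOn ℝ s') (hss : s' ⊆ s) : IsGeodesicOn cov γ s' :=
  isGeodesicOn_of_isProjectionAt hs' fun t ht ↦
    ⟨γ t, _, (h.isProjectionAt hs (hss ht) (mem_chart_source E _)).mono hss⟩

end CoordinateFrame

end

noncomputable section

open Connection

/-! ## Uniqueness and reparametrization of geodesics -/

namespace CoordinateFrame

variable {E : Type*} [NormedAddCommGroup E] [NormedSpace ℝ E] [FiniteDimensional ℝ E]
  {M : Type*} [TopologicalSpace M] [ChartedSpace E M] [IsManifold 𝓘(ℝ, E) ∞ M]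
  {cov : CovariantDerivative 𝓘(ℝ, E) E (TangentSpace 𝓘(ℝ, E) : M → Type _)}
  {p q x : M} {γ γ₁ γ₂ : ℝ → M} {s : Set ℝ} {t : ℝ}

theorem contDiffAt_geodesicField [T2Space M]
    (hcov : CovariantDerivative.ContMDiffCovariantDerivative cov ∞) {z : E × E}
    (hz : z.1 ∈ (chartAt E p).target) : ContDiffAt ℝ ∞ (geodesicField cov p) z := by
  have h1 := ((contDiffOn_christoffel cov hcov p).contDiffAt
    ((chartAt E p).open_target.mem_nhds hz)).comp z contDiffAt_fst
  exact contDiffAt_snd.prodMk ((h1.clm_apply contDiffAt_snd).clm_apply contDiffAt_snd).neg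

theorem phase_eq_of_eventuallyEq (h : γ₁ =ᶠ[𝓝[s] t] γ₂) (ht : t ∈ s) :
    phase (E := E) p γ₁ s t = phase (E := E) p γ₂ s t := by
  have h1 := h.self_of_nhdsWithin ht
  refine Prod.ext (by simp [phase, h1]) ?_
  refine Filter.EventuallyEq.derivWithin_eq ?_ (by rw [h1])
  filter_upwards [h] with t' ht'
  rw [ht']

theorem IsProjectionAt.continuousWithinAt_phase {z : ℝ → E × E} (h : IsProjectionAt cov p z γ s t)
    (hs : UniqueDiffOn ℝ s) (ht : t ∈ s) : ContinuousWithinAt (phase (E := E) p γ s) s t :=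
  (h.eventually.self_of_nhdsWithin ht).2.continuousWithinAt.congr_of_eventuallyEq (h.phase_eq hs)
    ((h.phase_eq hs).self_of_nhdsWithin ht)

theorem IsProjectionAt.congr {z : ℝ → E × E} (h : IsProjectionAt cov p z γ₁ s t)
    (hγ : γ₂ =ᶠ[𝓝[s] t] γ₁) (ht : t ∈ s) : IsProjectionAt cov p z γ₂ s t := by
  have h1 := hγ.self_of_nhdsWithin ht
  refine ⟨h1 ▸ h.mem_source, h.continuousWithinAt.congr_of_eventuallyEq hγ h1, ?_⟩
  filter_upwards [h.eventually, hγ] with t' h2 h3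
  rwa [h3]

theorem IsProjectionAt.congr_set {z : ℝ → E × E} (h : IsProjectionAt cov p z γ s t)
    {s' : Set ℝ} (hs : s ∈ 𝓝 t) (hs' : s' ∈ 𝓝 t) : IsProjectionAt cov p z γ s' t := by
  refine ⟨h.mem_source, h.continuousWithinAt.continuousAt hs |>.continuousWithinAt, ?_⟩
  have h1 := h.eventually
  rw [nhdsWithin_eq_nhds.2 hs] at h1
  rw [nhdsWithin_eq_nhds.2 hs']
  filter_upwards [h1, eventually_mem_nhds_iff.2 hs] with t' h2 h3
  exact ⟨h2.1, (h2.2.hasDerivAt h3).hasDerivWithinAt⟩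

section uniqueness

variable [T2Space M] (hcov : CovariantDerivative.ContMDiffCovariantDerivative cov ∞)
include hcov

theorem eventuallyEq_of_phase_eq (hs : UniqueDiffOn ℝ s) (hs' : s.OrdConnected)
    (h₁ : IsGeodesicOn cov γ₁ s) (h₂ : IsGeodesicOn cov γ₂ s) (ht : t ∈ s)
    (hp : γ₁ t ∈ (chartAt E p).source) (h : γ₁ t = γ₂ t) (hph : phase (E := E) p γ₁ s t = phase (E := E) p γ₂ s t) :
    γ₁ =ᶠ[𝓝[s] t] γ₂ := by
  have h1 := h₁.isProjectionAt hs ht hp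
  have h2 := h₂.isProjectionAt hs ht (h ▸ hp)
  have hF : ContDiffAt ℝ 1 (geodesicField cov p) (phase (E := E) p γ₁ s t) :=
    (contDiffAt_geodesicField hcov (extChartAt_mem_target hp)).of_le (by simp)
  have key := ODEFlow.eventuallyEq_of_eq hs' ht hF (h1.eventually.mono fun _ h ↦ h.2)
    (h2.eventually.mono fun _ h ↦ h.2) hph
  filter_upwards [key, eventually_mem_source h1.continuousWithinAt h1.mem_source,
    eventually_mem_source h2.continuousWithinAt h2.mem_source] with t' h3 h4 h5
  rw [← extChartAt_left_inv h4, ← extChartAt_left_inv h5]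
  exact congrArg (fun z : E × E ↦ (extChartAt 𝓘(ℝ, E) p).symm z.1) h3

/-- Two geodesics with the same position and velocity at one parameter agree. -/
theorem eqOn_of_phase_eq (hs : UniqueDiffOn ℝ s) (hs' : s.OrdConnected)
    (h₁ : IsGeodesicOn cov γ₁ s) (h₂ : IsGeodesicOn cov γ₂ s) (ht : t ∈ s)
    (hp : γ₁ t ∈ (chartAt E p).source) (h : γ₁ t = γ₂ t) (hph : phase (E := E) p γ₁ s t = phase (E := E) p γ₂ s t) :
    EqOn γ₁ γ₂ s := by
  have : PreconnectedSpace s := Subtype.preconnectedSpace hs'.isPreconnected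
  -- A clopen argument in s: agreement near a parameter is an open condition, and at a limit
  -- parameter positions and velocities agree by continuity, so local uniqueness applies again.
  let u : Set ℝ := {t | ∀ᶠ t' in 𝓝 t, t' ∈ s → γ₁ t' = γ₂ t'}
  have hu : ∀ t, t ∈ u ↔ γ₁ =ᶠ[𝓝[s] t] γ₂ := fun t ↦ eventually_nhdsWithin_iff.symm
  have hopen : IsOpen ((↑) ⁻¹' u : Set s) :=
    (isOpen_setOfPred_eventually_nhds).preimage continuous_subtype_val
  have hclosed : IsClosed ((↑) ⁻¹' u : Set s) := by
    refine isClosed_of_closure_subset fun ⟨t', ht'⟩ hcl ↦ ?_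
    rw [closure_subtype, Subtype.image_preimage_coe, mem_closure_iff_nhdsWithin_neBot] at hcl
    have hmono : 𝓝[s ∩ u] t' ≤ 𝓝[s] t' := nhdsWithin_mono _ inter_subset_left
    have hev : ∀ᶠ y in 𝓝[s ∩ u] t', y ∈ s ∩ u := self_mem_nhdsWithin
    have heq : γ₁ t' = γ₂ t' := by
      have c1 := (h₁.1 t' ht').continuousWithinAt.mono_left hmono
      have c2 := (h₂.1 t' ht').continuousWithinAt.mono_left hmono
      refine tendsto_nhds_unique (c1.congr' ?_) c2
      filter_upwards [hev] with y hy
      exact ((hu y).1 hy.2).self_of_nhdsWithin hy.1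
    have hp' := mem_chart_source E (γ₁ t')
    have hphase : phase (E := E) (γ₁ t') γ₁ s t' = phase (E := E) (γ₁ t') γ₂ s t' := by
      have c1 := ((h₁.isProjectionAt hs ht' hp').continuousWithinAt_phase hs ht').mono_left hmono
      have hp2 : γ₂ t' ∈ (chartAt E (γ₁ t')).source := by rw [← heq]; exact hp'
      have c2 := ((h₂.isProjectionAt hs ht' hp2).continuousWithinAt_phase hs
        ht').mono_left hmono
      refine tendsto_nhds_unique (c1.congr' ?_) c2
      filter_upwards [hev] with y hy
      exact phase_eq_of_eventuallyEq ((hu y).1 hy.2) hy.1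
    exact (hu t').2 (eventuallyEq_of_phase_eq hcov hs hs' h₁ h₂ ht' hp' heq hphase)
  have huniv := IsClopen.eq_univ ⟨hclosed, hopen⟩
    ⟨⟨t, ht⟩, (hu t).2 (eventuallyEq_of_phase_eq hcov hs hs' h₁ h₂ ht hp h hph)⟩
  intro t' ht'
  have : (⟨t', ht'⟩ : s) ∈ ((↑) ⁻¹' u : Set s) := huniv ▸ mem_univ _
  exact ((hu t').1 this).self_of_nhdsWithin ht'

end uniqueness

theorem phase_mono (h : IsGeodesicOn cov γ s) (hs : UniqueDiffOn ℝ s) {s' : Set ℝ}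
    (hs' : UniqueDiffOn ℝ s') (hss : s' ⊆ s) (ht : t ∈ s') (hp : γ t ∈ (chartAt E p).source) :
    phase (E := E) p γ s' t = phase (E := E) p γ s t :=
  (((h.isProjectionAt hs (hss ht) hp).mono hss).phase_eq hs').self_of_nhdsWithin ht

/-- A geodesic stays a geodesic under affine changes of the parameter. -/
theorem IsProjectionAt.comp_affine {z : ℝ → E × E} {a c u : ℝ}
    (h : IsProjectionAt cov p z γ s (a + c * u)) {s' : Set ℝ}
    (hs' : MapsTo (fun u ↦ a + c * u) s' s) :
    IsProjectionAt cov p (fun u ↦ ((z (a + c * u)).1, c • (z (a + c * u)).2))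
      (fun u ↦ γ (a + c * u)) s' u := by
  have hd : ∀ u, HasDerivAt (fun u ↦ a + c * u) c u := fun u ↦ by
    simpa using ((hasDerivAt_id u).const_mul c).const_add a
  have hc : Filter.Tendsto (fun u ↦ a + c * u) (𝓝[s'] u) (𝓝[s] (a + c * u)) :=
    (hd u).continuousAt.continuousWithinAt.tendsto_nhdsWithin hs'
  refine ⟨h.mem_source, h.continuousWithinAt.tendsto.comp hc, ?_⟩
  filter_upwards [hc.eventually h.eventually] with u' hu'
  refine ⟨hu'.1, ?_⟩
  have h1 := hu'.2.scomp u' (hd u').hasDerivWithinAt hs'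
  have h2 := h1.hasFDerivWithinAt.fst.hasDerivWithinAt
  have h3 := h1.hasFDerivWithinAt.snd.hasDerivWithinAt.const_smul c
  have h4 := h2.prodMk h3
  refine h4.congr_deriv ?_
  simp [geodesicField, smul_smul]

theorem _root_.Connection.IsGeodesicOn.comp_affine (h : IsGeodesicOn cov γ s)
    (hs : UniqueDiffOn ℝ s) {a c : ℝ} {s' : Set ℝ} (hs' : MapsTo (fun u ↦ a + c * u) s' s)
    (hsu : UniqueDiffOn ℝ s') : IsGeodesicOn cov (fun u ↦ γ (a + c * u)) s' :=
  isGeodesicOn_of_isProjectionAt hsu fun u hu ↦ ⟨_, _,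
    (h.isProjectionAt hs (hs' hu) (mem_chart_source E _)).comp_affine hs'⟩

theorem phase_comp_affine (h : IsGeodesicOn cov γ s)
    (hs : UniqueDiffOn ℝ s) {a c u : ℝ} {s' : Set ℝ} (hs' : MapsTo (fun u ↦ a + c * u) s' s)
    (hsu : UniqueDiffOn ℝ s') (hu : u ∈ s') (hp : γ (a + c * u) ∈ (chartAt E p).source) :
    phase (E := E) p (fun u ↦ γ (a + c * u)) s' u =
      ((phase (E := E) p γ s (a + c * u)).1, c • (phase (E := E) p γ s (a + c * u)).2) :=
  (((h.isProjectionAt hs (hs' hu) hp).comp_affine hs').phase_eq hsu).self_of_nhdsWithin hu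

end CoordinateFrame

end

noncomputable section

open Connection

/-! ## Families of geodesics -/

namespace CoordinateFrame

variable {E : Type*} [NormedAddCommGroup E] [NormedSpace ℝ E] [FiniteDimensional ℝ E]
  {M : Type*} [TopologicalSpace M] [ChartedSpace E M] [IsManifold 𝓘(ℝ, E) ∞ M]
  {cov : CovariantDerivative 𝓘(ℝ, E) E (TangentSpace 𝓘(ℝ, E) : M → Type _)}
  {p q x : M} {γ γ₁ γ₂ : ℝ → M} {s : Set ℝ} {t : ℝ}

theorem phase_of_mem_nhds (hs : s ∈ 𝓝 t) : phase (E := E) p γ s t = phase p γ univ t := by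
  rw [phase, phase, derivWithin_of_mem_nhds hs, derivWithin_univ]

theorem phase_congr (h : γ₁ =ᶠ[𝓝 t] γ₂) : phase (E := E) p γ₁ univ t = phase p γ₂ univ t :=
  phase_eq_of_eventuallyEq (by rwa [nhdsWithin_univ]) (mem_univ t)

theorem _root_.Connection.IsGeodesicOn.isProjectionAt_univ (h : IsGeodesicOn cov γ s)
    (hs : IsOpen s) (ht : t ∈ s) (hp : γ t ∈ (chartAt E p).source) :
    IsProjectionAt cov p (phase p γ s) γ univ t :=
  (h.isProjectionAt hs.uniqueDiffOn ht hp).congr_set (hs.mem_nhds ht) Filter.univ_mem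

theorem isGeodesicOn_of_isOpen (hs : IsOpen s)
    (h : ∀ t ∈ s, ∃ p z, IsProjectionAt cov p z γ univ t) : IsGeodesicOn cov γ s :=
  isGeodesicOn_of_isProjectionAt hs.uniqueDiffOn fun t ht ↦ by
    obtain ⟨p, z, h⟩ := h t ht
    exact ⟨p, z, h.congr_set Filter.univ_mem (hs.mem_nhds ht)⟩

theorem _root_.Connection.IsGeodesicOn.congr_of_eventuallyEq (h : IsGeodesicOn cov γ₁ s)
    (hs : IsOpen s) (ht : t ∈ s) (h12 : γ₂ =ᶠ[𝓝 t] γ₁) : ∃ p z, IsProjectionAt cov p z γ₂ univ t :=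
  ⟨γ₁ t, _, (h.isProjectionAt_univ hs ht (mem_chart_source E _)).congr
    (by rwa [nhdsWithin_univ]) (mem_univ t)⟩

theorem isProjectionAt_symm {z : ℝ → E × E} (hs : IsOpen s) (ht : t ∈ s)
    (h : ∀ t ∈ s, (z t).1 ∈ (chartAt E p).target ∧ HasDerivAt z (geodesicField cov p (z t)) t) :
    IsProjectionAt cov p z (fun t ↦ (extChartAt 𝓘(ℝ, E) p).symm (z t).1) univ t := by
  refine ⟨extChartAt_symm_mem (h t ht).1, ?_, ?_⟩
  · exact (ContinuousAt.comp (f := fun t ↦ (z t).1) (contMDiffAt_chart_symm (h t ht).1).continuousAt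
      (h t ht).2.continuousAt.fst).continuousWithinAt
  · rw [nhdsWithin_univ]
    filter_upwards [hs.mem_nhds ht] with t' ht'
    exact ⟨extChartAt_right_inv (h t' ht').1, (h t' ht').2.hasDerivWithinAt⟩

/-- The position and velocity at the parameter `t` of the curves in the family `σ` depend
differentiably on the member of the family, at `v`. -/
def IsDifferentiableFamilyAt (v : E) (σ : E → ℝ → M) (t : ℝ) (q : M) : Prop :=
  (∀ᶠ w in 𝓝 v, σ w t ∈ (chartAt E q).source) ∧
    DifferentiableAt ℝ (fun w ↦ phase (E := E) q (σ w) univ t) v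

theorem IsDifferentiableFamilyAt.congr {v : E} {σ σ' : E → ℝ → M}
    (h : IsDifferentiableFamilyAt v σ t q) (hσ : ∀ᶠ w in 𝓝 v, σ' w =ᶠ[𝓝 t] σ w) :
    IsDifferentiableFamilyAt v σ' t q := by
  refine ⟨?_, h.2.congr_of_eventuallyEq ?_⟩
  · filter_upwards [h.1, hσ] with w h1 h2
    rwa [h2.self_of_nhds]
  · filter_upwards [hσ] with w h2 using phase_congr h2

/-- Positions change by the smooth coordinate change and velocities by the transition matrix, which
is differentiable in the position. -/
theorem IsDifferentiableFamilyAt.change_chart {v : E} {σ : E → ℝ → M}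
    (h : IsDifferentiableFamilyAt v σ t q)
    (hσ : ∀ᶠ w in 𝓝 v, MDifferentiableWithinAt 𝓘(ℝ, ℝ) 𝓘(ℝ, E) (σ w) univ t)
    (hp : σ v t ∈ (chartAt E p).source) : IsDifferentiableFamilyAt v σ t p := by
  have hq : σ v t ∈ (chartAt E q).source := h.1.self_of_nhds
  have hsymm := (contMDiffAt_chart_symm (extChartAt_mem_target hq)).continuousAt
  have hc : ContinuousAt (fun w ↦ σ w t) v := by
    have h1 : ContinuousAt (fun w ↦ extChartAt 𝓘(ℝ, E) q (σ w t)) v := h.2.continuousAt.fst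
    have h2 := ContinuousAt.comp (f := fun w ↦ extChartAt 𝓘(ℝ, E) q (σ w t)) hsymm h1
    refine h2.congr ?_
    filter_upwards [h.1] with w hw using extChartAt_left_inv hw
  have hmem : ∀ᶠ w in 𝓝 v, σ w t ∈ (chartAt E p).source :=
    hc ((chartAt E p).open_source.mem_nhds hp)
  refine ⟨hmem, ?_⟩
  have hX : DifferentiableAt ℝ (fun w ↦ extChartAt 𝓘(ℝ, E) p (σ w t)) v := by
    have h1 := differentiableAt_comp_symm (p := q) hq
      ((contMDiffAt_chart hp).mdifferentiableAt (by simp))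
    refine (h1.comp v h.2.fst).congr_of_eventuallyEq ?_
    filter_upwards [h.1] with w hw
    exact congrArg _ (extChartAt_left_inv hw).symm
  have hY := ((differentiableAt_transition hp hq).comp v hX).clm_apply h.2.snd
  refine (hX.prodMk hY).congr_of_eventuallyEq ?_
  filter_upwards [h.1, hmem, hσ] with w h1 h2 h3
  refine Prod.ext rfl ?_
  have e1 := coord_velocity uniqueDiffWithinAt_univ h3 h1
  have e2 := coord_velocity uniqueDiffWithinAt_univ h3 h2
  simp only [phase, Function.comp_apply]
  rw [← e1, ← e2, transition_chart h2]
  exact congrArg _ (frameL_coord h1 _).symm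

section local_family

variable [T2Space M] (hcov : CovariantDerivative.ContMDiffCovariantDerivative cov ∞)
include hcov

/-- A flow box whose size δ, r depends on z₀ but not on the initial data Z or the starting time T;
this uniformity is what continuation along a geodesic needs. The data need be differentiable only at
v, as is known for the family being continued. -/
theorem exists_local_family {z₀ : E × E} (hz₀ : z₀.1 ∈ (chartAt E q).target) :
    ∃ δ > 0, ∃ r > 0, ∀ (v : E) (Z : E → E × E), DifferentiableAt ℝ Z v →
      Z v ∈ Metric.ball z₀ r → ∀ T : ℝ, ∃ σ : E → ℝ → M,
        (∀ᶠ w in 𝓝 v, IsGeodesicOn cov (σ w) (Ioo (T - δ) (T + δ)) ∧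
          σ w T = (extChartAt 𝓘(ℝ, E) q).symm (Z w).1 ∧ phase q (σ w) univ T = Z w) ∧
        ∀ t ∈ Ioo (T - δ) (T + δ), IsDifferentiableFamilyAt v σ t q ∧
          HasDerivAt (fun t ↦ fderiv ℝ (fun w ↦ phase (E := E) q (σ w) univ t) v)
            ((fderiv ℝ (geodesicField cov q) (phase q (σ v) univ t)).comp
              (fderiv ℝ (fun w ↦ phase (E := E) q (σ w) univ t) v)) t := by
  have hΩ : IsOpen (Prod.fst ⁻¹' (chartAt E q).target : Set (E × E)) :=
    (chartAt E q).open_target.preimage continuous_fst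
  obtain ⟨δ, hδ, r, hr, α, hα⟩ := ODEFlow.exists_flow (F := geodesicField cov q) hΩ
    (fun z hz ↦ ((contDiffAt_geodesicField hcov hz).of_le (by simp)).contDiffWithinAt) hz₀
  refine ⟨δ, hδ, r, hr, fun v Z hZ hZv T ↦ ?_⟩
  have hball : ∀ᶠ w in 𝓝 v, Z w ∈ Metric.ball z₀ r :=
    hZ.continuousAt (Metric.isOpen_ball.mem_nhds hZv)
  let σ : E → ℝ → M := fun w t ↦ (extChartAt 𝓘(ℝ, E) q).symm (α (Z w) (t - T)).1
  have hshift : ∀ t ∈ Ioo (T - δ) (T + δ), t - T ∈ Ioo (-δ) δ := fun t ht ↦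
    ⟨by linarith [ht.1], by linarith [ht.2]⟩
  have hT : T ∈ Ioo (T - δ) (T + δ) := ⟨by linarith, by linarith⟩
  have hα' : ∀ w, Z w ∈ Metric.ball z₀ r → ∀ t ∈ Ioo (T - δ) (T + δ),
      (α (Z w) (t - T)).1 ∈ (chartAt E q).target ∧ HasDerivAt (fun t ↦ α (Z w) (t - T))
        (geodesicField cov q (α (Z w) (t - T))) t := fun w hw t ht ↦ by
    have h1 := (hα (Z w) hw).2.1 (t - T) (hshift t ht)
    exact ⟨h1.1, h1.2.comp_sub_const t T⟩
  have hproj : ∀ w, Z w ∈ Metric.ball z₀ r → ∀ t ∈ Ioo (T - δ) (T + δ),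
      IsProjectionAt cov q (fun t ↦ α (Z w) (t - T)) (σ w) univ t := fun w hw t ht ↦
    isProjectionAt_symm isOpen_Ioo ht (hα' w hw)
  have hphase : ∀ w, Z w ∈ Metric.ball z₀ r → ∀ t ∈ Ioo (T - δ) (T + δ),
      phase q (σ w) univ t = α (Z w) (t - T) := fun w hw t ht ↦
    ((hproj w hw t ht).phase_eq uniqueDiffOn_univ).self_of_nhdsWithin (mem_univ t)
  obtain ⟨h0, -, L, hL0, hL⟩ := hα (Z v) hZv
  have hderiv : ∀ t ∈ Ioo (T - δ) (T + δ), HasFDerivAt (fun w ↦ phase (E := E) q (σ w) univ t)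
      ((L (t - T)).comp (fderiv ℝ Z v)) v := fun t ht ↦ by
    refine ((hL _ (hshift t ht)).2.comp v hZ.hasFDerivAt).congr_of_eventuallyEq ?_
    filter_upwards [hball] with w hw using hphase w hw t ht
  refine ⟨σ, ?_, fun t ht ↦ ⟨⟨?_, (hderiv t ht).differentiableAt⟩, ?_⟩⟩
  · filter_upwards [hball] with w hw
    refine ⟨isGeodesicOn_of_isOpen isOpen_Ioo fun t ht ↦ ⟨q, _, hproj w hw t ht⟩, ?_, ?_⟩
    · simp only [σ, sub_self, (hα (Z w) hw).1]
    · rw [hphase w hw T hT, sub_self, (hα (Z w) hw).1]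
  · filter_upwards [hball] with w hw using (hproj w hw t ht).mem_source
  · rw [(hderiv t ht).fderiv, hphase v hZv t ht]
    have h1 := ((hL _ (hshift t ht)).1.comp_sub_const t T).clm_comp
      (hasDerivAt_const t (fderiv ℝ Z v))
    have h2 : HasDerivAt (fun t ↦ (L (t - T)).comp (fderiv ℝ Z v))
        ((fderiv ℝ (geodesicField cov q) (α (Z v) (t - T))).comp
          ((L (t - T)).comp (fderiv ℝ Z v))) t := by
      refine h1.congr_deriv ?_
      rw [ContinuousLinearMap.comp_zero, add_zero, ContinuousLinearMap.comp_assoc]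
    refine h2.congr_of_eventuallyEq ?_
    filter_upwards [isOpen_Ioo.mem_nhds ht] with t' ht' using (hderiv t' ht').fderiv

/-- Two geodesics which agree to first order at a common parameter can be glued. -/
theorem exists_glue {a b c d T : ℝ} (h₁ : IsGeodesicOn cov γ₁ (Ioo a b))
    (h₂ : IsGeodesicOn cov γ₂ (Ioo c d)) (hT : T ∈ Ioo a b) (hT' : T ∈ Ioo c d)
    (hq : γ₁ T ∈ (chartAt E q).source) (h : γ₁ T = γ₂ T)
    (hph : phase (E := E) q γ₁ univ T = phase q γ₂ univ T) :
    EqOn (fun t ↦ if t < T then γ₁ t else γ₂ t) γ₁ (Ioo a (min b d)) ∧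
      EqOn (fun t ↦ if t < T then γ₁ t else γ₂ t) γ₂ (Ioo (max a c) d) ∧
      IsGeodesicOn cov (fun t ↦ if t < T then γ₁ t else γ₂ t) (Ioo a d) := by
  have hmem : Ioo (max a c) (min b d) ∈ 𝓝 T :=
    Ioo_mem_nhds (max_lt hT.1 hT'.1) (lt_min hT.2 hT'.2)
  have key : EqOn γ₁ γ₂ (Ioo (max a c) (min b d)) := by
    refine eqOn_of_phase_eq hcov isOpen_Ioo.uniqueDiffOn ordConnected_Ioo
      (h₁.mono isOpen_Ioo.uniqueDiffOn isOpen_Ioo.uniqueDiffOn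
        (Ioo_subset_Ioo (le_max_left _ _) (min_le_left _ _)))
      (h₂.mono isOpen_Ioo.uniqueDiffOn isOpen_Ioo.uniqueDiffOn
        (Ioo_subset_Ioo (le_max_right _ _) (min_le_right _ _))) (mem_of_mem_nhds hmem) hq h ?_
    rwa [phase_of_mem_nhds hmem, phase_of_mem_nhds hmem]
  have e1 : EqOn (fun t ↦ if t < T then γ₁ t else γ₂ t) γ₁ (Ioo a (min b d)) := fun t ht ↦ by
    by_cases h : t < T
    · simp [h]
    · simp only [h, if_false]
      exact (key ⟨(max_lt hT.1 hT'.1).trans_le (not_lt.1 h), ht.2⟩).symm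
  have e2 : EqOn (fun t ↦ if t < T then γ₁ t else γ₂ t) γ₂ (Ioo (max a c) d) := fun t ht ↦ by
    by_cases h : t < T
    · simp only [h, if_true]
      exact key ⟨ht.1, h.trans (lt_min hT.2 hT'.2)⟩
    · simp [h]
  refine ⟨e1, e2, isGeodesicOn_of_isOpen isOpen_Ioo fun t ht ↦ ?_⟩
  rcases le_or_gt t T with h | h
  · have : t ∈ Ioo a (min b d) := ⟨ht.1, h.trans_lt (lt_min hT.2 hT'.2)⟩
    exact h₁.congr_of_eventuallyEq isOpen_Ioo ⟨ht.1, h.trans_lt hT.2⟩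
      (e1.eventuallyEq_of_mem (isOpen_Ioo.mem_nhds this))
  · have : t ∈ Ioo (max a c) d := ⟨(max_lt hT.1 hT'.1).trans h, ht.2⟩
    exact h₂.congr_of_eventuallyEq isOpen_Ioo ⟨hT'.1.trans h, ht.2⟩
      (e2.eventuallyEq_of_mem (isOpen_Ioo.mem_nhds this))

end local_family

end CoordinateFrame

end

/-! ### Continuation of geodesic families along a geodesic and the linearized equation -/

noncomputable section

open Connection

namespace CoordinateFrame

variable {E : Type*} [NormedAddCommGroup E] [NormedSpace ℝ E] [FiniteDimensional ℝ E]
  {M : Type*} [TopologicalSpace M] [ChartedSpace E M] [IsManifold 𝓘(ℝ, E) ∞ M]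
  {cov : CovariantDerivative 𝓘(ℝ, E) E (TangentSpace 𝓘(ℝ, E) : M → Type _)}
  {p q x : M} {γ γ₁ γ₂ : ℝ → M} {s : Set ℝ} {t : ℝ}

/-- The curves `σ w`, for `w` near `v`, are geodesics on `(a, b)` which start at `p` with velocity
`w`, and depend differentiably on `w` at `v`. -/
structure IsGeodesicFamily (cov : CovariantDerivative 𝓘(ℝ, E) E (TangentSpace 𝓘(ℝ, E) : M → Type _))
    (p : M) (v : E) (a b : ℝ) (σ : E → ℝ → M) : Prop where
  geodesic : ∀ᶠ w in 𝓝 v, IsGeodesicOn cov (σ w) (Ioo a b) ∧ σ w 0 = p ∧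
    phase p (σ w) univ 0 = (extChartAt 𝓘(ℝ, E) p p, w)
  differentiable : ∀ t ∈ Ioo a b, ∃ q, IsDifferentiableFamilyAt v σ t q

namespace IsGeodesicFamily

variable {v : E} {a b : ℝ} {σ : E → ℝ → M}

theorem mono (h : IsGeodesicFamily cov p v a b σ) {a' b' : ℝ} (ha : a ≤ a') (hb : b' ≤ b) :
    IsGeodesicFamily cov p v a' b' σ := by
  refine ⟨?_, fun t ht ↦ h.differentiable t (Ioo_subset_Ioo ha hb ht)⟩
  filter_upwards [h.geodesic] with w hw
  exact ⟨hw.1.mono isOpen_Ioo.uniqueDiffOn isOpen_Ioo.uniqueDiffOn (Ioo_subset_Ioo ha hb), hw.2⟩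

theorem isDifferentiableFamilyAt (h : IsGeodesicFamily cov p v a b σ) (ht : t ∈ Ioo a b)
    (hq : σ v t ∈ (chartAt E q).source) : IsDifferentiableFamilyAt v σ t q := by
  obtain ⟨q', hq'⟩ := h.differentiable t ht
  refine hq'.change_chart ?_ hq
  filter_upwards [h.geodesic] with w hw
  exact ((hw.1.isProjectionAt_univ isOpen_Ioo ht (mem_chart_source E _)).contMDiffWithinAt
    (mem_univ t)).mdifferentiableWithinAt one_ne_zero

section

variable [T2Space M] (hcov : CovariantDerivative.ContMDiffCovariantDerivative cov ∞)
include hcov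

theorem exists_zero (p : M) (v : E) : ∃ ε > 0, ∃ σ, IsGeodesicFamily cov p v (-ε) (0 + ε) σ := by
  have hp := mem_chart_source E p
  obtain ⟨δ, hδ, r, hr, h⟩ := exists_local_family (q := p) hcov
    (z₀ := (extChartAt 𝓘(ℝ, E) p p, v)) (extChartAt_mem_target hp)
  obtain ⟨σ, h1, h2⟩ := h v (fun w ↦ (extChartAt 𝓘(ℝ, E) p p, w))
    ((differentiableAt_const _).prodMk differentiableAt_id) (Metric.mem_ball_self hr) 0
  rw [zero_sub] at h1 h2
  refine ⟨δ, hδ, σ, ?_, fun t ht ↦ ⟨p, (h2 t ht).1⟩⟩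
  filter_upwards [h1] with w hw
  exact ⟨hw.1, hw.2.1.trans (extChartAt_left_inv hp), hw.2.2⟩

/-- A family of geodesics can be extended by a flow box around a point of the central geodesic. -/
theorem exists_extend {δ T : ℝ} (h : IsGeodesicFamily cov p v a b σ) (hT : T ∈ Ioo a b)
    (h0 : 0 ∈ Ioc a T) (hδ : 0 < δ)
    {τ : E → ℝ → M} (hq : σ v T ∈ (chartAt E q).source)
    (hτ : ∀ᶠ w in 𝓝 v, IsGeodesicOn cov (τ w) (Ioo (T - δ) (T + δ)) ∧
          τ w T = (extChartAt 𝓘(ℝ, E) q).symm (phase (E := E) q (σ w) univ T).1 ∧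
          phase (E := E) q (τ w) univ T = phase q (σ w) univ T)
    (hτ' : ∀ t ∈ Ioo (T - δ) (T + δ), IsDifferentiableFamilyAt v τ t q) :
    ∃ σ', IsGeodesicFamily cov p v a (T + δ) σ' := by
  have hT' : T ∈ Ioo (T - δ) (T + δ) := ⟨by linarith, by linarith⟩
  have hglue : ∀ᶠ w in 𝓝 v,
      EqOn (fun t ↦ if t < T then σ w t else τ w t) (σ w) (Ioo a (min b (T + δ))) ∧
      EqOn (fun t ↦ if t < T then σ w t else τ w t) (τ w) (Ioo (max a (T - δ)) (T + δ)) ∧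
      IsGeodesicOn cov (fun t ↦ if t < T then σ w t else τ w t) (Ioo a (T + δ)) := by
    filter_upwards [h.geodesic, hτ, (h.isDifferentiableFamilyAt hT hq).1] with w h1 h2 h3
    exact exists_glue hcov h1.1 h2.1 hT hT' h3 (h2.2.1.trans (extChartAt_left_inv h3)).symm
      h2.2.2.symm
  refine ⟨fun w t ↦ if t < T then σ w t else τ w t, ?_, fun t ht ↦ ?_⟩
  · have h0' : Ioo a (min b (T + δ)) ∈ 𝓝 0 := Ioo_mem_nhds h0.1 (lt_min (h0.2.trans_lt hT.2)
      (h0.2.trans_lt hT'.2))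
    filter_upwards [h.geodesic, hglue] with w h1 h2
    refine ⟨h2.2.2, (h2.1 (mem_of_mem_nhds h0')).trans h1.2.1, ?_⟩
    rw [phase_congr (h2.1.eventuallyEq_of_mem h0'), h1.2.2]
  · rcases le_or_gt t T with htT | htT
    · have ht' : Ioo a (min b (T + δ)) ∈ 𝓝 t := Ioo_mem_nhds ht.1 (htT.trans_lt (lt_min hT.2 hT'.2))
      obtain ⟨q', hq'⟩ := h.differentiable t ⟨ht.1, htT.trans_lt hT.2⟩
      exact ⟨q', hq'.congr (hglue.mono fun w hw ↦ hw.1.eventuallyEq_of_mem ht')⟩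
    · have ht' : Ioo (max a (T - δ)) (T + δ) ∈ 𝓝 t :=
        Ioo_mem_nhds ((max_lt hT.1 hT'.1).trans htT) ht.2
      exact ⟨q, (hτ' t ⟨hT'.1.trans htT, ht.2⟩).congr
        (hglue.mono fun w hw ↦ hw.2.1.eventuallyEq_of_mem ht')⟩

/-- The central curve of a family of geodesics is determined by its initial values. -/
theorem eqOn_Icc (h : IsGeodesicFamily cov p v a b σ) (hγ : IsGeodesicOn cov γ (Icc 0 1))
    (hγ0 : γ 0 = p) (hγv : phase p γ (Icc 0 1) 0 = (extChartAt 𝓘(ℝ, E) p p, v)) {c : ℝ}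
    (hc : 0 < c) (hc1 : c ≤ 1) (ha : a < 0) (hb : c < b) :
    EqOn (σ v) γ (Icc 0 c) ∧ ∀ t ∈ Icc 0 c, ∀ q, γ t ∈ (chartAt E q).source →
      phase q (σ v) univ t = phase (E := E) q γ (Icc 0 1) t := by
  have hsub : Icc 0 c ⊆ Icc (0 : ℝ) 1 := Icc_subset_Icc_right hc1
  have hsub' : Icc 0 c ⊆ Ioo a b := fun t ht ↦ ⟨ha.trans_le ht.1, ht.2.trans_lt hb⟩
  have hu := uniqueDiffOn_Icc hc
  have hu1 := uniqueDiffOn_Icc (zero_lt_one' ℝ)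
  have h0 : (0 : ℝ) ∈ Icc 0 c := left_mem_Icc.2 hc.le
  have hσ := h.geodesic.self_of_nhds
  have key : ∀ t ∈ Icc 0 c, ∀ q, σ v t ∈ (chartAt E q).source →
      phase (E := E) q (σ v) (Icc 0 c) t = phase q (σ v) univ t := fun t ht q hq ↦ by
    rw [phase_mono hσ.1 isOpen_Ioo.uniqueDiffOn hu hsub' ht hq,
      phase_of_mem_nhds (isOpen_Ioo.mem_nhds (hsub' ht))]
  have heq : EqOn (σ v) γ (Icc 0 c) := by
    refine eqOn_of_phase_eq hcov hu ordConnected_Icc (hσ.1.mono isOpen_Ioo.uniqueDiffOn hu hsub')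
      (hγ.mono hu1 hu hsub) h0 (p := p) (by rw [hσ.2.1]; exact mem_chart_source E p)
      (hσ.2.1.trans hγ0.symm) ?_
    rw [key 0 h0 p (by rw [hσ.2.1]; exact mem_chart_source E p), hσ.2.2,
      phase_mono hγ hu1 hu hsub h0 (by rw [hγ0]; exact mem_chart_source E p), hγv]
  refine ⟨heq, fun t ht q hq ↦ ?_⟩
  rw [← key t ht q (by rwa [heq ht]), ← phase_mono hγ hu1 hu hsub ht hq]
  refine phase_eq_of_eventuallyEq ?_ ht
  filter_upwards [self_mem_nhdsWithin] with t' ht' using heq ht'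

/-- The geodesics with initial velocities near that of a geodesic `γ` on `[0, 1]` exist on `[0, 1]`
and form a differentiable family. -/
theorem exists_of_isGeodesicOn (hγ : IsGeodesicOn cov γ (Icc 0 1))
    (hγ0 : γ 0 = p) (hγv : phase p γ (Icc 0 1) 0 = (extChartAt 𝓘(ℝ, E) p p, v)) :
    ∃ ε > 0, ∃ σ, IsGeodesicFamily cov p v (-ε) (1 + ε) σ := by
  have hu1 := uniqueDiffOn_Icc (zero_lt_one' ℝ)
  -- Existence of a family slightly beyond T. By `hstep` its truth value is locally constant on [0,
  -- 1], and connectedness carries it from 0 to 1.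
  let S : ℝ → Prop := fun T ↦ ∃ ε > 0, ∃ σ, IsGeodesicFamily cov p v (-ε) (T + ε) σ
  have hstep : ∀ t₀ ∈ Icc (0 : ℝ) 1, ∃ δ > 0, ∀ T₁ ∈ Icc (0 : ℝ) 1, ∀ T₂ : ℝ,
      |T₁ - t₀| < δ → |T₂ - t₀| < δ → S T₁ → S T₂ := by
    intro t₀ ht₀
    have hq := mem_chart_source E (γ t₀)
    have hproj := hγ.isProjectionAt hu1 ht₀ hq
    obtain ⟨δ, hδ, r, hr, hfam⟩ := exists_local_family (q := γ t₀) hcov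
      (z₀ := phase (γ t₀) γ (Icc 0 1) t₀) (extChartAt_mem_target hq)
    have hnear : ∀ᶠ t in 𝓝[Icc 0 1] t₀, phase (γ t₀) γ (Icc 0 1) t ∈
        Metric.ball (phase (γ t₀) γ (Icc 0 1) t₀) r ∧ γ t ∈ (chartAt E (γ t₀)).source :=
      ((hproj.continuousWithinAt_phase hu1 ht₀).eventually (Metric.ball_mem_nhds _ hr)).and
        (eventually_mem_source hproj.continuousWithinAt hq)
    obtain ⟨η, hη, hball⟩ := Metric.mem_nhdsWithin_iff.1 hnear
    -- The bound η puts the phase at T₁ into the flow box. The bound δ / 4 gives T₂ - T₁ < δ / 2, so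
    -- the flow box started at T₁ reaches beyond T₂ by at least δ / 2.
    refine ⟨min η (δ / 4), by positivity, fun T₁ hT₁ T₂ h₁ h₂ hS ↦ ?_⟩
    obtain ⟨ε, hε, σ, hσ⟩ := hS
    rcases le_or_gt T₂ T₁ with hle | hlt
    · exact ⟨ε, hε, σ, hσ.mono le_rfl (by linarith)⟩
    have hT₁1 := hT₁.2
    have hT₁0 := hT₁.1
    obtain ⟨hz, hq₁⟩ := hball ⟨by
      rw [Metric.mem_ball, Real.dist_eq]; exact h₁.trans_le (min_le_left _ _), hT₁⟩
    -- The end point c is positive even when T₁ = 0, so that [0, c] is a nondegenerate interval on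
    -- which the family and γ can be compared.
    obtain ⟨c, hc0, hc1, hcT, hcε⟩ : ∃ c > 0, c ≤ 1 ∧ T₁ ≤ c ∧ c < T₁ + ε :=
      ⟨min (T₁ + ε / 2) 1, lt_min (by linarith) one_pos, min_le_right _ _,
        le_min (by linarith) hT₁.2, (min_le_left _ _).trans_lt (by linarith)⟩
    obtain ⟨heq, hph⟩ := hσ.eqOn_Icc hcov hγ hγ0 hγv hc0 hc1 (by linarith) hcε
    have hT₁c : T₁ ∈ Icc 0 c := ⟨hT₁0, hcT⟩
    have hT₁' : T₁ ∈ Ioo (-ε) (T₁ + ε) := ⟨by linarith, by linarith⟩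
    have hq₁' : σ v T₁ ∈ (chartAt E (γ t₀)).source := by rwa [heq hT₁c]
    have hdiff := hσ.isDifferentiableFamilyAt hT₁' hq₁'
    obtain ⟨τ, hτ, hτ'⟩ := hfam v (fun w ↦ phase (γ t₀) (σ w) univ T₁) hdiff.2
      (by rw [hph T₁ hT₁c _ hq₁]; exact hz) T₁
    obtain ⟨σ', hσ'⟩ := hσ.exists_extend hcov hT₁' ⟨by linarith, hT₁0⟩ hδ hq₁' hτ
      fun t ht ↦ (hτ' t ht).1
    have h₁' := (h₁.trans_le (min_le_right _ _))
    have h₂' := (h₂.trans_le (min_le_right _ _))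
    rw [abs_lt] at h₁' h₂'
    refine ⟨min ε (δ / 2), by positivity, σ', hσ'.mono (neg_le_neg (min_le_left _ _)) ?_⟩
    linarith [min_le_right ε (δ / 2)]
  have hconn := (isPreconnected_Icc (a := (0 : ℝ)) (b := 1)).induction₂ (fun T₁ T₂ ↦ S T₁ ↔ S T₂)
    (fun t₀ ht₀ ↦ by
      obtain ⟨δ, hδ, h⟩ := hstep t₀ ht₀
      filter_upwards [self_mem_nhdsWithin, mem_nhdsWithin_of_mem_nhds (Metric.ball_mem_nhds t₀ hδ)]
        with T hT hT'
      rw [Metric.mem_ball, Real.dist_eq] at hT'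
      have h0 : |t₀ - t₀| < δ := by simpa using hδ
      exact ⟨h t₀ ht₀ T h0 hT', h T hT t₀ hT' h0⟩)
    (fun T₁ T₂ T₃ _ _ _ h₁ h₂ ↦ h₁.trans h₂) (fun T₁ T₂ _ _ h ↦ h.symm)
    (left_mem_Icc.2 zero_le_one) (right_mem_Icc.2 zero_le_one)
  exact hconn.1 (exists_zero hcov p v)

/-- The variation of a family of geodesics satisfies the linearized geodesic equation. -/
theorem hasDerivAt_fderiv_phase (h : IsGeodesicFamily cov p v a b σ) (ht : t ∈ Ioo a b)
    (hq : σ v t ∈ (chartAt E q).source) :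
    ∀ᶠ t' in 𝓝 t, HasDerivAt (fun t ↦ fderiv ℝ (fun w ↦ phase (E := E) q (σ w) univ t) v)
      ((fderiv ℝ (geodesicField cov q) (phase q (σ v) univ t')).comp
        (fderiv ℝ (fun w ↦ phase (E := E) q (σ w) univ t') v)) t' := by
  have hd := h.isDifferentiableFamilyAt ht hq
  obtain ⟨δ, hδ, r, hr, hfam⟩ := exists_local_family (q := q) hcov
    (z₀ := phase q (σ v) univ t) (extChartAt_mem_target hq)
  -- The family is restarted at time t inside one flow box. Uniqueness gives agreement on a time
  -- interval common to all w near v, so the linearized equation of the flow box passes to σ.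
  obtain ⟨τ, hτ, hτ'⟩ := hfam v (fun w ↦ phase q (σ w) univ t) hd.2 (Metric.mem_ball_self hr) t
  have ht' : t ∈ Ioo (t - δ) (t + δ) := ⟨by linarith, by linarith⟩
  have hmem : Ioo (max a (t - δ)) (min b (t + δ)) ∈ 𝓝 t :=
    Ioo_mem_nhds (max_lt ht.1 ht'.1) (lt_min ht.2 ht'.2)
  have key : ∀ᶠ w in 𝓝 v, EqOn (σ w) (τ w) (Ioo (max a (t - δ)) (min b (t + δ))) := by
    filter_upwards [h.geodesic, hτ, hd.1] with w h1 h2 h3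
    refine eqOn_of_phase_eq hcov isOpen_Ioo.uniqueDiffOn ordConnected_Ioo
      (h1.1.mono isOpen_Ioo.uniqueDiffOn isOpen_Ioo.uniqueDiffOn
        (Ioo_subset_Ioo (le_max_left _ _) (min_le_left _ _)))
      (h2.1.mono isOpen_Ioo.uniqueDiffOn isOpen_Ioo.uniqueDiffOn
        (Ioo_subset_Ioo (le_max_right _ _) (min_le_right _ _))) (mem_of_mem_nhds hmem) h3
        (h2.2.1.trans (extChartAt_left_inv h3)).symm ?_
    rw [phase_of_mem_nhds hmem, phase_of_mem_nhds hmem, h2.2.2]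
  have hphase : ∀ t' ∈ Ioo (max a (t - δ)) (min b (t + δ)), ∀ᶠ w in 𝓝 v,
      phase (E := E) q (σ w) univ t' = phase q (τ w) univ t' := fun t' ht' ↦ by
    filter_upwards [key] with w hw
    exact phase_congr (hw.eventuallyEq_of_mem (isOpen_Ioo.mem_nhds ht'))
  have hfd : ∀ t' ∈ Ioo (max a (t - δ)) (min b (t + δ)),
      fderiv ℝ (fun w ↦ phase (E := E) q (σ w) univ t') v =
        fderiv ℝ (fun w ↦ phase (E := E) q (τ w) univ t') v :=
    fun t' ht' ↦ Filter.EventuallyEq.fderiv_eq (hphase t' ht')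
  filter_upwards [hmem] with t' ht'
  rw [hfd t' ht', (hphase t' ht').self_of_nhds]
  refine ((hτ' t' ⟨(le_max_right _ _).trans_lt ht'.1, ht'.2.trans_le (min_le_right _ _)⟩).2
    ).congr_of_eventuallyEq ?_
  filter_upwards [isOpen_Ioo.mem_nhds ht'] with t'' ht'' using hfd t'' ht''

end

end IsGeodesicFamily

end CoordinateFrame

end

noncomputable section

open Connection

/-! ## Jacobi fields and the exponential map -/

namespace CoordinateFrame

variable {E : Type*} [NormedAddCommGroup E] [NormedSpace ℝ E] [FiniteDimensional ℝ E]
  {M : Type*} [TopologicalSpace M] [ChartedSpace E M] [IsManifold 𝓘(ℝ, E) ∞ M]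
  {cov : CovariantDerivative 𝓘(ℝ, E) E (TangentSpace 𝓘(ℝ, E) : M → Type _)}
  {p q x : M} {γ γ₁ γ₂ : ℝ → M} {s : Set ℝ} {t : ℝ} {v : E} {σ : E → ℝ → M}

theorem IsDifferentiableFamilyAt.mdifferentiableAt (h : IsDifferentiableFamilyAt v σ t q) :
    MDifferentiableAt 𝓘(ℝ, E) 𝓘(ℝ, E) (fun w ↦ σ w t) v := by
  have hq := h.1.self_of_nhds
  have h1 : MDifferentiableAt 𝓘(ℝ, E) 𝓘(ℝ, E) (fun w ↦ extChartAt 𝓘(ℝ, E) q (σ w t)) v :=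
    h.2.fst.mdifferentiableAt
  have h2 := ((contMDiffAt_chart_symm (extChartAt_mem_target hq)).mdifferentiableAt
    (by simp)).comp v h1
  refine h2.congr_of_eventuallyEq ?_
  filter_upwards [h.1] with w hw using (extChartAt_left_inv hw).symm

theorem IsDifferentiableFamilyAt.coord_mfderiv (h : IsDifferentiableFamilyAt v σ t q) (w : E) :
    coord q (σ v t) (mfderiv 𝓘(ℝ, E) 𝓘(ℝ, E) (fun w ↦ σ w t) v w) =
      (fderiv ℝ (fun w ↦ phase (E := E) q (σ w) univ t) v w).1 := by
  have hq := h.1.self_of_nhds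
  have h1 : HasMFDerivAt 𝓘(ℝ, E) 𝓘(ℝ, E) (extChartAt 𝓘(ℝ, E) q) (σ v t) (coord q (σ v t)) := by
    rw [coord_eq_mfderiv hq]
    exact ((contMDiffAt_chart hq).mdifferentiableAt (by simp)).hasMFDerivAt
  have h2 : HasFDerivAt (fun w ↦ extChartAt 𝓘(ℝ, E) q (σ w t))
      ((coord q (σ v t)).comp (mfderiv 𝓘(ℝ, E) 𝓘(ℝ, E) (fun w ↦ σ w t) v) : E →L[ℝ] E) v :=
    (h1.comp v h.mdifferentiableAt.hasMFDerivAt).hasFDerivAt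
  have h3 := h.2.hasFDerivAt.fst
  exact congrArg (fun L : E →L[ℝ] E ↦ L w) (h2.unique h3)

section

variable [T2Space M] (hcov : CovariantDerivative.ContMDiffCovariantDerivative cov ∞)
include hcov

set_option synthInstance.maxHeartbeats 200000 in
theorem fderiv_geodesicField {z : E × E} (hz : z.1 ∈ (chartAt E p).target) (u : E × E) :
    fderiv ℝ (geodesicField cov p) z u = (u.2, - fderiv ℝ (christoffel cov p) z.1 u.1 z.2 z.2 -
      christoffel cov p z.1 u.2 z.2 - christoffel cov p z.1 z.2 u.2) := by
  have hΓ := (((contDiffOn_christoffel cov hcov p).contDiffAt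
    ((chartAt E p).open_target.mem_nhds hz)).differentiableAt (by simp)).hasFDerivAt
  have h1 := HasFDerivAt.comp (f := Prod.fst) z hΓ (hasFDerivAt_fst (𝕜 := ℝ) (E := E) (F := E))
  have h2 := hasFDerivAt_snd (𝕜 := ℝ) (E := E) (F := E) (p := z)
  have h3 := h2.prodMk ((h1.clm_apply h2).clm_apply h2).fun_neg
  have h4 : fderiv ℝ (geodesicField cov p) z = _ := h3.fderiv
  rw [h4]
  refine Prod.ext rfl ?_
  simp
  abel

/-- The linearized phase equation applied to w: its position component is the Jacobi field j and its
velocity component the coordinate derivative k. -/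
theorem IsGeodesicFamily.isJacobiAt {a b : ℝ} (h : IsGeodesicFamily cov p v a b σ)
    (ht : t ∈ Ioo a b) (hq : σ v t ∈ (chartAt E q).source) (w : E) :
    ∀ᶠ t' in 𝓝 t, (phase q (σ v) univ t').1 ∈ (chartAt E q).target ∧
      LocalConnection.IsJacobiAt (christoffel cov q)
      (fun t ↦ (phase q (σ v) univ t).1) (fun t ↦ (phase q (σ v) univ t).2)
      (fun t ↦ (fderiv ℝ (fun w ↦ phase (E := E) q (σ w) univ t) v w).1)
      (fun t ↦ (fderiv ℝ (fun w ↦ phase (E := E) q (σ w) univ t) v w).2) t' := by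
  have hproj := h.geodesic.self_of_nhds.1.isProjectionAt_univ isOpen_Ioo ht hq
  have hph := hproj.phase_eq uniqueDiffOn_univ
  have hev := hproj.eventually
  have hsrc := eventually_mem_source hproj.continuousWithinAt hq
  rw [nhdsWithin_univ] at hph hev hsrc
  filter_upwards [hph.eventually_nhds, hev, hsrc, h.hasDerivAt_fderiv_phase hcov ht hq]
    with t' h1 h2 h3 h4
  have hz : (phase q (σ v) univ t').1 ∈ (chartAt E q).target := extChartAt_mem_target h3
  have h5 : HasDerivAt (fun t ↦ phase q (σ v) univ t)
      (geodesicField cov q (phase q (σ v) univ t')) t' := by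
    have := (hasDerivWithinAt_univ.1 h2.2).congr_of_eventuallyEq h1
    rwa [← h1.self_of_nhds] at this
  have h6 := h4.clm_apply (hasDerivAt_const t' w)
  rw [ContinuousLinearMap.comp_apply, map_zero, add_zero, fderiv_geodesicField hcov hz] at h6
  exact ⟨hz, h5.hasFDerivAt.fst.hasDerivAt.congr_deriv (by simp [geodesicField]),
    h5.hasFDerivAt.snd.hasDerivAt.congr_deriv (by simp [geodesicField]),
    h6.hasFDerivAt.fst.hasDerivAt.congr_deriv (by simp),
    h6.hasFDerivAt.snd.hasDerivAt.congr_deriv (by simp)⟩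

end

theorem mk_eq_mk_iff {u : TangentSpace 𝓘(ℝ, E) x} {v : TangentSpace 𝓘(ℝ, E) p} :
    (⟨x, u⟩ : TangentBundle 𝓘(ℝ, E) M) = ⟨p, v⟩ ↔ x = p ∧ coord p x u = v := by
  constructor
  · intro h
    have h1 : x = p := congrArg TotalSpace.proj h
    refine ⟨h1, ?_⟩
    rw [coord_eq_snd (by rw [h1]; exact mem_chart_source E p), h,
      ← coord_eq_snd (mem_chart_source E p), coord_self]
  · rintro ⟨rfl, h⟩
    rw [coord_self] at h
    rw [h]

theorem isGeodesicFrom_iff {v : TangentSpace 𝓘(ℝ, E) p} :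
    IsGeodesicFrom cov p v γ ↔ IsGeodesicOn cov γ (Icc 0 1) ∧ γ 0 = p ∧
      phase p γ (Icc 0 1) 0 = (extChartAt 𝓘(ℝ, E) p p, v) := by
  refine and_congr_right fun h ↦ ?_
  rw [mk_eq_mk_iff]
  refine and_congr_right fun h0 ↦ ?_
  have hp : γ 0 ∈ (chartAt E p).source := by rw [h0]; exact mem_chart_source E p
  have h01 := left_mem_Icc.2 (zero_le_one' ℝ)
  rw [coord_velocity (uniqueDiffOn_Icc zero_lt_one 0 h01)
    ((h.1 0 h01).mdifferentiableWithinAt one_ne_zero) hp]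
  exact ⟨fun e ↦ Prod.ext (by simp only [phase, h0]) e, fun e ↦ congrArg Prod.snd e⟩

/-- By uniqueness of geodesics the choice made in `expMap` is immaterial. -/
theorem expMap_eq [T2Space M] (hcov : CovariantDerivative.ContMDiffCovariantDerivative cov ∞)
    {v : TangentSpace 𝓘(ℝ, E) p} (h : IsGeodesicFrom cov p v γ) : expMap cov p v = γ 1 := by
  have hex : ∃ γ, IsGeodesicFrom cov p v γ := ⟨γ, h⟩
  have hch := isGeodesicFrom_iff.1 hex.choose_spec
  have h := isGeodesicFrom_iff.1 h
  rw [expMap, dif_pos hex]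
  exact eqOn_of_phase_eq hcov (uniqueDiffOn_Icc zero_lt_one) ordConnected_Icc hch.1 h.1
    (left_mem_Icc.2 zero_le_one) (by rw [hch.2.1]; exact mem_chart_source E p)
    (hch.2.1.trans h.2.1.symm) (hch.2.2.trans h.2.2.symm) (right_mem_Icc.2 zero_le_one)

theorem IsGeodesicFamily.isGeodesicFrom {ε : ℝ} (h : IsGeodesicFamily cov p v (-ε) (1 + ε) σ)
    (hε : 0 < ε) : ∀ᶠ w in 𝓝 v, IsGeodesicFrom cov p (w : TangentSpace 𝓘(ℝ, E) p) (σ w) := by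
  have hsub : Icc (0 : ℝ) 1 ⊆ Ioo (-ε) (1 + ε) := fun t ht ↦
    ⟨by linarith [ht.1], by linarith [ht.2]⟩
  have h01 := left_mem_Icc.2 (zero_le_one' ℝ)
  have hu := uniqueDiffOn_Icc (zero_lt_one' ℝ)
  filter_upwards [h.geodesic] with w hw
  refine isGeodesicFrom_iff.2 ⟨hw.1.mono isOpen_Ioo.uniqueDiffOn hu hsub, hw.2.1, ?_⟩
  rw [phase_mono hw.1 isOpen_Ioo.uniqueDiffOn hu hsub h01
    (by rw [hw.2.1]; exact mem_chart_source E p),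
    phase_of_mem_nhds (isOpen_Ioo.mem_nhds (hsub h01))]
  exact hw.2.2

/-- Near v the exponential map is the time-one map of the family, so its differential gives the
time-one values of Jacobi fields. -/
theorem IsGeodesicFamily.dExp_eq [T2Space M]
    (hcov : CovariantDerivative.ContMDiffCovariantDerivative cov ∞) {ε : ℝ}
    (h : IsGeodesicFamily cov p v (-ε) (1 + ε) σ) (hε : 0 < ε) (w : E) :
    (dExp cov p v w : E) = mfderiv 𝓘(ℝ, E) 𝓘(ℝ, E) (fun w ↦ σ w 1) v w := by
  have h1 : (fun w : E ↦ expMap cov p (w : TangentSpace 𝓘(ℝ, E) p)) =ᶠ[𝓝 v] fun w ↦ σ w 1 := by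
    filter_upwards [h.isGeodesicFrom hε] with w hw using expMap_eq hcov hw
  have h2 := h1.mfderiv_eq (I := 𝓘(ℝ, E)) (I' := 𝓘(ℝ, E))
  exact congrArg (fun L : E →L[ℝ] E ↦ L w) h2

/-- The part of a geodesic between two parameters, reparametrized by `[0, 1]`. -/
theorem _root_.Connection.IsGeodesicOn.isGeodesicFrom (h : IsGeodesicOn cov γ s)
    (hs : s.OrdConnected) {a b : ℝ} (ha : a ∈ s) (hb : b ∈ s) (hab : a ≠ b) :
    IsGeodesicFrom cov (γ a) ((b - a) • velocity 𝓘(ℝ, E) γ s a)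
      (fun u ↦ γ (a + (b - a) * u)) := by
  -- Two distinct parameters give s an interior; either order is allowed, and b < a means running
  -- along the geodesic backwards.
  have hus : UniqueDiffOn ℝ s := by
    refine uniqueDiffOn_convex hs.convex ?_
    rcases hab.lt_or_gt with h | h
    · exact ((nonempty_Ioo.2 h).mono (interior_maximal
        (Ioo_subset_Icc_self.trans (hs.out ha hb)) isOpen_Ioo))
    · exact ((nonempty_Ioo.2 h).mono (interior_maximal
        (Ioo_subset_Icc_self.trans (hs.out hb ha)) isOpen_Ioo))
  have hu := uniqueDiffOn_Icc (zero_lt_one' ℝ)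
  have h01 := left_mem_Icc.2 (zero_le_one' ℝ)
  have hmaps : MapsTo (fun u ↦ a + (b - a) * u) (Icc 0 1) s := fun u hu ↦ by
    have : a + (b - a) * u = (1 - u) • a + u • b := by simp only [smul_eq_mul]; ring
    simp only [this]
    exact hs.convex ha hb (by linarith [hu.2]) hu.1 (by ring)
  have hp := mem_chart_source E (γ a)
  have h0 : γ (a + (b - a) * 0) = γ a := by simp
  refine isGeodesicFrom_iff.2 ⟨h.comp_affine hus hmaps hu, h0, ?_⟩
  rw [phase_comp_affine h hus hmaps hu h01 (by rw [h0]; exact hp)]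
  have e := coord_velocity (p := γ a) (hus a ha)
    ((h.1 a ha).mdifferentiableWithinAt one_ne_zero) hp
  rw [coord_self] at e
  refine Prod.ext (by simp [phase]) ?_
  simp only [phase, mul_zero, add_zero]
  exact congrArg (fun y : E ↦ (b - a) • y) e.symm

end CoordinateFrame

end

/-! ### Convexity of the Jacobi energy and injectivity of d exp -/

noncomputable section

set_option synthInstance.maxHeartbeats 200000
set_option maxHeartbeats 1000000
open Connection

/-- A convex function lies below its chord. The derivatives are given only locally because their
formulas come from a chart that changes with t. -/
theorem nonpos_of_second_deriv_nonneg {f : ℝ → ℝ} (hc : ContinuousOn f (Icc 0 1))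
    (hf : ∀ t ∈ Ioo (0 : ℝ) 1, ∃ (f₁ : ℝ → ℝ) (f₂ : ℝ), (∀ᶠ r in 𝓝 t, HasDerivAt f (f₁ r) r) ∧
      HasDerivAt f₁ f₂ t ∧ 0 ≤ f₂) (h0 : f 0 = 0) (h1 : f 1 = 0) {t : ℝ} (ht : t ∈ Icc (0 : ℝ) 1) :
    f t ≤ 0 := by
  have key : ∀ t ∈ Ioo (0 : ℝ) 1, DifferentiableAt ℝ f t ∧ DifferentiableAt ℝ (deriv f) t ∧
      0 ≤ deriv (deriv f) t := fun t ht ↦ by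
    obtain ⟨f₁, f₂, h1, h2, h3⟩ := hf t ht
    have h4 : deriv f =ᶠ[𝓝 t] f₁ := h1.mono fun r hr ↦ hr.deriv
    have h5 := h2.congr_of_eventuallyEq h4
    exact ⟨h1.self_of_nhds.differentiableAt, h5.differentiableAt, h5.deriv ▸ h3⟩
  have hconv : ConvexOn ℝ (Icc 0 1) f := by
    refine convexOn_of_deriv2_nonneg (convex_Icc 0 1) hc ?_ ?_ ?_ <;> rw [interior_Icc]
    · exact fun t ht ↦ (key t ht).1.differentiableWithinAt
    · exact fun t ht ↦ (key t ht).2.1.differentiableWithinAt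
    · exact fun t ht ↦ (key t ht).2.2
  have := hconv.2 (left_mem_Icc.2 zero_le_one) (right_mem_Icc.2 zero_le_one)
    (show 0 ≤ 1 - t by linarith [ht.2]) ht.1 (by ring)
  simpa [h0, h1] using this

theorem LocalConnection.IsSasakian.Ω_of_G_eq_zero {E : Type*} [NormedAddCommGroup E]
    [NormedSpace ℝ E] {U : Set E} {Γ : E → E →L[ℝ] E →L[ℝ] E} {θ : E → E →L[ℝ] ℝ}
    {Ω G : E → E →L[ℝ] E →L[ℝ] ℝ} {ξ : E → E} (h : IsSasakian U Γ θ Ω G ξ) {x j : E} (hx : x ∈ U)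
    (hj : G x j j = 0) (y : E) : Ω x y j = 0 := by
  rw [h.Ω_swap x hx, h.eq_of_G_eq_zero x hx j hj, map_smul, smul_apply, h.Ω_ξ x hx, smul_zero,
    neg_zero]

namespace PseudoHermitianStructure

open CoordinateFrame LocalConnection

variable {m : ℕ} {M : Type*} [TopologicalSpace M] [T2Space M]
  [ChartedSpace (EuclideanSpace ℝ (Fin (2 * m + 1))) M] [IsManifold (𝓡 (2 * m + 1)) ∞ M]
  {P : PseudoHermitianStructure m M}
  {cov : CovariantDerivative (𝓡 (2 * m + 1)) (EuclideanSpace ℝ (Fin (2 * m + 1)))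
    (TangentSpace (𝓡 (2 * m + 1)) : M → Type _)}
  {p : M} {v : EuclideanSpace ℝ (Fin (2 * m + 1))} {a b : ℝ}
  {σ : EuclideanSpace ℝ (Fin (2 * m + 1)) → ℝ → M}

variable (P) in
/-- The square of the length of the horizontal part of a Jacobi field. -/
def jacobiEnergy (σ : EuclideanSpace ℝ (Fin (2 * m + 1)) → ℝ → M)
    (v w : EuclideanSpace ℝ (Fin (2 * m + 1))) (t : ℝ) : ℝ :=
  P.dθ (σ v t) (mfderiv (𝓡 (2 * m + 1)) (𝓡 (2 * m + 1)) (fun w ↦ σ w t) v w)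
    (P.J (σ v t) (mfderiv (𝓡 (2 * m + 1)) (𝓡 (2 * m + 1)) (fun w ↦ σ w t) v w))

variable (P) in
/-- The component of a Jacobi field along the Reeb vector field. -/
def jacobiθ (σ : EuclideanSpace ℝ (Fin (2 * m + 1)) → ℝ → M)
    (v w : EuclideanSpace ℝ (Fin (2 * m + 1))) (t : ℝ) : ℝ :=
  P.θ (σ v t) (mfderiv (𝓡 (2 * m + 1)) (𝓡 (2 * m + 1)) (fun w ↦ σ w t) v w)

section

variable (hcov : P.IsTanakaWebster cov) (hσ : IsGeodesicFamily cov p v a b σ)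
include hcov hσ

theorem eventually_frame_eq {t : ℝ} (ht : t ∈ Ioo a b) {q : M}
    (hq : σ v t ∈ (chartAt (EuclideanSpace ℝ (Fin (2 * m + 1))) q).source)
    (w : EuclideanSpace ℝ (Fin (2 * m + 1))) :
    ∀ᶠ r in 𝓝 t, σ v r ∈ (chartAt (EuclideanSpace ℝ (Fin (2 * m + 1))) q).source ∧
      frame q ((fderiv ℝ (fun w ↦ phase (E := EuclideanSpace ℝ (Fin (2 * m + 1)))
        q (σ w) univ r) v w).1) (σ v r) =
        mfderiv (𝓡 (2 * m + 1)) (𝓡 (2 * m + 1)) (fun w ↦ σ w r) v w := by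
  have hsrc := eventually_mem_source
    (hσ.geodesic.self_of_nhds.1.isProjectionAt_univ isOpen_Ioo ht hq).continuousWithinAt hq
  rw [nhdsWithin_univ] at hsrc
  filter_upwards [hsrc, isOpen_Ioo.mem_nhds ht] with r hr hr'
  refine ⟨hr, ?_⟩
  rw [← (hσ.isDifferentiableFamilyAt hr' hr).coord_mfderiv]
  exact frameL_coord hr _

/-- The second derivative of the energy of a Jacobi field is nonnegative. -/
theorem hasDerivAt_jacobiEnergy (hS : P.IsSasakian cov) (hK : P.HasNonposHorizontalCurvature cov)
    {t : ℝ} (ht : t ∈ Ioo a b) (w : EuclideanSpace ℝ (Fin (2 * m + 1))) :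
    ∃ (f₁ : ℝ → ℝ) (f₂ : ℝ), (∀ᶠ r in 𝓝 t, HasDerivAt (P.jacobiEnergy σ v w) (f₁ r) r) ∧
      HasDerivAt f₁ f₂ t ∧ 0 ≤ f₂ := by
  -- The chart is centred at the current point because the curvature inequality is available only at
  -- the centre. This suffices: the second derivative is needed at t alone.
  set q := σ v t with hq_def
  have hq : σ v t ∈ (chartAt (EuclideanSpace ℝ (Fin (2 * m + 1))) q).source := mem_chart_source _ _
  have hSas := hcov.isSasakian_coord hS q
  have hJ := hσ.isJacobiAt hcov.smooth ht hq w
  have hfr := eventually_frame_eq hcov hσ ht hq w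
  have hQ : ∀ᶠ r in 𝓝 t, P.jacobiEnergy σ v w r =
      P.coordG q (phase q (σ v) univ r).1 (fderiv ℝ (fun w ↦ phase q (σ w) univ r) v w).1
        (fderiv ℝ (fun w ↦ phase q (σ w) univ r) v w).1 := by
    filter_upwards [hfr] with r hr
    refine Eq.trans ?_ (P.coordG_chart hr.1 _ _).symm
    rw [hr.2]
    rfl
  refine ⟨_, _, ?_, hJ.self_of_nhds.2.hasDerivAt_deriv_energy hSas hJ.self_of_nhds.1, ?_⟩
  · filter_upwards [hJ, hQ.eventually_nhds] with r hr hr'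
    exact (hr.2.hasDerivAt_energy hSas hr.1).congr_of_eventuallyEq hr'
  · have h1 := hSas.G_nonneg _ hJ.self_of_nhds.1
    have h2 := hSas.G_curv_nonneg hJ.self_of_nhds.1
      (fun u v hu hv ↦ hcov.coordG_curv_nonpos hK q u v hu hv)
    exact mul_nonneg zero_le_two (add_nonneg (h1 _) (h2 _ _))

theorem continuousAt_jacobiEnergy (hS : P.IsSasakian cov)
    (hK : P.HasNonposHorizontalCurvature cov)
    {t : ℝ} (ht : t ∈ Ioo a b) (w : EuclideanSpace ℝ (Fin (2 * m + 1))) :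
    ContinuousAt (P.jacobiEnergy σ v w) t := by
  obtain ⟨f₁, f₂, h, -⟩ := hasDerivAt_jacobiEnergy hcov hσ hS hK ht w
  exact h.self_of_nhds.continuousAt

/-- In general θ(j)' = θ(Y) + Ω(y, j). Where the energy vanishes, j is a multiple of ξ and the Ω
term drops, leaving θ(Y), which is constant. The first conjunct supplies continuity up to the end
points. -/
theorem hasDerivAt_jacobiθ (hS : P.IsSasakian cov) {t : ℝ} (ht : t ∈ Ioo a b)
    (w : EuclideanSpace ℝ (Fin (2 * m + 1))) :
    (∃ f₁, HasDerivAt (P.jacobiθ σ v w) f₁ t) ∧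
    ((∀ᶠ r in 𝓝 t, P.jacobiEnergy σ v w r = 0) → ∃ f₁ : ℝ → ℝ,
      (∀ᶠ r in 𝓝 t, HasDerivAt (P.jacobiθ σ v w) (f₁ r) r) ∧ HasDerivAt f₁ 0 t) := by
  set q := σ v t with hq_def
  have hq : σ v t ∈ (chartAt (EuclideanSpace ℝ (Fin (2 * m + 1))) q).source := mem_chart_source _ _
  have hSas := hcov.isSasakian_coord hS q
  have hJ := hσ.isJacobiAt hcov.smooth ht hq w
  have hfr := eventually_frame_eq hcov hσ ht hq w
  have hb : ∀ᶠ r in 𝓝 t, P.jacobiθ σ v w r =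
      P.coordθ q (phase q (σ v) univ r).1 (fderiv ℝ (fun w ↦ phase q (σ w) univ r) v w).1 := by
    filter_upwards [hfr] with r hr
    refine Eq.trans ?_ (P.coordθ_chart hr.1 _).symm
    rw [hr.2]
    rfl
  have hb' := hJ.and hb.eventually_nhds |>.mono fun r hr ↦
    (hr.1.2.hasDerivAt_θ_j hSas hr.1.1).congr_of_eventuallyEq hr.2
  refine ⟨⟨_, hb'.self_of_nhds⟩, fun h0 ↦ ⟨_, ?_,
    hJ.self_of_nhds.2.hasDerivAt_θ_covDeriv hSas hJ.self_of_nhds.1⟩⟩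
  filter_upwards [hb', hJ, h0, hfr] with r h1 h2 h3 h4
  refine h1.congr_deriv ?_
  have h5 := hSas.Ω_of_G_eq_zero h2.1 (j := (fderiv ℝ (fun w ↦ phase q (σ w) univ r) v w).1) (by
    refine (P.coordG_chart h4.1 _ _).trans ?_
    rw [h4.2]
    exact h3) (phase q (σ v) univ r).2
  exact (congrArg (_ + ·) h5).trans (add_zero _)

end

/-- A Jacobi field which vanishes at `0` and at `1` vanishes on `[0, 1]`. -/
theorem mfderiv_eq_zero (hcov : P.IsTanakaWebster cov) (hS : P.IsSasakian cov)
    (hK : P.HasNonposHorizontalCurvature cov) (hσ : IsGeodesicFamily cov p v a b σ) (ha : a < 0)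
    (hb : 1 < b) {w : EuclideanSpace ℝ (Fin (2 * m + 1))}
    (h0 : mfderiv (𝓡 (2 * m + 1)) (𝓡 (2 * m + 1)) (fun w ↦ σ w 0) v w = 0)
    (h1 : mfderiv (𝓡 (2 * m + 1)) (𝓡 (2 * m + 1)) (fun w ↦ σ w 1) v w = 0) {t : ℝ}
    (ht : t ∈ Icc (0 : ℝ) 1) :
    mfderiv (𝓡 (2 * m + 1)) (𝓡 (2 * m + 1)) (fun w ↦ σ w t) v w = 0 := by
  have hsub : Icc (0 : ℝ) 1 ⊆ Ioo a b := fun t ht ↦ ⟨by linarith [ht.1], by linarith [ht.2]⟩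
  have hQ : ∀ t ∈ Icc (0 : ℝ) 1, P.jacobiEnergy σ v w t = 0 := fun t ht ↦ by
    refine le_antisymm (nonpos_of_second_deriv_nonneg
      (fun r hr ↦ (continuousAt_jacobiEnergy hcov hσ hS hK (hsub hr) w).continuousWithinAt)
      (fun r hr ↦ hasDerivAt_jacobiEnergy hcov hσ hS hK (hsub (Ioo_subset_Icc_self hr)) w)
      ?_ ?_ ht) (P.levi_nonneg _)
    · rw [jacobiEnergy, h0, map_zero, map_zero]
      rfl
    · rw [jacobiEnergy, h1, map_zero, map_zero]
      rfl
  have hc : ∀ t ∈ Icc (0 : ℝ) 1, ContinuousAt (P.jacobiθ σ v w) t := fun t ht ↦ by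
    obtain ⟨⟨_, h⟩, -⟩ := hasDerivAt_jacobiθ hcov hσ hS (hsub ht) w
    exact h.continuousAt
  have hd : ∀ t ∈ Ioo (0 : ℝ) 1, ∃ f₁ : ℝ → ℝ,
      (∀ᶠ r in 𝓝 t, HasDerivAt (P.jacobiθ σ v w) (f₁ r) r) ∧ HasDerivAt f₁ 0 t := fun t ht ↦ by
    refine (hasDerivAt_jacobiθ hcov hσ hS (hsub (Ioo_subset_Icc_self ht)) w).2 ?_
    filter_upwards [isOpen_Ioo.mem_nhds ht] with r hr using hQ r (Ioo_subset_Icc_self hr)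
  have hθ0 : P.jacobiθ σ v w 0 = 0 := by rw [jacobiθ, h0, map_zero]
  have hθ1 : P.jacobiθ σ v w 1 = 0 := by rw [jacobiθ, h1, map_zero]
  -- The Reeb component has zero second derivative, so the convexity bound applies both to it and to
  -- its negative.
  have hθ : P.jacobiθ σ v w t = 0 := by
    refine le_antisymm (nonpos_of_second_deriv_nonneg (fun r hr ↦ (hc r hr).continuousWithinAt)
      (fun r hr ↦ ?_) hθ0 hθ1 ht) (neg_nonpos.1 (nonpos_of_second_deriv_nonneg
        (f := fun t ↦ - P.jacobiθ σ v w t) (fun r hr ↦ (hc r hr).neg.continuousWithinAt)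
      (fun r hr ↦ ?_) (by rw [hθ0, neg_zero]) (by rw [hθ1, neg_zero]) ht))
    · obtain ⟨f₁, h2, h3⟩ := hd r hr
      exact ⟨f₁, 0, h2, h3, le_rfl⟩
    · obtain ⟨f₁, h2, h3⟩ := hd r hr
      exact ⟨fun t ↦ - f₁ t, - 0, h2.mono fun _ h ↦ h.neg, h3.neg, by simp⟩
  have h2 := P.eq_of_levi_eq_zero (hQ t ht)
  rw [h2]
  refine (congrArg (· • P.reeb (σ v t)) hθ).trans (zero_smul ℝ _)

/-- For w in the kernel, the Jacobi field vanishes at time 0, since all geodesics start at p, and at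
time 1. It then vanishes on [0, 1], while its coordinate derivative at 0 is w. -/
theorem injective_dExp (hcov : P.IsTanakaWebster cov) (hS : P.IsSasakian cov)
    (hK : P.HasNonposHorizontalCurvature cov) {v : EuclideanSpace ℝ (Fin (2 * m + 1))} {γ : ℝ → M}
    (hγ : IsGeodesicFrom cov p (v : TangentSpace (𝓡 (2 * m + 1)) p) γ) :
    Function.Injective (dExp cov p (v : TangentSpace (𝓡 (2 * m + 1)) p)) := by
  obtain ⟨hγ, hγ0, hγv⟩ := isGeodesicFrom_iff.1 hγ
  obtain ⟨ε, hε, σ, hσ⟩ := IsGeodesicFamily.exists_of_isGeodesicOn hcov.smooth hγ hγ0 hγv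
  rw [injective_iff_map_eq_zero]
  intro w hw
  have hp := mem_chart_source (EuclideanSpace ℝ (Fin (2 * m + 1))) p
  have hσp := hσ.geodesic.self_of_nhds.2.1
  have h0mem : (0 : ℝ) ∈ Ioo (-ε) (1 + ε) := ⟨by linarith, by linarith⟩
  have hq : σ v 0 ∈ (chartAt (EuclideanSpace ℝ (Fin (2 * m + 1))) p).source := by rwa [hσp]
  have hd0 : fderiv ℝ (fun w ↦ phase (E := EuclideanSpace ℝ (Fin (2 * m + 1))) p (σ w) univ 0) v w = (0, w) := by
    have h1 : (fun w ↦ phase (E := EuclideanSpace ℝ (Fin (2 * m + 1))) p (σ w) univ 0) =ᶠ[𝓝 v]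
        fun w ↦ (extChartAt (𝓡 (2 * m + 1)) p p, w) := hσ.geodesic.mono fun w hw ↦ hw.2.2
    have h2 := ((hasFDerivAt_const (extChartAt (𝓡 (2 * m + 1)) p p) v).prodMk
      (hasFDerivAt_id (𝕜 := ℝ) v)).congr_of_eventuallyEq h1
    exact congrArg (fun L ↦ L w) h2.fderiv
  have h0 : mfderiv (𝓡 (2 * m + 1)) (𝓡 (2 * m + 1)) (fun w ↦ σ w 0) v w = 0 := by
    have h1 := (hσ.isDifferentiableFamilyAt h0mem hq).coord_mfderiv w
    rw [hd0] at h1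
    have h2 := frameL_coord hq (mfderiv (𝓡 (2 * m + 1)) (𝓡 (2 * m + 1)) (fun w ↦ σ w 0) v w)
    rw [h1, map_zero] at h2
    exact h2.symm
  have h1 : mfderiv (𝓡 (2 * m + 1)) (𝓡 (2 * m + 1)) (fun w ↦ σ w 1) v w = 0 :=
    (hσ.dExp_eq hcov.smooth hε w).symm.trans hw
  have hJ := (hσ.isJacobiAt hcov.smooth h0mem hq w).self_of_nhds.2.deriv_j
  rw [hd0] at hJ
  -- A one-sided derivative, since vanishing is known only for t ≥ 0; it still determines the
  -- derivative w.
  have hzero : HasDerivWithinAt (fun t ↦ (fderiv ℝ (fun w ↦ phase (E := EuclideanSpace ℝ (Fin (2 * m + 1))) p (σ w) univ t) v w).1) 0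
      (Ici 0) 0 := by
    refine (hasDerivWithinAt_const (0 : ℝ) (Ici 0) 0).congr_of_eventuallyEq ?_ (by rw [hd0])
    filter_upwards [mem_nhdsWithin_of_mem_nhds (eventually_frame_eq hcov hσ h0mem hq w),
      Icc_mem_nhdsGE (zero_lt_one' ℝ)] with t ht ht'
    have h2 := ht.2
    rw [mfderiv_eq_zero hcov hS hK hσ (by linarith) (by linarith) h0 h1 ht'] at h2
    rw [← coord_frame ht.1 ((fderiv ℝ (fun w ↦ phase (E := EuclideanSpace ℝ (Fin (2 * m + 1))) p (σ w) univ t) v w).1), h2, map_zero]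
  exact (uniqueDiffWithinAt_Ici 0).eq_deriv _ hJ.hasDerivWithinAt hzero

end PseudoHermitianStructure

theorem theorem4p4 (m : ℕ) {M : Type*} [TopologicalSpace M] [T2Space M]
    [ChartedSpace (EuclideanSpace ℝ (Fin (2 * m + 1))) M] [IsManifold (𝓡 (2 * m + 1)) ∞ M]
    (P : PseudoHermitianStructure m M)
    (cov : CovariantDerivative (𝓡 (2 * m + 1)) (EuclideanSpace ℝ (Fin (2 * m + 1)))
      (TangentSpace (𝓡 (2 * m + 1)) : M → Type _))
    (hcov : P.IsTanakaWebster cov) (hS : P.IsSasakian cov)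
    (hK : P.HasNonposHorizontalCurvature cov) :
    (∀ (β : ℝ) (γ : ℝ → M), 0 < β → Connection.IsGeodesicOn cov γ (Icc 0 β) →
      ∀ t ∈ Ioc 0 β, ¬ Connection.IsConjugateAlong cov γ (Icc 0 β) 0 t) ∧
    (Connection.IsCompleteConnection cov →
      ∀ (s : Set ℝ) (γ : ℝ → M), s.OrdConnected → Connection.IsGeodesicOn cov γ s →
        ∀ a ∈ s, ∀ b ∈ s, a ≠ b → ¬ Connection.IsConjugateAlong cov γ s a b) := by
  -- The piece from γ(a) to γ(b), reparametrized by [0, 1], is the geodesic with initial velocity (b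
  -- - a)γ'(a), the vector at which conjugacy tests d exp.
  have key : ∀ (s : Set ℝ) (γ : ℝ → M), s.OrdConnected → Connection.IsGeodesicOn cov γ s →
      ∀ a ∈ s, ∀ b ∈ s, a ≠ b → ¬ Connection.IsConjugateAlong cov γ s a b :=
    fun s γ hs hγ a ha b hb hab h ↦
      h (P.injective_dExp hcov hS hK (hγ.isGeodesicFrom hs ha hb hab))
  exact ⟨fun β γ hβ hγ t ht ↦ key _ γ ordConnected_Icc hγ 0 (left_mem_Icc.2 hβ.le) t
    ⟨ht.1.le, ht.2⟩ ht.1.ne, fun _ ↦ key⟩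

end
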